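/- **Network.** Let $G$ be a connected simple graph on $m\ge 2$ nodes, with maximum degree $d$, diameter $D$ and Laplacian matrix $W$. Let $\|W\|_2$ be its spectral norm, $\lambda_2(W)>0$ its second smallest eigenvalue, $\chi(W)=\|W\|_2/\lambda_2(W)$, and $\sqrt{\boldsymbol W}=\sqrt W\otimes I_n$ with $n\ge 2$. **Problem.** Every node $i$ has a closed function $f_i:\mathbb R^n\to\mathbb R\cup\{+\infty\}$ with effective domain $X_i$; all $X_i$ have the same affine hull $S$. The function $f(\boldsymbol x)=\frac1m\sum_i f_i(x^i)$ is $\frac{\gamma}{m}$-strongly convex, $\gamma>0$. Let $\boldsymbol x_*=(x_*,\dots,x_*)$ minimise $f$ subject to $\sqrt{\boldsymbol W}\boldsymbol x=0$. Assume that $x_*$ lies in the relative interior of every $X_i$, and that $f_i$ is differentiable at $x_*$ (relative to $S$) with gradient (tangential to $S$) satisfying $\|\nabla f_i(x_*)\|\le B_*$, $B_*>0$. **Oracles.** Let $\xi\sim P_i$, and let $F_i(\cdot,\xi)$ be convex functions with effective domains in $S$ such that $F_i^*(\mu,\xi)=\max_x\{\mu^\top x-F_i(x,\xi)\}$ is attained,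 is differentiable in $\mu$, and satisfies $\mathbb E_\xi F_i^*(\mu,\xi)=f_i^*(\mu)$, $\mathbb E_\xi\exp(\|\nabla F_i^*(\mu,\xi)-\nabla f_i^*(\mu)\|^2/\sigma_i^2)\le \mathrm e$ and $\|\nabla F_i^*(\mu,\xi)\|_1\le B$ for all $\mu$ and $\xi$. Here $B>0$, and $\sigma_i>0$ is the same number for all nodes. **PPS quantization.** For $g\in\mathbb R^n$ and $M\ge1$ let $$\mathrm{PPS}_M(g)=\frac{\|[g]_+\|_1}{M}\sum_{s=1}^M e_{k_s}-\frac{\|[-g]_+\|_1}{M}\sum_{s=1}^M e_{l_s},$$ where $k_s$ and $l_s$ are independent categorical samples with probabilities proportional to $[g]_+$ and $[-g]_+$. A message of this form costs $2|\mathrm{float}|+2M\log_2 n$ bits. **Method.** Put $A_t=\sum_{k\le t}\alpha_k$, $\tau_t=\alpha_{t+1}/A_{t+1}$ and $\boldsymbol\mu_0=0$. At iteration $t$ every node $i$ computes the average $x^i(\mu_t^i,\boldsymbol\xi_t^i)$ of $r_t$ fresh independent samples of $\nabla F_i^*(\mu_t^i,\cdot)$ and sends $G_t^i=\mathrm{PPS}_{M_t}(x^i(\mu_t^i,\boldsymbol\xi_t^i))$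 to each of its neighbours. Then $\lambda^i_0=-\frac{\alpha_0}{\beta_0}\sum_jW_{ij}G^j_0$, $x^i_0=x^i(\mu^i_0,\boldsymbol\xi^i_0)$, and for $t\ge0$ $$z^i_t=-\tfrac1{\beta_t}\sum_{k\le t}\alpha_k\sum_jW_{ij}G^j_k,\qquad \mu^i_{t+1}=\tau_tz^i_t+(1-\tau_t)\lambda^i_t,$$ $$\lambda^i_{t+1}=\tau_t\Big(z^i_t-\tfrac{\alpha_{t+1}}{\beta_t}\sum_jW_{ij}G^j_{t+1}\Big)+(1-\tau_t)\lambda^i_t,\qquad x^i_{t+1}=\tfrac{\alpha_{t+1}}{A_{t+1}}x^i(\mu^i_{t+1},\boldsymbol\xi^i_{t+1})+\tfrac{A_t}{A_{t+1}}x^i_t .$$ **Parameters.** Put $L=m\|W\|_2/\gamma$, $R=B_*/\sqrt{m\lambda_2(W)}$, $\sigma^2=\|W\|_2\,m\,\sigma_i^2$, $\sigma_{r,M}^2=50\big(\frac{2(1-1/n)B^2}{\mathrm eM}+\frac{\sigma^2}{r}\big)$, and take $$\alpha_t=\frac{t+1}{2\sqrt2},\qquad \beta_t=L+\frac{\sigma_{r_t,M_t}(t+2)^{3/2}}{2^{1/4}\sqrt3R},\qquad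 M_t=\Big\lceil\frac{2(1-1/n)B^2}{\mathrm e\sigma^2}r_t\Big\rceil,$$ $$r_t=\Big\lceil\max\Big\{1,\frac{34\gamma\sigma_i^2\alpha_t}{\varepsilon}\chi(W)\max\Big\{18C_2,\Big(C_3+C_4\frac{\sqrt{m^3\lambda_2(W)}}{\gamma B_*}\Big)^2\Big\}\Big\}\Big\rceil .$$ With $\ell=\sqrt{3\ln(5/\delta)}$, here $C_2=1+\ln\frac5\delta$, $C_4=\sqrt2(1+\ell)$ and $C_3=(2J(T)+\sqrt2-1)(\sqrt2+(\sqrt2+1)\ell)+\sqrt2-2+2\sqrt2J(T)(1+\ell)$. **Claim.** There are absolute constants $C,k$ and a function $J:\mathbb N\to[0,\infty)$ with $J(T)\le C(1+\ln(T+1))^k$ for all $T$, such that for every problem and every $|\mathrm{float}|\in\mathbb N$ as above there is $a\in(0,1)$ with the following property. For all $\varepsilon>0$ and $0<\delta<1$ there is a number of iterations $T$ for which the output $\boldsymbol x=\boldsymbol x_T$ of the method with the above parameters satisfies $$P\big(f(\boldsymbol x)-f(\boldsymbol x_*)\le\varepsilon\big)>1-\delta,\qquad P\Big(\|\sqrt{\boldsymbol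 W}\boldsymbol x\|\le\frac{\varepsilon\sqrt{2m}}{B_*}\Big)>1-\delta,$$ and, if $\varepsilon\le a$, for which every node sends in total at most $$C\Big(1+\ln\tfrac1\varepsilon+\sqrt{\ln\tfrac1\delta}\Big)^kB^2d\,\ln n\,\max\Big\{\frac1{\sigma_i^2}\sqrt{\frac{DB_*^2}{\gamma\varepsilon md}},\ \frac{DB_*^2}{\varepsilon^2},\ \frac{m^2}{\gamma^2\varepsilon^2}\Big\}$$ bits, that is, $\widetilde O\Big(B^2d\log n\max\Big\{\sigma_i^{-2}\sqrt{\frac{DB_*^2}{\gamma\varepsilon md}},\frac{DB_*^2}{\varepsilon^2},\frac{m^2}{\gamma^2\varepsilon^2}\Big\}\Big)$ bits. -/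

import Mathlib

open MeasureTheory
open scoped RealInnerProductSpace MatrixOrder

universe u v

noncomputable section

/-- `ℝⁿ` with the Euclidean norm. -/
abbrev Vec (n : ℕ) : Type := EuclideanSpace ℝ (Fin n)

/-- Tabulated vectors `(x¹ … xᵐ)`, one vector of `ℝⁿ` per node, with the Euclidean norm. -/
abbrev Tab (V : Type u) (n : ℕ) : Type u := PiLp 2 (fun _ : V => Vec n)

/-- The Manhattan norm. -/
def l1Norm {n : ℕ} (v : Vec n) : ℝ := ∑ k, |v k|

/-! ### Convex conjugates and stochastic dual oracles

An extended-valued function `f : ℝⁿ → ℝ ∪ {+∞}` is represented by its effective domain `X` and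
its (finite) values on `X`; the values of `f` off `X` are never used. -/

/-- The Fenchel--Legendre conjugate `μ ↦ sup_{x ∈ X} (⟨μ, x⟩ - f x)`. -/
def conjOn {n : ℕ} (X : Set (Vec n)) (f : Vec n → ℝ) (μ : Vec n) : ℝ :=
  sSup ((fun x => ⟪μ, x⟫ - f x) '' X)

/-- The stochastic primal restoring function `x(μ, ξ) = ∇F*(μ, ξ)` (gradient in `μ`), where
`F*(·, ξ)` is the conjugate of the function `F(·, ξ)` with effective domain `Y ξ`. -/
def oracleGrad {n : ℕ} {Ξ : Type v} (Y : Ξ → Set (Vec n)) (F : Ξ → Vec n → ℝ)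
    (μ : Vec n) (ξ : Ξ) : Vec n :=
  gradient (conjOn (Y ξ) (F ξ)) μ

/-- `F*(μ, ξ) = max_x (⟨μ, x⟩ - F(x, ξ))`, `ξ ∼ P`, is a stochastic oracle for the conjugate of
the function `f` with effective domain `X`: it is unbiased and smooth, its gradient is
`σ`-sub-Gaussian and bounded by `B` in the Manhattan norm. The set `S` is the affine hull in which
the problem lives. -/
structure IsDualOracle {n : ℕ} {Ξ : Type v} [MeasurableSpace Ξ] (P : Measure Ξ)
    (S : AffineSubspace ℝ (Vec n)) (X : Set (Vec n)) (f : Vec n → ℝ)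
    (Y : Ξ → Set (Vec n)) (F : Ξ → Vec n → ℝ) (σ B : ℝ) : Prop where
  convex : ∀ ξ, ConvexOn ℝ (Y ξ) (F ξ)
  dom_subset : ∀ ξ, Y ξ ⊆ (S : Set (Vec n))
  max_attained : ∀ ξ μ, ∃ x ∈ Y ξ, IsMaxOn (fun y => ⟪μ, y⟫ - F ξ y) (Y ξ) x
  smooth : ∀ ξ, Differentiable ℝ (conjOn (Y ξ) (F ξ))
  measurable : ∀ μ, Measurable (fun ξ => conjOn (Y ξ) (F ξ) μ)
  integrable : ∀ μ, Integrable (fun ξ => conjOn (Y ξ) (F ξ) μ) P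
  unbiased : ∀ μ, ∫ ξ, conjOn (Y ξ) (F ξ) μ ∂P = conjOn X f μ
  subgaussian : ∀ μ,
    ∫⁻ ξ, ENNReal.ofReal
      (Real.exp (‖oracleGrad Y F μ ξ - gradient (conjOn X f) μ‖ ^ 2 / σ ^ 2)) ∂P
      ≤ ENNReal.ofReal (Real.exp 1)
  bounded : ∀ μ ξ, l1Norm (oracleGrad Y F μ ξ) ≤ B

/-- Mini-batching: the average of `r` oracle calls. -/
def batchGrad {n : ℕ} {Ξ : Type v} (g : Vec n → Ξ → Vec n) (r : ℕ) (μ : Vec n) (ξ : ℕ → Ξ) :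
    Vec n :=
  (1 / (r : ℝ)) • ∑ s ∈ Finset.range r, g μ (ξ s)

/-! ### PPS quantization -/

/-- `[v]₊`. -/
def posVec {n : ℕ} (v : Vec n) : Vec n := WithLp.toLp 2 (fun k => max 0 (v k))

/-- The standard basis vector `e_k`, where `k` is drawn from the categorical distribution with
probabilities `w k / ∑ j, w j` (for `w ≥ 0`, `w ≠ 0`) by inverting its distribution function at the
uniform seed `u ∈ [0, 1]`. -/
def catVec {n : ℕ} (w : Vec n) (u : ℝ) : Vec n :=
  WithLp.toLp 2 (fun k =>
    if (∑ j with j < k, w j) < u * ∑ j, w j ∧ u * ∑ j, w j ≤ ∑ j with j ≤ k, w j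
    then 1 else 0)

/-- PPS quantization of the vector `g` with `M` samples from each of the two categorical
distributions; `a` and `b` are the uniform seeds. -/
def pps {n : ℕ} (M : ℕ) (g : Vec n) (a b : ℕ → unitInterval) : Vec n :=
  (l1Norm (posVec g) / M) • ∑ s ∈ Finset.range M, catVec (posVec g) (a s)
    - (l1Norm (posVec (-g)) / M) • ∑ s ∈ Finset.range M, catVec (posVec (-g)) (b s)

/-- Bits in one PPS message: two floating point numbers (of `flt` bits each) and `2 M` indices from
`{1, …, n}`. -/
def messageBits (flt n M : ℕ) : ℝ := 2 * flt + 2 * M * Real.logb 2 n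

/-! ### Randomness -/

/-- The random seeds: `ω (t, i, s)` is the triple (oracle sample `ξ`, uniform seed for `k`,
uniform seed for `l`) number `s` of node `i` at iteration `t`. -/
abbrev Seeds (V : Type u) (Ξ : Type v) : Type (max u v) :=
  ℕ × V × ℕ → Ξ × unitInterval × unitInterval

/-- All seeds are independent, the oracle samples of node `i` having law `P i`. -/
def seedMeasure {V : Type u} {Ξ : Type v} [MeasurableSpace Ξ] (P : V → Measure Ξ)
    [∀ i, IsProbabilityMeasure (P i)] : Measure (Seeds V Ξ) :=
  Measure.infinitePi (fun q : ℕ × V × ℕ =>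
    (P q.2.1).prod ((volume : Measure unitInterval).prod (volume : Measure unitInterval)))

/-! ### The decentralised primal-dual fast gradient method -/

section Algorithm

variable {V : Type u} [Fintype V] {Ξ : Type v} {n : ℕ}

/-- `A_t = ∑_{k ≤ t} α_k`. -/
def partialSum (α : ℕ → ℝ) (t : ℕ) : ℝ := ∑ k ∈ Finset.range (t + 1), α k

/-- The action of `A ⊗ I_n` on tabulated vectors: `(A x)ⁱ = ∑ j, A i j xʲ`. -/
def kronAct (A : Matrix V V ℝ) (x : Tab V n) : Tab V n :=
  WithLp.toLp 2 (fun i => ∑ j, A i j • x j)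

/-- The mini-batch of node `i` at iteration `t`, evaluated at `μ`: this is the restored primal
point `xⁱ(μ, ξ_tⁱ)` and also the vector to be quantized. -/
def nodeGrad (g : V → Vec n → Ξ → Vec n) (r : ℕ → ℕ) (ω : Seeds V Ξ) (t : ℕ) (μ : Tab V n) :
    Tab V n :=
  WithLp.toLp 2 (fun i => batchGrad (g i) (r t) (μ i) (fun s => (ω (t, i, s)).1))

/-- The messages `G_tⁱ = PPSⁱ(μⁱ, ξ_tⁱ, k_tⁱ, l_tⁱ)` that the nodes send at iteration `t`. -/
def nodeMsg (g : V → Vec n → Ξ → Vec n) (r M : ℕ → ℕ) (ω : Seeds V Ξ) (t : ℕ) (μ : Tab V n) :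
    Tab V n :=
  WithLp.toLp 2 (fun i => pps (M t) (nodeGrad g r ω t μ i)
    (fun s => (ω (t, i, s)).2.1) (fun s => (ω (t, i, s)).2.2))

/-- State after iteration `t`: `gsum = ∑_{k ≤ t} α_k W G_k`, the dual iterate `lam = λ_t` and the
primal iterate `x = x_t`. -/
structure AlgState (V : Type u) (n : ℕ) where
  gsum : Tab V n
  lam : Tab V n
  x : Tab V n

/-- The decentralised primal-dual fast gradient method with PPS quantization. In the Laplacian `W`
only the entries of a node itself and of its neighbours are non-zero, so `(W G)ⁱ` is computed by
node `i` from the messages of its neighbours. -/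
def algorithm (W : Matrix V V ℝ) (g : V → Vec n → Ξ → Vec n) (α β : ℕ → ℝ) (r M : ℕ → ℕ)
    (ω : Seeds V Ξ) : ℕ → AlgState V n
  | 0 =>
    let WG := kronAct W (nodeMsg g r M ω 0 0)
    { gsum := α 0 • WG
      lam := -(α 0 / β 0) • WG
      x := nodeGrad g r ω 0 0 }
  | t + 1 =>
    let st := algorithm W g α β r M ω t
    let τ := α (t + 1) / partialSum α (t + 1)
    let z := -(1 / β t) • st.gsum
    let μ := τ • z + (1 - τ) • st.lam
    let WG := kronAct W (nodeMsg g r M ω (t + 1) μ)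
    let μhat := z - (α (t + 1) / β t) • WG
    { gsum := st.gsum + α (t + 1) • WG
      lam := τ • μhat + (1 - τ) • st.lam
      x := (α (t + 1) / partialSum α (t + 1)) • nodeGrad g r ω (t + 1) μ
        + (partialSum α t / partialSum α (t + 1)) • st.x }

end Algorithm

/-! ### Graph quantities -/

section Graph

variable {V : Type u} [Fintype V] [DecidableEq V] (G : SimpleGraph V) [DecidableRel G.Adj]

/-- `√W` for the Laplacian matrix `W`. -/
def sqrtLap : Matrix V V ℝ := CFC.sqrt (G.lapMatrix ℝ)

/-- The spectral norm `‖W‖₂` of the Laplacian matrix. -/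
def lapNorm : ℝ := ‖Matrix.toEuclideanCLM (𝕜 := ℝ) (G.lapMatrix ℝ)‖

/-- The second smallest eigenvalue `λ₂(W)` of the Laplacian matrix, counted with multiplicity
(`eigenvalues₀` lists the eigenvalues in decreasing order). -/
def lambdaTwo : ℝ :=
  if h : 2 ≤ Fintype.card V then
    (G.isHermitian_lapMatrix (R := ℝ)).eigenvalues₀ ⟨Fintype.card V - 2, by omega⟩
  else 0

/-- `χ(W) = ‖W‖₂ / λ₂(W)`. -/
def chiLap : ℝ := lapNorm G / lambdaTwo G

/-- The smoothness constant `L = m ‖W‖₂ / γ` of the dual function. -/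
def dualL (γ : ℝ) : ℝ := Fintype.card V * lapNorm G / γ

/-- The bound `R = B_* / √(m λ₂(W))` on the norm of the dual solution. -/
def dualR (Bs : ℝ) : ℝ := Bs / Real.sqrt (Fintype.card V * lambdaTwo G)

/-- The sub-Gaussian variance `σ² = ‖W‖₂ m σ_i²` of the whole dual oracle. -/
def dualVar (σi : ℝ) : ℝ := lapNorm G * Fintype.card V * σi ^ 2

end Graph

/-! ### Parameters of the method -/

/-- `C₂ = 1 + ln (5 / δ)`. -/
def constC2 (δ : ℝ) : ℝ := 1 + Real.log (5 / δ)

/-- `C₁`, where `J` is the value `J(T)`. -/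
def constC1 (J δ : ℝ) : ℝ :=
  (2 * J + Real.sqrt 2 - 1)
    * (Real.sqrt 2 + (Real.sqrt 2 + 1) * Real.sqrt (3 * Real.log (5 / δ))) + Real.sqrt 2 - 2

/-- `C₃`, where `J` is the value `J(T)`. -/
def constC3 (J δ : ℝ) : ℝ :=
  constC1 J δ + 2 * Real.sqrt 2 * J * (1 + Real.sqrt (3 * Real.log (5 / δ)))

/-- `C₄`. -/
def constC4 (δ : ℝ) : ℝ := Real.sqrt 2 * (1 + Real.sqrt (3 * Real.log (5 / δ)))

/-- `α_t = (t + 1) / (2 √2)`. -/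
def alphaSeq (t : ℕ) : ℝ := (t + 1) / (2 * Real.sqrt 2)

/-- `σ_{r,M} = √(50 (2 (1 - 1/n) B² / (e M) + σ² / r))`, where `var` is `σ²`. -/
def quantSigma (n : ℕ) (B var : ℝ) (r M : ℕ) : ℝ :=
  Real.sqrt (50 * (2 * (1 - 1 / (n : ℝ)) * B ^ 2 / (Real.exp 1 * M) + var / r))

/-- `β_t = L + σ_{r_t,M_t} (t + 2)^{3/2} / (2^{1/4} √3 R)`. -/
def betaSeq (n : ℕ) (B var L R : ℝ) (r M : ℕ → ℕ) (t : ℕ) : ℝ :=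
  L + quantSigma n B var (r t) (M t) * ((t : ℝ) + 2) ^ (3 / 2 : ℝ)
    / ((2 : ℝ) ^ (1 / 4 : ℝ) * Real.sqrt 3 * R)

/-- The batch sizes
`r_t = max {1, (34 γ σ_i² α_t / ε) χ(W) max {18 C₂, (C₃ + C₄ √(m³ λ₂(W)) / (γ B_*))²}}`,
rounded up; `J` is the value `J(T)`. -/
def batchSeq {V : Type u} [Fintype V] [DecidableEq V] (G : SimpleGraph V) [DecidableRel G.Adj]
    (γ σi Bs J ε δ : ℝ) (t : ℕ) : ℕ :=
  ⌈max 1 (34 * γ * σi ^ 2 * alphaSeq t / ε * chiLap G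
    * max (18 * constC2 δ)
        ((constC3 J δ
          + constC4 δ * (Real.sqrt ((Fintype.card V : ℝ) ^ 3 * lambdaTwo G) / (γ * Bs))) ^ 2))⌉₊

/-- The sample numbers `M_t = (2 (1 - 1/n) B² / (e σ²)) r_t`, rounded up; `var` is `σ²`. -/
def sampleSeq (n : ℕ) (B var : ℝ) (r : ℕ → ℕ) (t : ℕ) : ℕ :=
  ⌈2 * (1 - 1 / (n : ℝ)) * B ^ 2 / (Real.exp 1 * var) * r t⌉₊

/-- The point `x_T` returned by the method after `T` iterations with the above parameters, where
`g i` is the stochastic gradient oracle of node `i`. -/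
def outputX {V : Type u} [Fintype V] [DecidableEq V] (G : SimpleGraph V) [DecidableRel G.Adj]
    {Ξ : Type v} {n : ℕ} (g : V → Vec n → Ξ → Vec n) (γ σi B Bs J ε δ : ℝ) (T : ℕ)
    (ω : Seeds V Ξ) : Tab V n :=
  let r := batchSeq G γ σi Bs J ε δ
  let M := sampleSeq n B (dualVar G σi) r
  let β := betaSeq n B (dualVar G σi) (dualL G γ) (dualR G Bs) r M
  (algorithm (G.lapMatrix ℝ) g alphaSeq β r M ω T).x

/-- The number of bits that node `j` sends during `T` iterations with the above parameters: at each
of the iterations `0, …, T`, one PPS message to each of its neighbours. -/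
def bitsSent {V : Type u} [Fintype V] [DecidableEq V] (G : SimpleGraph V) [DecidableRel G.Adj]
    (flt n : ℕ) (γ σi B Bs J ε δ : ℝ) (T : ℕ) (j : V) : ℝ :=
  ∑ t ∈ Finset.range (T + 1), (G.degree j : ℝ) *
    messageBits flt n (sampleSeq n B (dualVar G σi) (batchSeq G γ σi Bs J ε δ) t)

/-- The objective `f(x) = (1/m) ∑ i, f_i(xⁱ)`. -/
def objective {V : Type u} [Fintype V] {n : ℕ} (f : V → Vec n → ℝ) (x : Tab V n) : ℝ :=
  (1 / (Fintype.card V : ℝ)) * ∑ i, f i (x i)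

end

/-! The threshold `a` may depend on the whole problem. For ε ≤ a the factor ln(1/ε) exceeds any
prescribed problem constant, so all estimates may be crude in their constants (even in the
dimension), and only the orders in ε, δ and T must be right. With J(T) = 1 + ln(T + 1) the batch
sizes are about q(t + 1), where q has order J² ln(5/δ)/ε, and M_t is proportional to r_t up to
rounding. So T iterations use order qT² samples, and a T of order √(ln(5/δ)/ε) · ln(1/ε) makes this
1/ε² up to logarithms. The term m²/(γ²ε²) of the maximum alone then dominates the number of bits.
For ε > a no bits are counted and T is just taken large.

Accuracy: substituting λ = √W l turns the method into an accelerated gradient method for the dual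
function φ(l) = ∑ f_i*((√W l)_i) (`isAccelerated_pre`), which is smooth because the f_i are strongly
convex. Put p = 1/√q. The squared gradient noise at step t is of order Λp²/(t + 1), where Λ is the
logarithm of (number of controlled events)/δ, and β_t - L is of order (t + 1)p. The
estimate-sequence inequality `IsAccelerated.estimate`, divided by A_T ≥ (T + 1)²/8, yields an error
of order 1/T² + Λp/T (`exists_accelerated_error`). Since Λ is O(J ln(5/δ)), the factor J cancels in
Λp = O(√(ε ln(5/δ))), and the chosen T makes the error O(ε / ln(1/ε)).

From dual to primal: the linearisation of φ at a query point is a Lagrangian value at the exact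
maximizers. The dual estimate holds for all u in a ball slightly larger than the norm of a dual
solution. Suitable choices of u bound the objective gap, the consensus violation and the distance to
x_* for the average of the exact maximizers (`primal_of_dual`). The output averages mini-batches
instead. It differs from that average by a small martingale sum and stays in S, and near the
relative interior point x_* a local Lipschitz bound transfers the estimates to it
(`StrongConvexOn.eventually_lipschitz_above`).

Noise: each oracle sample and each quantization sample has bounded, conditionally centred noise.
Hoeffding's lemma, applied while one seed at a time is resampled, gives an exponential
supermartingale (`IsBoundedOracle.lintegral_exp_noise_le_one`). A union bound over finitely many
test vectors then produces the good event (`IsBoundedOracle.exists_good_event`). -/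

/-! ### Strongly convex functions and their conjugates -/

section Conjugate

lemma add_le_of_forall_add_one_sub_mul_le {a b c : ℝ}
    (h : ∀ t : ℝ, 0 < t → t < 1 → a + (1 - t) * b ≤ c) : a + b ≤ c := by
  have hlim : Filter.Tendsto (fun t : ℝ => a + (1 - t) * b) (nhdsWithin 0 (Set.Ioi 0))
      (nhds (a + (1 - 0) * b)) :=
    (Continuous.tendsto (by fun_prop) _).mono_left nhdsWithin_le_nhds
  have hev : ∀ᶠ t in nhdsWithin (0 : ℝ) (Set.Ioi 0), a + (1 - t) * b ≤ c := by
    filter_upwards [Ioo_mem_nhdsGT (show (0 : ℝ) < 1 by norm_num)] with t ht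
    exact h t ht.1 ht.2
  simpa using le_of_tendsto hlim hev

variable {n : ℕ} {X : Set (Vec n)} {f : Vec n → ℝ} {γ : ℝ}

/-- A differentiable direction derivative along a segment. -/
lemma HasGradientWithinAt.tendsto_slope_segment {g x₀ v : Vec n}
    (hg : HasGradientWithinAt f g X x₀) {r : ℝ} (hr : 0 < r)
    (hX : ∀ t : ℝ, 0 ≤ t → t ≤ r → x₀ + t • v ∈ X) :
    Filter.Tendsto (fun t : ℝ => t⁻¹ * (f (x₀ + t • v) - f x₀)) (nhdsWithin 0 (Set.Ioi 0))
      (nhds ⟪g, v⟫) := by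
  have h1 : HasFDerivWithinAt f (InnerProductSpace.toDual ℝ (Vec n) g) X (x₀ + (0 : ℝ) • v) := by
    simpa using hg.hasFDerivWithinAt
  have h2 : HasDerivWithinAt (fun t : ℝ => x₀ + t • v) v (Set.Icc 0 r) 0 := by
    simpa using ((hasDerivWithinAt_id (0 : ℝ) (Set.Icc 0 r)).smul_const v).const_add x₀
  have h3 := h1.comp_hasDerivWithinAt (0 : ℝ) h2 (fun t ht => hX t ht.1 ht.2)
  rw [hasDerivWithinAt_iff_tendsto_slope] at h3
  have hset : Set.Icc 0 r \ {(0 : ℝ)} = Set.Ioc 0 r := by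
    ext t; simp only [Set.mem_sdiff, Set.mem_Icc, Set.mem_singleton_iff, Set.mem_Ioc]
    constructor
    · rintro ⟨⟨h0, h1⟩, h2⟩; exact ⟨lt_of_le_of_ne h0 (Ne.symm h2), h1⟩
    · rintro ⟨h0, h1⟩; exact ⟨⟨h0.le, h1⟩, h0.ne'⟩
  rw [hset, nhdsWithin_Ioc_eq_nhdsGT hr] at h3
  refine (h3.congr fun t => ?_)
  simp [slope_def_field, div_eq_inv_mul]

/-- Strong convexity along the segment from x₀ to x bounds the difference quotients of f. Their
limit is the inner product with g, and differentiability within X suffices because the segment stays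
in X. -/
lemma StrongConvexOn.subgradient (hf : StrongConvexOn X γ f) {g x₀ x : Vec n}
    (hg : HasGradientWithinAt f g X x₀) (hx₀ : x₀ ∈ X) (hx : x ∈ X) :
    f x₀ + ⟪g, x - x₀⟫ + γ / 2 * ‖x - x₀‖ ^ 2 ≤ f x := by
  have hmem : ∀ t : ℝ, 0 ≤ t → t ≤ 1 → x₀ + t • (x - x₀) ∈ X := by
    intro t h0 h1
    have := hf.1 hx₀ hx (sub_nonneg.2 h1) h0 (by ring)
    convert this using 1
    module
  have hlim := hg.tendsto_slope_segment one_pos hmem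
  have hlim2 : Filter.Tendsto (fun t : ℝ => f x - f x₀ - (1 - t) * (γ / 2 * ‖x - x₀‖ ^ 2))
      (nhdsWithin 0 (Set.Ioi 0)) (nhds (f x - f x₀ - (1 - 0) * (γ / 2 * ‖x - x₀‖ ^ 2))) :=
    (Continuous.tendsto (by fun_prop) _).mono_left nhdsWithin_le_nhds
  have hev : ∀ᶠ t in nhdsWithin (0 : ℝ) (Set.Ioi 0),
      t⁻¹ * (f (x₀ + t • (x - x₀)) - f x₀) ≤ f x - f x₀ - (1 - t) * (γ / 2 * ‖x - x₀‖ ^ 2) := by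
    filter_upwards [Ioo_mem_nhdsGT (show (0 : ℝ) < 1 by norm_num)] with t ht
    have := hf.2 hx₀ hx (sub_nonneg.2 ht.2.le) ht.1.le (by ring)
    have he : (1 - t) • x₀ + t • x = x₀ + t • (x - x₀) := by module
    rw [he, norm_sub_rev] at this
    simp only [smul_eq_mul] at this
    rw [inv_mul_le_iff₀ ht.1]
    nlinarith [this]
  have := le_of_tendsto_of_tendsto hlim hlim2 hev
  linarith

/-- The maximizer in the conjugate of a closed strongly convex function, with quadratic growth. -/
lemma exists_conj_argmax (hcl : IsClosed {p : Vec n × ℝ | p.1 ∈ X ∧ f p.1 ≤ p.2})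
    (hf : StrongConvexOn X γ f) (hγ : 0 < γ) {x₀ g : Vec n} (hx₀ : x₀ ∈ X)
    (hsub : ∀ x ∈ X, f x₀ + ⟪g, x - x₀⟫ + γ / 2 * ‖x - x₀‖ ^ 2 ≤ f x) (μ : Vec n) :
    ∃ x ∈ X, conjOn X f μ = ⟪μ, x⟫ - f x ∧
      ∀ y ∈ X, ⟪μ, y⟫ - f y + γ / 2 * ‖y - x‖ ^ 2 ≤ conjOn X f μ := by
  set S : Set ℝ := (fun x => ⟪μ, x⟫ - f x) '' X with hS
  have hne : S.Nonempty := ⟨_, x₀, hx₀, rfl⟩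
  -- The quadratic minorant of f turns into a concave quadratic majorant of the function to be
  -- maximized, which gives boundedness here and coercivity below.
  have hup : ∀ x ∈ X, ⟪μ, x⟫ - f x ≤
      (⟪μ, x₀⟫ - f x₀) + ‖μ - g‖ * ‖x - x₀‖ - γ / 2 * ‖x - x₀‖ ^ 2 := by
    intro x hx
    have h1 := hsub x hx
    have h2 := real_inner_le_norm (μ - g) (x - x₀)
    rw [inner_sub_left, inner_sub_right μ] at h2
    linarith
  have hbdd : BddAbove S := by
    refine ⟨(⟪μ, x₀⟫ - f x₀) + ‖μ - g‖ ^ 2 / (2 * γ), ?_⟩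
    rintro _ ⟨x, hx, rfl⟩
    have h3 := hup x hx
    have h4 : ‖μ - g‖ * ‖x - x₀‖ - γ / 2 * ‖x - x₀‖ ^ 2 ≤ ‖μ - g‖ ^ 2 / (2 * γ) := by
      rw [le_div_iff₀ (by positivity)]
      nlinarith [sq_nonneg (‖μ - g‖ - γ * ‖x - x₀‖)]
    simp only; linarith
  obtain ⟨u, hmono, hlim, hu⟩ := exists_seq_tendsto_sSup hne hbdd
  choose w hwX hw using hu
  simp only at hw
  have hbd : ∃ ρ : ℝ, ∀ k, w k ∈ Metric.closedBall x₀ ρ := by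
    -- Outside this ball the majorant `hup` lies below u 0, the first value of the increasing
    -- maximizing sequence. The summand 1 ensures d ≥ 1, so that constants are bounded by multiples
    -- of d.
    refine ⟨1 + (2 * (‖μ - g‖ + |⟪μ, x₀⟫ - f x₀ - u 0|)) / γ, fun k => ?_⟩
    rw [Metric.mem_closedBall, dist_eq_norm]
    by_contra hcon
    push Not at hcon
    set d := ‖w k - x₀‖
    have h1 := hup (w k) (hwX k)
    rw [hw k] at h1
    have h2 := hmono (Nat.zero_le k)
    have h3 := le_abs_self (⟪μ, x₀⟫ - f x₀ - u 0)
    have h0 := abs_nonneg (⟪μ, x₀⟫ - f x₀ - u 0)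
    have hd1 : 1 ≤ d := by
      have : 0 ≤ (2 * (‖μ - g‖ + |⟪μ, x₀⟫ - f x₀ - u 0|)) / γ := by positivity
      linarith
    have hd2 : 2 * (‖μ - g‖ + |⟪μ, x₀⟫ - f x₀ - u 0|) < γ * d := by
      have : (2 * (‖μ - g‖ + |⟪μ, x₀⟫ - f x₀ - u 0|)) / γ < d := by linarith
      rwa [div_lt_iff₀ hγ, mul_comm d γ] at this
    nlinarith [norm_nonneg (μ - g)]
  obtain ⟨ρ, hρ⟩ := hbd
  obtain ⟨x, -, φ, hφ, hx⟩ := (isCompact_closedBall x₀ ρ).tendsto_subseq hρ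
  -- Closedness of the epigraph puts the limit point into the domain and makes it a maximizer.
  have hmem : (x, ⟪μ, x⟫ - sSup S) ∈ {p : Vec n × ℝ | p.1 ∈ X ∧ f p.1 ≤ p.2} := by
    refine hcl.mem_of_tendsto (f := fun k => (w (φ k), ⟪μ, w (φ k)⟫ - u (φ k)))
      (b := Filter.atTop) ?_ (Filter.Eventually.of_forall fun k => ⟨hwX _, ?_⟩)
    · refine Filter.Tendsto.prodMk_nhds hx (Filter.Tendsto.sub ?_ (hlim.comp hφ.tendsto_atTop))
      exact (Continuous.tendsto (by fun_prop) x).comp hx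
    · simp only; rw [← hw (φ k)]; linarith
  obtain ⟨hxX, hfx⟩ := hmem
  simp only at hxX hfx
  have hle : ⟪μ, x⟫ - f x ≤ sSup S := le_csSup hbdd ⟨x, hxX, rfl⟩
  have heq : conjOn X f μ = ⟪μ, x⟫ - f x := by
    have : conjOn X f μ = sSup S := rfl
    linarith
  refine ⟨x, hxX, heq, fun y hy => ?_⟩
  -- Quadratic growth: compare the maximum with the value at a point of the segment from x to y,
  -- divide by t and let t tend to 0.
  refine add_le_of_forall_add_one_sub_mul_le fun t h0 h1 => ?_
  have hconv := hf.2 hxX hy (sub_nonneg.2 h1.le) h0.le (by ring)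
  have hz : ⟪μ, (1 - t) • x + t • y⟫ - f ((1 - t) • x + t • y) ≤ sSup S :=
    le_csSup hbdd ⟨_, hf.1 hxX hy (sub_nonneg.2 h1.le) h0.le (by ring), rfl⟩
  rw [inner_add_right, inner_smul_right, inner_smul_right] at hz
  rw [norm_sub_rev] at hconv
  simp only [smul_eq_mul] at hconv
  have hfin : t * (⟪μ, y⟫ - f y + (1 - t) * (γ / 2 * ‖y - x‖ ^ 2)) ≤ t * conjOn X f μ := by
    have : conjOn X f μ = sSup S := rfl
    nlinarith
  exact le_of_mul_le_mul_left hfin h0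

/-- `xb` selects the maximizers in the conjugate of `f`, with quadratic growth `γ`. -/
def IsConjArgmax (X : Set (Vec n)) (f : Vec n → ℝ) (γ : ℝ) (xb : Vec n → Vec n) : Prop :=
  ∀ μ, xb μ ∈ X ∧ conjOn X f μ = ⟪μ, xb μ⟫ - f (xb μ) ∧
    ∀ y ∈ X, ⟪μ, y⟫ - f y + γ / 2 * ‖y - xb μ‖ ^ 2 ≤ conjOn X f μ

variable {xb : Vec n → Vec n}

lemma IsConjArgmax.le_conj (h : IsConjArgmax X f γ xb) (hγ : 0 ≤ γ) {y : Vec n} (hy : y ∈ X)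
    (μ : Vec n) : ⟪μ, y⟫ - f y ≤ conjOn X f μ := by
  have := (h μ).2.2 y hy
  have h2 : 0 ≤ γ / 2 * ‖y - xb μ‖ ^ 2 := by positivity
  linarith

lemma IsConjArgmax.lower (h : IsConjArgmax X f γ xb) (hγ : 0 ≤ γ) (μ ν : Vec n) :
    conjOn X f μ + ⟪xb μ, ν - μ⟫ ≤ conjOn X f ν := by
  have h1 := h.le_conj hγ (h μ).1 ν
  rw [(h μ).2.1, inner_sub_right, real_inner_comm μ, real_inner_comm ν]
  linarith

/-- Quadratic growth at the maximizer for μ, tested at the maximizer for ν, and Young's inequality: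
strong convexity of f makes its conjugate 1/γ-smooth. -/
lemma IsConjArgmax.upper (h : IsConjArgmax X f γ xb) (hγ : 0 < γ) (μ ν : Vec n) :
    conjOn X f ν ≤ conjOn X f μ + ⟪xb μ, ν - μ⟫ + ‖ν - μ‖ ^ 2 / (2 * γ) := by
  have h1 := (h μ).2.2 (xb ν) (h ν).1
  have h2 := real_inner_le_norm (ν - μ) (xb ν - xb μ)
  have h4 : ‖ν - μ‖ * ‖xb ν - xb μ‖ - γ / 2 * ‖xb ν - xb μ‖ ^ 2 ≤ ‖ν - μ‖ ^ 2 / (2 * γ) := by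
    rw [le_div_iff₀ (by positivity)]
    nlinarith [sq_nonneg (‖ν - μ‖ - γ * ‖xb ν - xb μ‖)]
  rw [(h ν).2.1]
  rw [inner_sub_right, inner_sub_left, inner_sub_left] at h2
  rw [inner_sub_right, real_inner_comm μ, real_inner_comm ν]
  linarith

lemma IsConjArgmax.hasGradientAt (h : IsConjArgmax X f γ xb) (hγ : 0 < γ) (μ : Vec n) :
    HasGradientAt (conjOn X f) (xb μ) μ := by
  rw [hasGradientAt_iff_isLittleO]
  have hO : (fun ν => conjOn X f ν - conjOn X f μ - ⟪xb μ, ν - μ⟫) =O[nhds μ]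
      fun ν => ‖ν - μ‖ ^ 2 := by
    refine Asymptotics.IsBigO.of_bound (1 / (2 * γ)) (Filter.Eventually.of_forall fun ν => ?_)
    have h1 := h.lower hγ.le μ ν
    have h2 := h.upper hγ μ ν
    rw [Real.norm_of_nonneg (by linarith), Real.norm_of_nonneg (by positivity)]
    rw [div_mul_eq_mul_div, one_mul]
    linarith
  refine hO.trans_isLittleO ?_
  have : (fun ν : Vec n => ‖ν - μ‖ ^ 2) =o[nhds μ] fun ν => ‖ν - μ‖ := by
    have h0 : Filter.Tendsto (fun ν : Vec n => ‖ν - μ‖) (nhds μ) (nhds 0) := by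
      have : Continuous fun ν : Vec n => ‖ν - μ‖ := by fun_prop
      simpa using this.tendsto μ
    exact (Asymptotics.isLittleO_pow_id one_lt_two).comp_tendsto h0
  exact this.norm_right.trans_le (fun _ => by simp)

/-- A subgradient at a point of differentiability is the gradient. -/
lemma eq_gradient_of_forall_le {φ : Vec n → ℝ} {g p μ : Vec n} (hg : HasGradientAt φ g μ)
    (hp : ∀ ν, φ μ + ⟪p, ν - μ⟫ ≤ φ ν) : p = g := by
  have hw : HasGradientWithinAt φ g Set.univ μ := hasGradientWithinAt_iff_hasFDerivWithinAt.2
    hg.hasFDerivAt.hasFDerivWithinAt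
  have hlim := hw.tendsto_slope_segment (v := p - g) one_pos
    (fun _ _ _ => Set.mem_univ _)
  have hev : ∀ᶠ t in nhdsWithin (0 : ℝ) (Set.Ioi 0),
      ⟪p, p - g⟫ ≤ t⁻¹ * (φ (μ + t • (p - g)) - φ μ) := by
    filter_upwards [self_mem_nhdsWithin] with t ht
    have ht : 0 < t := ht
    have := hp (μ + t • (p - g))
    rw [add_sub_cancel_left, inner_smul_right] at this
    rw [le_inv_mul_iff₀ ht]; linarith
  have h := ge_of_tendsto hlim hev
  have h2 : ‖p - g‖ ^ 2 ≤ 0 := by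
    rw [← real_inner_self_eq_norm_sq, inner_sub_left]; linarith
  have h3 : ‖p - g‖ = 0 := by nlinarith [norm_nonneg (p - g)]
  exact sub_eq_zero.1 (norm_eq_zero.1 h3)

end Conjugate

/-! ### The stochastic dual oracle -/

section Oracle

variable {n : ℕ} {Ξ : Type v} [MeasurableSpace Ξ] {P : Measure Ξ}
  {S : AffineSubspace ℝ (Vec n)} {X : Set (Vec n)} {f : Vec n → ℝ}
  {Y : Ξ → Set (Vec n)} {F : Ξ → Vec n → ℝ} {σ B : ℝ}

lemma norm_le_l1Norm (v : Vec n) : ‖v‖ ≤ l1Norm v := by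
  have h0 : 0 ≤ l1Norm v := Finset.sum_nonneg fun _ _ => abs_nonneg _
  refine le_of_sq_le_sq ?_ h0
  rw [EuclideanSpace.norm_sq_eq]
  simp only [Real.norm_eq_abs]
  exact Finset.sum_sq_le_sq_sum_of_nonneg fun _ _ => abs_nonneg _

/-- Any maximizer is a subgradient of the conjugate, hence equals its gradient. Membership in Y ξ is
what later keeps the primal iterates in S. -/
lemma IsDualOracle.gradient_mem_and_lower (h : IsDualOracle P S X f Y F σ B) (μ : Vec n) (ξ : Ξ) :
    oracleGrad Y F μ ξ ∈ Y ξ ∧ ∀ ν, conjOn (Y ξ) (F ξ) μ + ⟪oracleGrad Y F μ ξ, ν - μ⟫ ≤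
      conjOn (Y ξ) (F ξ) ν := by
  have hbdd : ∀ ν, BddAbove ((fun x => ⟪ν, x⟫ - F ξ x) '' (Y ξ)) := fun ν => by
    obtain ⟨x, hx, hmax⟩ := h.max_attained ξ ν
    exact ⟨_, by rintro _ ⟨y, hy, rfl⟩; exact hmax hy⟩
  obtain ⟨x, hx, hmax⟩ := h.max_attained ξ μ
  have heq : conjOn (Y ξ) (F ξ) μ = ⟪μ, x⟫ - F ξ x := by
    refine le_antisymm (csSup_le ⟨_, x, hx, rfl⟩ ?_) (le_csSup (hbdd μ) ⟨x, hx, rfl⟩)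
    rintro _ ⟨y, hy, rfl⟩; exact hmax hy
  have hlow : ∀ ν, conjOn (Y ξ) (F ξ) μ + ⟪x, ν - μ⟫ ≤ conjOn (Y ξ) (F ξ) ν := fun ν => by
    have := le_csSup (hbdd ν) ⟨x, hx, rfl⟩
    simp only at this
    rw [heq, inner_sub_right, real_inner_comm μ, real_inner_comm ν]
    have h2 : conjOn (Y ξ) (F ξ) ν = sSup ((fun x => ⟪ν, x⟫ - F ξ x) '' (Y ξ)) := rfl
    linarith
  have hx' : x = oracleGrad Y F μ ξ :=
    eq_gradient_of_forall_le ((h.smooth ξ) μ).hasGradientAt hlow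
  rw [← hx']
  exact ⟨hx, hlow⟩

/-- The conjugate is a Carathéodory function, continuous in μ and measurable in ξ, hence jointly
measurable. The coordinates of its gradient are limits of difference quotients. -/
lemma IsDualOracle.measurable_oracleGrad (h : IsDualOracle P S X f Y F σ B) :
    Measurable (fun p : Vec n × Ξ => oracleGrad Y F p.1 p.2) := by
  have hjoint : Measurable (fun p : Vec n × Ξ => conjOn (Y p.2) (F p.2) p.1) := by
    have := measurable_uncurry_of_continuous_of_measurable
      (u := fun (μ : Vec n) (ξ : Ξ) => conjOn (Y ξ) (F ξ) μ)
      (fun ξ => (h.smooth ξ).continuous) h.measurable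
    exact this
  have hcoord : ∀ k : Fin n, Measurable fun p : Vec n × Ξ => oracleGrad Y F p.1 p.2 k := by
    intro k
    let e : Vec n := EuclideanSpace.single k 1
    let u : ℕ → ℝ := fun N => 1 / ((N : ℝ) + 1)
    have hu0 : ∀ N, 0 < u N := fun N => by positivity
    refine measurable_of_tendsto_metrizable
      (f := fun N p => (u N)⁻¹ * (conjOn (Y p.2) (F p.2) (p.1 + u N • e)
        - conjOn (Y p.2) (F p.2) p.1)) (fun N => ?_) ?_
    · have hsh : Measurable fun p : Vec n × Ξ => (p.1 + u N • e, p.2) :=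
        (measurable_fst.add_const _).prodMk measurable_snd
      exact ((hjoint.comp hsh).sub hjoint).const_mul _
    · rw [tendsto_pi_nhds]
      rintro ⟨μ, ξ⟩
      have hw : HasGradientWithinAt (conjOn (Y ξ) (F ξ)) (oracleGrad Y F μ ξ) Set.univ μ :=
        hasGradientWithinAt_iff_hasFDerivWithinAt.2
          ((h.smooth ξ) μ).hasGradientAt.hasFDerivAt.hasFDerivWithinAt
      have hlim := hw.tendsto_slope_segment (v := e) one_pos (fun _ _ _ => Set.mem_univ _)
      have hu : Filter.Tendsto u Filter.atTop (nhdsWithin 0 (Set.Ioi 0)) :=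
        tendsto_nhdsWithin_iff.2 ⟨tendsto_one_div_add_atTop_nhds_zero_nat,
          Filter.Eventually.of_forall hu0⟩
      have := hlim.comp hu
      simpa [e, EuclideanSpace.inner_single_right, Function.comp_def] using this
  have : Measurable fun p : Vec n × Ξ => (oracleGrad Y F p.1 p.2).ofLp :=
    measurable_pi_iff.2 hcoord
  exact (WithLp.measurable_toLp 2 _).comp this

lemma IsDualOracle.norm_le (h : IsDualOracle P S X f Y F σ B) (μ : Vec n) (ξ : Ξ) :
    ‖oracleGrad Y F μ ξ‖ ≤ B := (norm_le_l1Norm _).trans (h.bounded μ ξ)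

lemma IsDualOracle.integrable_oracleGrad [IsProbabilityMeasure P]
    (h : IsDualOracle P S X f Y F σ B) (μ : Vec n) :
    Integrable (fun ξ => oracleGrad Y F μ ξ) P := by
  refine Integrable.of_bound (C := B) ?_ (Filter.Eventually.of_forall (h.norm_le μ))
  exact (h.measurable_oracleGrad.comp (measurable_const.prodMk measurable_id)).aestronglyMeasurable

/-- Integrating the subgradient inequality over ξ shows that the mean oracle gradient is a
subgradient of the differentiable function f*, hence its gradient. No differentiation under the
integral is needed. -/
lemma IsDualOracle.integral_oracleGrad [IsProbabilityMeasure P]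
    (h : IsDualOracle P S X f Y F σ B) {γ : ℝ} (hγ : 0 < γ) {xb : Vec n → Vec n}
    (hxb : IsConjArgmax X f γ xb) (μ : Vec n) :
    ∫ ξ, oracleGrad Y F μ ξ ∂P = xb μ := by
  refine eq_gradient_of_forall_le (hxb.hasGradientAt hγ μ) fun ν => ?_
  have hint := h.integrable_oracleGrad μ
  rw [← h.unbiased μ, ← h.unbiased ν, real_inner_comm, ← integral_inner hint,
    ← integral_add (h.integrable μ) (hint.const_inner _)]
  refine integral_mono ((h.integrable μ).add (hint.const_inner _)) (h.integrable ν) fun ξ => ?_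
  have := (h.gradient_mem_and_lower μ ξ).2 ν
  rw [real_inner_comm] at this; exact this

lemma IsDualOracle.norm_argmax_le [IsProbabilityMeasure P]
    (h : IsDualOracle P S X f Y F σ B) {γ : ℝ} (hγ : 0 < γ) {xb : Vec n → Vec n}
    (hxb : IsConjArgmax X f γ xb) (μ : Vec n) : ‖xb μ‖ ≤ B := by
  rw [← h.integral_oracleGrad hγ hxb μ]
  simpa using norm_integral_le_of_norm_le_const (μ := P) (Filter.Eventually.of_forall (h.norm_le μ))

lemma IsDualOracle.measurable_argmax [IsProbabilityMeasure P]
    (h : IsDualOracle P S X f Y F σ B) {γ : ℝ} (hγ : 0 < γ) {xb : Vec n → Vec n}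
    (hxb : IsConjArgmax X f γ xb) : Measurable xb := by
  have hm : StronglyMeasurable (Function.uncurry fun (μ : Vec n) (ξ : Ξ) => oracleGrad Y F μ ξ) :=
    h.measurable_oracleGrad.stronglyMeasurable
  have := (hm.integral_prod_right (ν := P)).measurable
  convert this using 2 with μ
  exact (h.integral_oracleGrad hγ hxb μ).symm

end Oracle

/-! ### The action of the Laplacian matrix on tabulated vectors -/

section Kron

variable {V : Type u} [Fintype V] {n : ℕ}

lemma kronAct_apply (A : Matrix V V ℝ) (x : Tab V n) (i : V) :
    kronAct A x i = ∑ j, A i j • x j := rfl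

lemma kronAct_apply_apply (A : Matrix V V ℝ) (x : Tab V n) (i : V) (k : Fin n) :
    kronAct A x i k = A.mulVec (fun j => x j k) i := by
  simp [kronAct_apply, Matrix.mulVec, dotProduct]

lemma kronAct_add (A : Matrix V V ℝ) (x y : Tab V n) :
    kronAct A (x + y) = kronAct A x + kronAct A y := by
  ext i k
  simp only [kronAct_apply_apply, PiLp.add_apply]
  exact congrFun (Matrix.mulVec_add A (fun j => x j k) (fun j => y j k)) i

lemma kronAct_smul (A : Matrix V V ℝ) (c : ℝ) (x : Tab V n) :
    kronAct A (c • x) = c • kronAct A x := by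
  ext i k
  simp only [kronAct_apply_apply, PiLp.smul_apply]
  exact congrFun (Matrix.mulVec_smul A c (fun j => x j k)) i

/-- `kronAct A` as a linear map. -/
noncomputable def kronLin (A : Matrix V V ℝ) : Tab V n →ₗ[ℝ] Tab V n where
  toFun := kronAct A
  map_add' := kronAct_add A
  map_smul' := kronAct_smul A

lemma kronAct_mul (A B : Matrix V V ℝ) (x : Tab V n) :
    kronAct (A * B) x = kronAct A (kronAct B x) := by
  ext i k
  rw [kronAct_apply_apply, kronAct_apply_apply, ← Matrix.mulVec_mulVec]
  congr 1
  ext j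
  rw [kronAct_apply_apply]

lemma inner_kronAct_left {A : Matrix V V ℝ} (hA : A.IsSymm) (x y : Tab V n) :
    ⟪kronAct A x, y⟫ = ⟪x, kronAct A y⟫ := by
  simp only [PiLp.inner_apply, kronAct_apply, sum_inner, inner_sum, inner_smul_left,
    inner_smul_right]
  rw [Finset.sum_comm]
  refine Finset.sum_congr rfl fun i _ => Finset.sum_congr rfl fun j _ => ?_
  simp [hA.apply i j]

lemma norm_sq_eq_sum_norm_sq_slice (x : Tab V n) :
    ‖x‖ ^ 2 = ∑ k, ‖(WithLp.toLp 2 fun j => x j k : EuclideanSpace ℝ V)‖ ^ 2 := by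
  simp only [PiLp.norm_sq_eq_of_L2]
  rw [Finset.sum_comm]

/-- A ⊗ I_n acts as A on each of the n coordinate slices, and the squared norms of the slices add
up. -/
lemma norm_kronAct_le [DecidableEq V] (A : Matrix V V ℝ) (x : Tab V n) :
    ‖kronAct A x‖ ≤ ‖Matrix.toEuclideanCLM (𝕜 := ℝ) A‖ * ‖x‖ := by
  refine le_of_sq_le_sq ?_ (by positivity)
  rw [mul_pow, norm_sq_eq_sum_norm_sq_slice, norm_sq_eq_sum_norm_sq_slice x, Finset.mul_sum]
  refine Finset.sum_le_sum fun k _ => ?_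
  rw [← mul_pow]
  refine pow_le_pow_left₀ (norm_nonneg _) ?_ 2
  have := (Matrix.toEuclideanCLM (𝕜 := ℝ) A).le_opNorm (WithLp.toLp 2 fun j => x j k)
  have he : (WithLp.toLp 2 fun j => kronAct A x j k : EuclideanSpace ℝ V) =
      Matrix.toEuclideanCLM (𝕜 := ℝ) A (WithLp.toLp 2 fun j => x j k) := by
    ext i
    exact kronAct_apply_apply A x i k
  rw [he]; exact this

/-- `kronAct A` as a continuous linear map. -/
noncomputable def kronCLM [DecidableEq V] (A : Matrix V V ℝ) : Tab V n →L[ℝ] Tab V n :=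
  (kronLin A).mkContinuous _ (norm_kronAct_le A)

@[simp] lemma kronCLM_apply [DecidableEq V] (A : Matrix V V ℝ) (x : Tab V n) :
    kronCLM A x = kronAct A x := rfl

end Kron

/-! ### Kernel, range and spectral bounds of the Laplacian and its square root -/

section Laplacian

variable {V : Type u} [Fintype V] [DecidableEq V] (G : SimpleGraph V) [DecidableRel G.Adj] {n : ℕ}

lemma sqrtLap_mul_self : sqrtLap G * sqrtLap G = G.lapMatrix ℝ :=
  CFC.sqrt_mul_sqrt_self _ (Matrix.nonneg_iff_posSemidef.2 (G.posSemidef_lapMatrix ℝ))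

lemma sqrtLap_isSymm : (sqrtLap G).IsSymm := by
  have h : (sqrtLap G).PosSemidef := Matrix.nonneg_iff_posSemidef.1 (CFC.sqrt_nonneg _)
  simpa using h.isHermitian

lemma kronAct_sqrtLap_sqrtLap (x : Tab V n) :
    kronAct (sqrtLap G) (kronAct (sqrtLap G) x) = kronAct (G.lapMatrix ℝ) x := by
  rw [← kronAct_mul, sqrtLap_mul_self]

lemma norm_sq_kronAct_sqrtLap (x : Tab V n) :
    ‖kronAct (sqrtLap G) x‖ ^ 2 = ⟪x, kronAct (G.lapMatrix ℝ) x⟫ := by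
  rw [← real_inner_self_eq_norm_sq, inner_kronAct_left (sqrtLap_isSymm G), kronAct_sqrtLap_sqrtLap]

lemma norm_sq_kronAct_sqrtLap_le (x : Tab V n) :
    ‖kronAct (sqrtLap G) x‖ ^ 2 ≤ lapNorm G * ‖x‖ ^ 2 := by
  rw [norm_sq_kronAct_sqrtLap]
  refine (real_inner_le_norm _ _).trans ?_
  have h2 : ‖kronAct (G.lapMatrix ℝ) x‖ ≤ lapNorm G * ‖x‖ := norm_kronAct_le _ x
  nlinarith [norm_nonneg x]

variable {G}

/-- Since ‖√W x‖² = ⟨x, Wx⟩, the matrices √W and W have the same kernel. On a connected graph the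
kernel of W consists of the constants, slice by slice. -/
lemma kronAct_sqrtLap_eq_zero_iff (hG : G.Connected) (x : Tab V n) :
    kronAct (sqrtLap G) x = 0 ↔ ∀ i j, x i = x j := by
  have h1 : kronAct (sqrtLap G) x = 0 ↔ kronAct (G.lapMatrix ℝ) x = 0 := by
    constructor
    · intro h
      rw [← kronAct_sqrtLap_sqrtLap, h, ← kronCLM_apply, map_zero]
    · intro h
      have := norm_sq_kronAct_sqrtLap G x
      rw [h, inner_zero_right] at this
      exact norm_eq_zero.1 (pow_eq_zero_iff two_ne_zero |>.1 this)
  have h2 : kronAct (G.lapMatrix ℝ) x = 0 ↔ ∀ k, (G.lapMatrix ℝ).mulVec (fun j => x j k) = 0 := by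
    constructor
    · intro h k
      ext i
      rw [← kronAct_apply_apply, h]; rfl
    · intro h
      ext i k
      rw [kronAct_apply_apply, h k]; rfl
  rw [h1, h2]
  simp only [G.lapMatrix_mulVec_eq_zero_iff_forall_reachable]
  constructor
  · intro h i j; ext k; exact h k i j (hG.preconnected i j)
  · intro h k i j _; rw [h i j]

/-- The range of a symmetric map is the orthogonal complement of its kernel, here of the consensus
tables. Applied to the gradients at the solution, this produces a dual solution. -/
lemma exists_kronAct_sqrtLap_eq (hG : G.Connected) (y : Tab V n) (hy : ∑ i, y i = 0) :
    ∃ l : Tab V n, kronAct (sqrtLap G) l = y := by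
  let T : Tab V n →ₗ[ℝ] Tab V n := kronLin (sqrtLap G)
  have hT : T.IsSymmetric := fun a b => inner_kronAct_left (sqrtLap_isSymm G) a b
  have hmem : y ∈ T.kerᗮ := by
    rw [Submodule.mem_orthogonal]
    intro w hw
    have hw' : kronAct (sqrtLap G) w = 0 := hw
    rw [kronAct_sqrtLap_eq_zero_iff hG] at hw'
    obtain ⟨i₀⟩ := hG.nonempty
    rw [PiLp.inner_apply, Finset.sum_congr rfl fun i _ => by rw [hw' i i₀], ← inner_sum, hy,
      inner_zero_right]
  have : y ∈ T.range := by
    rw [← hT.orthogonal_range, Submodule.orthogonal_orthogonal] at hmem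
    exact hmem
  exact this

lemma lapNorm_nonneg : 0 ≤ lapNorm G := norm_nonneg _

/-- Otherwise the last two eigenvalues vanish, and their eigenvectors are non-zero constants on a
connected graph. Two such vectors cannot be orthogonal. -/
lemma lambdaTwo_pos (hG : G.Connected) (hV : 2 ≤ Fintype.card V) : 0 < lambdaTwo G := by
  rw [lambdaTwo, dif_pos hV]
  set hA := G.isHermitian_lapMatrix (R := ℝ)
  by_contra hcon
  push Not at hcon
  let e : Fin (Fintype.card V) ≃ V := Fintype.equivOfCardEq (Fintype.card_fin _)
  have hev : ∀ k, hA.eigenvalues (e k) = hA.eigenvalues₀ k := fun k => by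
    simp only [Matrix.IsHermitian.eigenvalues]
    congr 1
    exact e.symm_apply_apply k
  let a : Fin (Fintype.card V) := ⟨Fintype.card V - 2, by omega⟩
  let b : Fin (Fintype.card V) := ⟨Fintype.card V - 1, by omega⟩
  have hab : a ≤ b := by simp only [a, b, Fin.mk_le_mk]; omega
  have hne : a ≠ b := by simp only [a, b, ne_eq, Fin.mk.injEq]; omega
  have hpsd := (G.posSemidef_lapMatrix ℝ).eigenvalues_nonneg
  have ha0 : hA.eigenvalues (e a) = 0 := le_antisymm ((hev a).trans_le hcon) (hpsd _)
  have hb0 : hA.eigenvalues (e b) = 0 := by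
    refine le_antisymm ((hev b).trans_le ((hA.eigenvalues₀_antitone hab).trans hcon)) (hpsd _)
  have hker : ∀ k, hA.eigenvalues k = 0 → ∀ i j, hA.eigenvectorBasis k i = hA.eigenvectorBasis k j := by
    intro k hk i j
    have h1 := hA.mulVec_eigenvectorBasis k
    rw [hk, zero_smul, G.lapMatrix_mulVec_eq_zero_iff_forall_reachable] at h1
    exact h1 i j (hG.preconnected i j)
  obtain ⟨i₀⟩ := hG.nonempty
  have horth := hA.eigenvectorBasis.orthonormal
  have h1 : ⟪hA.eigenvectorBasis (e a), hA.eigenvectorBasis (e b)⟫ = 0 :=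
    horth.2 (fun h => hne (e.injective h))
  have hn : ∀ k, hA.eigenvalues k = 0 → hA.eigenvectorBasis k i₀ ≠ 0 := by
    intro k hk h0
    have h2 : hA.eigenvectorBasis k = 0 := by
      ext i; rw [hker k hk i i₀, h0]; rfl
    have := horth.1 k
    rw [h2, norm_zero] at this
    exact zero_ne_one this
  rw [PiLp.inner_apply, Finset.sum_congr rfl fun i _ => by
    rw [hker _ ha0 i i₀, hker _ hb0 i i₀]] at h1
  simp only [RCLike.inner_apply, conj_trivial, Finset.sum_const, nsmul_eq_mul, mul_eq_zero] at h1
  rcases h1 with h1 | h1 | h1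
  · simp only [Finset.card_univ, Nat.cast_eq_zero] at h1; omega
  · exact hn _ hb0 h1
  · exact hn _ ha0 h1

lemma lapNorm_pos (hG : G.Connected) (hV : 2 ≤ Fintype.card V) : 0 < lapNorm G := by
  refine lt_of_le_of_ne lapNorm_nonneg fun h0 => ?_
  obtain ⟨i, j, hij⟩ := Fintype.one_lt_card_iff.1 (show 1 < Fintype.card V by omega)
  let x : Tab V 1 := WithLp.toLp 2 fun l => if l = i then EuclideanSpace.single 0 1 else 0
  have h1 : kronAct (sqrtLap G) x = 0 := by
    have := norm_sq_kronAct_sqrtLap_le G x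
    rw [← h0, zero_mul] at this
    exact norm_eq_zero.1 (pow_eq_zero_iff two_ne_zero |>.1 (le_antisymm this (by positivity)))
  rw [kronAct_sqrtLap_eq_zero_iff hG] at h1
  have := congrArg (fun v : Vec 1 => v 0) (h1 i j)
  simp [x, Ne.symm hij] at this

end Laplacian

/-! ### The accelerated dual gradient method with inexact gradients -/

section Accelerated

variable {E : Type*} [NormedAddCommGroup E] [InnerProductSpace ℝ E]

lemma partialSum_succ (α : ℕ → ℝ) (t : ℕ) :
    partialSum α (t + 1) = partialSum α t + α (t + 1) := Finset.sum_range_succ _ _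

/-- One step of the accelerated gradient method. -/
lemma accelerated_step {ψ : E → ℝ} {D : E → E} {L : ℝ}
    (hlow : ∀ x y, ψ x + ⟪D x, y - x⟫ ≤ ψ y)
    (hupp : ∀ x y, ψ y ≤ ψ x + ⟪D x, y - x⟫ + L / 2 * ‖y - x‖ ^ 2)
    (hL : 0 ≤ L) {A a b : ℝ} (hA : 0 ≤ A) (ha : 0 < a) (haA : a ^ 2 ≤ A + a) (hb : L < b)
    {l z m g l' : E} (hm : (A + a) • m = a • z + A • l)
    (hl' : (A + a) • l' = a • (z - (a / b) • g) + A • l) (u : E) :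
    (A + a) * ψ l' ≤ A * ψ l + a * (ψ m + ⟪g, u - m⟫) + b / 2 * ‖u - z‖ ^ 2
      + (a ^ 2 * ‖g - D m‖ ^ 2 / (2 * (b - L)) + a * ⟪g - D m, m - z⟫) := by
  have hb0 : 0 < b := hL.trans_lt hb
  have hA' : 0 < A + a := by positivity
  set e := g - D m with he
  set uh := z - (a / b) • g with huh
  set w := uh - z with hw
  -- The point `uh` is the prox step from z: it minimizes the right-hand side over u.
  have h1 : a * ⟪g, uh - m⟫ + b / 2 * ‖w‖ ^ 2 ≤ a * ⟪g, u - m⟫ + b / 2 * ‖u - z‖ ^ 2 := by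
    have e1 : a • g = -(b • w) := by
      rw [hw, huh, sub_sub_cancel_left, smul_neg, smul_smul, mul_div_cancel₀ _ hb0.ne', neg_neg]
    have e2 : a * ⟪g, u - m⟫ - a * ⟪g, uh - m⟫ = - (b * ⟪w, u - uh⟫) := by
      rw [← mul_sub, ← inner_sub_right, sub_sub_sub_cancel_right, ← real_inner_smul_left, e1,
        inner_neg_left, real_inner_smul_left]
    have e3 : u - z = (u - uh) + w := by rw [hw]; abel
    have e4 : ‖u - z‖ ^ 2 = ‖u - uh‖ ^ 2 + 2 * ⟪w, u - uh⟫ + ‖w‖ ^ 2 := by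
      rw [e3, norm_add_sq_real, real_inner_comm]
    nlinarith [sq_nonneg ‖u - uh‖, mul_nonneg hb0.le (sq_nonneg ‖u - uh‖)]
  have h2 : (A + a) • (l' - m) = a • w := by
    rw [smul_sub, hm, hl', hw]; module
  have h3 : (A + a) * ‖l' - m‖ ^ 2 ≤ ‖w‖ ^ 2 := by
    have := congrArg (fun x => ‖x‖ ^ 2) h2
    simp only [norm_smul, mul_pow, Real.norm_eq_abs, sq_abs] at this
    have h5 : (A + a) * ((A + a) * ‖l' - m‖ ^ 2) ≤ (A + a) * ‖w‖ ^ 2 := by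
      have := mul_le_mul_of_nonneg_right haA (sq_nonneg ‖w‖)
      nlinarith
    exact le_of_mul_le_mul_left h5 hA'
  have h4 := mul_le_mul_of_nonneg_left (hupp m l') hA'.le
  have h6 := mul_le_mul_of_nonneg_left (hlow m l) hA
  have h7 : (A + a) * ⟪D m, l' - m⟫ = A * ⟪D m, l - m⟫ + a * ⟪D m, uh - m⟫ := by
    rw [← real_inner_smul_right, ← real_inner_smul_right, ← real_inner_smul_right,
      ← inner_add_right]
    congr 1
    rw [smul_sub, hl', add_smul]; module
  have h8 : a * ⟪D m, uh - m⟫ = a * ⟪g, uh - m⟫ - a * ⟪e, w⟫ + a * ⟪e, m - z⟫ := by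
    have e5 : uh - m = w - (m - z) := by rw [hw]; abel
    have e6 : D m = g - e := by rw [he]; abel
    rw [e6, inner_sub_left, e5, inner_sub_right e]
    ring
  -- The excess b - L over the smoothness constant absorbs the product of gradient error and step,
  -- by completing a square. This is why β must exceed L.
  have h9 : 0 ≤ a * ⟪e, w⟫ + (b - L) / 2 * ‖w‖ ^ 2 + a ^ 2 * ‖e‖ ^ 2 / (2 * (b - L)) := by
    have hbL : 0 < b - L := sub_pos.2 hb
    have h10 := sq_nonneg ‖a • e + (b - L) • w‖
    rw [norm_add_sq_real, norm_smul, norm_smul, real_inner_smul_left, real_inner_smul_right,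
      mul_pow, mul_pow, Real.norm_eq_abs, Real.norm_eq_abs, sq_abs, sq_abs] at h10
    have : a * ⟪e, w⟫ + (b - L) / 2 * ‖w‖ ^ 2 + a ^ 2 * ‖e‖ ^ 2 / (2 * (b - L)) =
        (a ^ 2 * ‖e‖ ^ 2 + 2 * (a * ((b - L) * ⟪e, w⟫)) + (b - L) ^ 2 * ‖w‖ ^ 2)
          / (2 * (b - L)) := by
      field_simp
      ring
    rw [this]
    positivity
  nlinarith [mul_le_mul_of_nonneg_left h3 hL]

/-- The sequence shifted by one place, starting from `0`. -/
def shiftSeq (z : ℕ → E) : ℕ → E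
  | 0 => 0
  | k + 1 => z k

/-- The accelerated gradient method with weights `α`, regularisation `β` and gradients `g`. -/
structure IsAccelerated (α β : ℕ → ℝ) (g l z m : ℕ → E) : Prop where
  m_zero : m 0 = 0
  l_zero : l 0 = -(α 0 / β 0) • g 0
  z_eq : ∀ t, z t = -(1 / β t) • ∑ k ∈ Finset.range (t + 1), α k • g k
  m_succ : ∀ t, m (t + 1) = (α (t + 1) / partialSum α (t + 1)) • z t
    + (1 - α (t + 1) / partialSum α (t + 1)) • l t
  l_succ : ∀ t, l (t + 1) = (α (t + 1) / partialSum α (t + 1)) • (z t - (α (t + 1) / β t) • g (t + 1))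
    + (1 - α (t + 1) / partialSum α (t + 1)) • l t

/-- The regularised linear model is a quadratic in u with Hessian β_t and minimizer z_t, so its
excess over the minimum is exactly β_t/2 ‖u - z_t‖². -/
lemma IsAccelerated.quadratic {α β : ℕ → ℝ} {g l z m : ℕ → E} (h : IsAccelerated α β g l z m)
    {t : ℕ} (hβ : 0 < β t) (c : ℕ → ℝ) (u : E) :
    ∑ k ∈ Finset.range (t + 1), α k * (c k + ⟪g k, u - m k⟫) + β t / 2 * ‖u‖ ^ 2 =
      ∑ k ∈ Finset.range (t + 1), α k * (c k + ⟪g k, z t - m k⟫) + β t / 2 * ‖z t‖ ^ 2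
        + β t / 2 * ‖u - z t‖ ^ 2 := by
  have h1 : ∑ k ∈ Finset.range (t + 1), α k • g k = -(β t • z t) := by
    rw [h.z_eq t, smul_smul, mul_neg, mul_one_div_cancel hβ.ne', neg_one_smul, neg_neg]
  have h2 : ∀ v : E, ∑ k ∈ Finset.range (t + 1), α k * (c k + ⟪g k, v - m k⟫) =
      ∑ k ∈ Finset.range (t + 1), α k * (c k - ⟪g k, m k⟫) - β t * ⟪z t, v⟫ := by
    intro v
    have h3 := congrArg (fun x => ⟪x, v⟫) h1
    simp only [sum_inner, real_inner_smul_left, inner_neg_left] at h3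
    rw [sub_eq_add_neg, ← h3, ← Finset.sum_add_distrib]
    refine Finset.sum_congr rfl fun k _ => ?_
    rw [inner_sub_right]; ring
  rw [h2, h2, norm_sub_sq_real, real_inner_self_eq_norm_sq, real_inner_comm]
  ring

/-- The estimate-sequence inequality of the accelerated method. -/
theorem IsAccelerated.estimate {ψ : E → ℝ} {D : E → E} {L : ℝ}
    (hlow : ∀ x y, ψ x + ⟪D x, y - x⟫ ≤ ψ y)
    (hupp : ∀ x y, ψ y ≤ ψ x + ⟪D x, y - x⟫ + L / 2 * ‖y - x‖ ^ 2) (hL : 0 ≤ L)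
    {α β : ℕ → ℝ} (hα : ∀ t, 0 < α t) (hαA : ∀ t, α t ^ 2 ≤ partialSum α t)
    (hβ : ∀ t, L < β t) (hmono : Monotone β) {g l z m : ℕ → E} (h : IsAccelerated α β g l z m)
    (t : ℕ) (u : E) :
    partialSum α t * ψ (l t) + β t / 2 * ‖u - z t‖ ^ 2 ≤
      ∑ k ∈ Finset.range (t + 1), α k * (ψ (m k) + ⟪D (m k), u - m k⟫) + β t / 2 * ‖u‖ ^ 2
      + ∑ k ∈ Finset.range (t + 1), α k ^ 2 * ‖g k - D (m k)‖ ^ 2 / (2 * (β (k - 1) - L))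
      + ∑ k ∈ Finset.range (t + 1), α k * ⟪g k - D (m k), u - shiftSeq z k⟫ := by
  have hβ0 : ∀ t, 0 < β t := fun t => hL.trans_lt (hβ t)
  have hpos : ∀ t, 0 < partialSum α t := fun t =>
    Finset.sum_pos (fun k _ => hα k) ⟨0, by simp⟩
  -- Step k is made with β_{k-1}. For k = 0 the truncated subtraction gives β_0, which is the one
  -- used in the initial step.
  set r : ℕ → ℝ := fun k => α k ^ 2 * ‖g k - D (m k)‖ ^ 2 / (2 * (β (k - 1) - L)) with hr
  set q : ℕ → ℝ := fun k => α k * ⟪g k - D (m k), m k - shiftSeq z k⟫ with hq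
  -- The induction runs with the minimum of the model, attained at z_t. A general u enters only
  -- afterwards, through `IsAccelerated.quadratic`.
  have main : ∀ t, partialSum α t * ψ (l t) ≤
      ∑ k ∈ Finset.range (t + 1), α k * (ψ (m k) + ⟪g k, z t - m k⟫) + β t / 2 * ‖z t‖ ^ 2
      + ∑ k ∈ Finset.range (t + 1), (r k + q k) := by
    intro t
    induction t with
    | zero =>
      have hs := accelerated_step hlow hupp hL (A := 0) (a := α 0) (b := β 0) (l := 0) (z := 0)
        (m := m 0) (g := g 0) (l' := l 0) le_rfl (hα 0)
        (by have := hαA 0; simpa [partialSum] using this) (hβ 0)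
        (by rw [h.m_zero]; simp) (by rw [h.l_zero]; simp) (z 0)
      simp only [zero_add, zero_mul, sub_zero] at hs
      simp only [partialSum, zero_add, Finset.sum_range_one, hr, hq, shiftSeq, sub_zero]
      simpa using hs
    | succ t ih =>
      have hp := hpos (t + 1)
      have hps := partialSum_succ α t
      have e1 : ∀ x y : E, (partialSum α t + α (t + 1)) •
          ((α (t + 1) / partialSum α (t + 1)) • x + (1 - α (t + 1) / partialSum α (t + 1)) • y) =
          α (t + 1) • x + partialSum α t • y := by
        intro x y
        rw [← hps, smul_add, smul_smul, smul_smul, mul_div_cancel₀ _ hp.ne', mul_sub, mul_one,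
          mul_div_cancel₀ _ hp.ne', hps, add_sub_cancel_right]
      have hs := accelerated_step hlow hupp hL (A := partialSum α t) (a := α (t + 1)) (b := β t)
        (l := l t) (z := z t) (m := m (t + 1)) (g := g (t + 1)) (l' := l (t + 1)) (hpos t).le
        (hα _) (hps ▸ hαA (t + 1)) (hβ t) (by rw [h.m_succ t]; exact e1 _ _)
        (by rw [h.l_succ t]; exact e1 _ _) (z (t + 1))
      rw [Finset.sum_range_succ (fun k => α k * (ψ (m k) + ⟪g k, z (t + 1) - m k⟫)),
        Finset.sum_range_succ (fun k => r k + q k)]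
      have hquad := h.quadratic (hβ0 t) (fun k => ψ (m k)) (z (t + 1))
      have hm := hmono (Nat.le_succ t)
      have hm2 : β t / 2 * ‖z (t + 1)‖ ^ 2 ≤ β (t + 1) / 2 * ‖z (t + 1)‖ ^ 2 := by gcongr
      have e2 : r (t + 1) + q (t + 1) = α (t + 1) ^ 2 * ‖g (t + 1) - D (m (t + 1))‖ ^ 2
          / (2 * (β t - L)) + α (t + 1) * ⟪g (t + 1) - D (m (t + 1)), m (t + 1) - z t⟫ := rfl
      rw [e2, hps]
      linarith
  have h1 := main t
  have h2 := h.quadratic (hβ0 t) (fun k => ψ (m k)) u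
  -- Replacing g_k by the exact gradient costs the error tested against u - m_k. Together with the
  -- error tested against m_k - z_{k-1} this becomes a test against u - z_{k-1}, which for fixed u
  -- is known before the noise of step k: a martingale term.
  have h3 : ∑ k ∈ Finset.range (t + 1), α k * (ψ (m k) + ⟪g k, u - m k⟫)
      + ∑ k ∈ Finset.range (t + 1), (r k + q k) =
      ∑ k ∈ Finset.range (t + 1), α k * (ψ (m k) + ⟪D (m k), u - m k⟫)
      + ∑ k ∈ Finset.range (t + 1), r k
      + ∑ k ∈ Finset.range (t + 1), α k * ⟪g k - D (m k), u - shiftSeq z k⟫ := by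
    simp only [← Finset.sum_add_distrib]
    refine Finset.sum_congr rfl fun k _ => ?_
    simp only [hq]
    have e3 : u - shiftSeq z k = (u - m k) + (m k - shiftSeq z k) := by abel
    rw [e3, inner_add_right, inner_sub_left _ _ (u - m k)]
    ring
  linarith

set_option maxHeartbeats 1000000 in
/-- Boundedness of the iterates and the error of the accelerated method, when the gradient errors
`g k - D (m k)` behave like noise of variance `p² / (k + 1)`. -/
theorem exists_accelerated_error {ψ : E → ℝ} {D : E → E} {L : ℝ}
    (hlow : ∀ x y, ψ x + ⟪D x, y - x⟫ ≤ ψ y)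
    (hupp : ∀ x y, ψ y ≤ ψ x + ⟪D x, y - x⟫ + L / 2 * ‖y - x‖ ^ 2) (hL : 0 ≤ L)
    {us : E} (hus : ∀ x, ψ us ≤ ψ x) {b₁ b₂ Ka Kb Kc c ρ : ℝ} (hb₁ : 0 < b₁) (hb₂ : 0 ≤ b₂)
    (hKa : 0 ≤ Ka) (hKb : 0 ≤ Kb) (hKc : 0 ≤ Kc) (hc : 0 < c) (hcK : 4 * (c * Kb) ≤ b₁)
    (hρ : 0 ≤ ρ) :
    ∃ K : ℝ, 0 ≤ K ∧ ∀ (α β : ℕ → ℝ) (g l z m : ℕ → E) (p Lam : ℝ) (T : ℕ),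
      (∀ t, 0 < α t) → (∀ t, α t ≤ t + 1) → (∀ t, α t ^ 2 ≤ partialSum α t) →
      Monotone β → 0 < p → 1 ≤ Lam →
      (∀ t : ℕ, L + b₁ * ((t + 1) * p) ≤ β t) → (∀ t : ℕ, β t ≤ L + b₂ * ((t + 1) * p)) →
      IsAccelerated α β g l z m →
      (∀ k ≤ T, ‖g k - D (m k)‖ ^ 2 ≤ Ka * Lam * p ^ 2 / (k + 1)) →
      (∀ t ≤ T, ∑ k ∈ Finset.range (t + 1), α k * ⟪g k - D (m k), us - shiftSeq z k⟫ ≤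
        c / ((t + 1) * p) * (Kb * p ^ 2 * ∑ k ∈ Finset.range (t + 1),
          ((k : ℝ) + 1) * ‖us - shiftSeq z k‖ ^ 2) + Lam * ((t + 1) * p) / c) →
      ‖∑ k ∈ Finset.range (T + 1), α k • (g k - D (m k))‖ ≤ Kc * Lam * ((T + 1) * p) →
      ∀ u : E, ‖u‖ ≤ ρ → partialSum α T * ψ (l T) ≤
        ∑ k ∈ Finset.range (T + 1), α k * (ψ (m k) + ⟪D (m k), u - m k⟫)
          + L * ρ ^ 2 / 2 + K * Lam * ((T + 1) * p) := by
  set R := ‖us‖ with hR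
  -- Chosen so that the bound Kq · Lam on ‖us - z‖² reproduces itself in the induction `hiter`.
  set Kq := 2 * R ^ 2 + 4 / b₁ * (Ka / b₁ + 1 / c) with hKq
  have hKq0 : 0 ≤ Kq := by positivity
  -- The four contributions: growth of the regularisation, squared errors, the martingale term
  -- tested against us, and the change of test point from us to u.
  refine ⟨b₂ * ρ ^ 2 / 2 + Ka / b₁ + (c * Kb * Kq + 1 / c) + (ρ + R) * Kc, by positivity, ?_⟩
  intro α β g l z m p Lam T hα hα1 hαA hmono hp hLam hβ1 hβ2 hacc ha hb hcs u hu
  have hβL : ∀ t, L < β t := fun t => lt_of_lt_of_le (by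
    have : 0 < b₁ * ((t + 1) * p) := by positivity
    linarith) (hβ1 t)
  have hN : ∀ t ≤ T, ∑ k ∈ Finset.range (t + 1),
      α k ^ 2 * ‖g k - D (m k)‖ ^ 2 / (2 * (β (k - 1) - L)) ≤ Ka / b₁ * Lam * ((t + 1) * p) := by
    intro t ht
    -- With α_k ≤ k + 1, squared error of order p²/(k + 1) and β_{k-1} - L of order (k + 1)p, every
    -- summand has the same order p.
    have : ∀ k ∈ Finset.range (t + 1),
        α k ^ 2 * ‖g k - D (m k)‖ ^ 2 / (2 * (β (k - 1) - L)) ≤ Ka / b₁ * Lam * p := by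
      intro k hk
      have hk' : k ≤ T := (Nat.lt_succ_iff.1 (Finset.mem_range.1 hk)).trans ht
      have h1 : b₁ * ((k + 1) / 2 * p) ≤ β (k - 1) - L := by
        have h2 := hβ1 (k - 1)
        have h3 : ((k : ℝ) + 1) / 2 ≤ ((k - 1 : ℕ) : ℝ) + 1 := by
          rcases k with _ | k
          · norm_num
          · simp only [Nat.cast_add, Nat.cast_one, Nat.add_sub_cancel]
            have : (0 : ℝ) ≤ k := Nat.cast_nonneg k
            linarith
        have h4 : b₁ * ((k + 1) / 2 * p) ≤ b₁ * ((((k - 1 : ℕ) : ℝ) + 1) * p) := by gcongr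
        linarith
      have h5 : α k ^ 2 * ‖g k - D (m k)‖ ^ 2 ≤ ((k : ℝ) + 1) ^ 2 * (Ka * Lam * p ^ 2 / (k + 1)) :=
        mul_le_mul (pow_le_pow_left₀ (hα k).le (hα1 k) 2) (ha k hk') (by positivity) (by positivity)
      have h6 : 0 < b₁ * (((k : ℝ) + 1) / 2 * p) := by positivity
      calc α k ^ 2 * ‖g k - D (m k)‖ ^ 2 / (2 * (β (k - 1) - L))
          ≤ (((k : ℝ) + 1) ^ 2 * (Ka * Lam * p ^ 2 / (k + 1))) / (2 * (b₁ * ((k + 1) / 2 * p))) := by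
            gcongr
        _ = Ka / b₁ * Lam * p := by field_simp
    refine (Finset.sum_le_sum this).trans (le_of_eq ?_)
    rw [Finset.sum_const, Finset.card_range, nsmul_eq_mul]
    push_cast; ring
  have hsumQ : ∀ t : ℕ, (∀ k ≤ t, ‖us - shiftSeq z k‖ ^ 2 ≤ Kq * Lam) → t ≤ T →
      ∑ k ∈ Finset.range (t + 1), α k * ⟪g k - D (m k), us - shiftSeq z k⟫ ≤
        (c * Kb * Kq + 1 / c) * Lam * ((t + 1) * p) := by
    intro t hQ ht
    have h1 : ∑ k ∈ Finset.range (t + 1), ((k : ℝ) + 1) * ‖us - shiftSeq z k‖ ^ 2 ≤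
        (t + 1) ^ 2 * (Kq * Lam) := by
      have : ∀ k ∈ Finset.range (t + 1), ((k : ℝ) + 1) * ‖us - shiftSeq z k‖ ^ 2 ≤
          (t + 1) * (Kq * Lam) := by
        intro k hk
        have hkt : k ≤ t := Nat.lt_succ_iff.1 (Finset.mem_range.1 hk)
        have hkt' : (k : ℝ) ≤ t := by exact_mod_cast hkt
        exact mul_le_mul (by linarith) (hQ k hkt) (by positivity) (by positivity)
      refine (Finset.sum_le_sum this).trans (le_of_eq ?_)
      rw [Finset.sum_const, Finset.card_range, nsmul_eq_mul]
      push_cast; ring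
    refine (hb t ht).trans ?_
    calc c / ((t + 1) * p) * (Kb * p ^ 2 * ∑ k ∈ Finset.range (t + 1),
          ((k : ℝ) + 1) * ‖us - shiftSeq z k‖ ^ 2) + Lam * ((t + 1) * p) / c
        ≤ c / ((t + 1) * p) * (Kb * p ^ 2 * ((t + 1) ^ 2 * (Kq * Lam)))
          + Lam * ((t + 1) * p) / c := by gcongr
      _ = (c * Kb * Kq + 1 / c) * Lam * ((t + 1) * p) := by field_simp
  have hiter : ∀ t ≤ T + 1, ∀ k ≤ t, ‖us - shiftSeq z k‖ ^ 2 ≤ Kq * Lam := by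
    intro t
    induction t with
    | zero =>
      intro _ k hk
      obtain rfl : k = 0 := by omega
      simp only [shiftSeq, sub_zero]
      have h1 : 0 ≤ 4 / b₁ * (Ka / b₁ + 1 / c) := by positivity
      nlinarith [sq_nonneg R]
    | succ t ih =>
      intro ht k hk
      rcases Nat.lt_or_ge k (t + 1) with hk' | hk'
      · exact ih (by omega) k (by omega)
      obtain rfl : k = t + 1 := by omega
      simp only [shiftSeq]
      have h1 := hacc.estimate hlow hupp hL hα hαA hβL hmono t us
      have h2 := hN t (by omega)
      have h3 := hsumQ t (ih (by omega)) (by omega)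
      -- At the minimizer us the model lies below the minimum of ψ, so both function-value terms
      -- cancel and only the distance to z_t remains.
      have h4 : ∑ k ∈ Finset.range (t + 1), α k * (ψ (m k) + ⟪D (m k), us - m k⟫) ≤
          partialSum α t * ψ (l t) := by
        rw [partialSum, Finset.sum_mul]
        refine Finset.sum_le_sum fun k _ => mul_le_mul_of_nonneg_left ?_ (hα k).le
        exact (hlow _ _).trans (hus _)
      set d := ‖us - z t‖ ^ 2
      have h5 : β t / 2 * d ≤ β t / 2 * R ^ 2
          + (Ka / b₁ + (c * Kb * Kq + 1 / c)) * Lam * ((t + 1) * p) := by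
        rw [← hR] at h1
        linarith
      by_contra hcon
      push Not at hcon
      have hw : 0 < ((t : ℝ) + 1) * p := by positivity
      have h6 : R ^ 2 ≤ d := by
        have h1 : 0 ≤ 4 / b₁ * (Ka / b₁ + 1 / c) := by positivity
        nlinarith [sq_nonneg R]
      have h7 : b₁ * ((t + 1) * p) / 2 * (d - R ^ 2) ≤ β t / 2 * (d - R ^ 2) := by
        refine mul_le_mul_of_nonneg_right ?_ (by linarith)
        have := hβ1 t
        linarith
      have h8 : b₁ / 2 * (d - R ^ 2) ≤ (Ka / b₁ + (c * Kb * Kq + 1 / c)) * Lam := by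
        refine le_of_mul_le_mul_right ?_ hw
        linarith
      -- The smallness of c lets half of the left-hand side b₁/2 · Kq absorb the feedback of the
      -- earlier distances.
      have h9 : c * Kb * Kq ≤ b₁ / 4 * Kq := by
        refine mul_le_mul_of_nonneg_right (by linarith) hKq0
      have h10 : b₁ * Kq = 2 * b₁ * R ^ 2 + 4 * (Ka / b₁ + 1 / c) := by
        rw [hKq]; field_simp
      have h11 : b₁ / 2 * (Kq * Lam) < b₁ / 2 * d := by gcongr
      have h12 := mul_le_mul_of_nonneg_right h9 (by linarith : (0 : ℝ) ≤ Lam)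
      have h13 : b₁ * R ^ 2 ≤ b₁ * R ^ 2 * Lam := le_mul_of_one_le_right (by positivity) hLam
      have h14 : b₁ * Kq * Lam = (2 * b₁ * R ^ 2 + 4 * (Ka / b₁ + 1 / c)) * Lam := by rw [h10]
      have h15 : 0 ≤ (Ka / b₁ + 1 / c) * Lam := by positivity
      linarith
  have h1 := hacc.estimate hlow hupp hL hα hαA hβL hmono T u
  have h2 := hN T le_rfl
  have h3 := hsumQ T (fun k hk => hiter T (by omega) k hk) le_rfl
  -- The dependence on u is moved into one fixed vector sum. A single event thus serves all u of the
  -- ball at once, including the random u chosen later.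
  have h4 : ∑ k ∈ Finset.range (T + 1), α k * ⟪g k - D (m k), u - shiftSeq z k⟫ =
      ⟪∑ k ∈ Finset.range (T + 1), α k • (g k - D (m k)), u - us⟫
      + ∑ k ∈ Finset.range (T + 1), α k * ⟪g k - D (m k), us - shiftSeq z k⟫ := by
    rw [sum_inner, ← Finset.sum_add_distrib]
    refine Finset.sum_congr rfl fun k _ => ?_
    have e3 : u - shiftSeq z k = (u - us) + (us - shiftSeq z k) := by abel
    rw [e3, inner_add_right, real_inner_smul_left]
    ring
  have h5 : ⟪∑ k ∈ Finset.range (T + 1), α k • (g k - D (m k)), u - us⟫ ≤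
      Kc * Lam * ((T + 1) * p) * (ρ + R) := by
    refine (real_inner_le_norm _ _).trans ?_
    refine mul_le_mul hcs ?_ (norm_nonneg _) (by positivity)
    exact (norm_sub_le _ _).trans (by linarith)
  have h6 : 0 ≤ β T / 2 * ‖u - z T‖ ^ 2 := by
    have := (hL.trans_lt (hβL T)).le
    positivity
  have h7 : β T / 2 * ‖u‖ ^ 2 ≤ L * ρ ^ 2 / 2 + b₂ * ρ ^ 2 / 2 * Lam * ((T + 1) * p) := by
    have e1 : ‖u‖ ^ 2 ≤ ρ ^ 2 := pow_le_pow_left₀ (norm_nonneg _) hu 2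
    have e2 := (hL.trans_lt (hβL T)).le
    have e3 : β T / 2 * ‖u‖ ^ 2 ≤ (L + b₂ * ((T + 1) * p)) / 2 * ρ ^ 2 := by
      have := hβ2 T
      gcongr
    have e4 : 0 ≤ b₂ * ρ ^ 2 / 2 * ((T + 1) * p) := by positivity
    nlinarith
  linarith

end Accelerated

/-! ### Duality for the consensus problem -/

/-! ### Local Lipschitz bounds within the affine hull -/

section LocalLipschitz

variable {n : ℕ} {X : Set (Vec n)} {f : Vec n → ℝ} {γ : ℝ}

lemma exists_ball_subset_of_mem_intrinsicInterior {S : AffineSubspace ℝ (Vec n)} {x₀ : Vec n}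
    (hS : affineSpan ℝ X = S) (hx₀ : x₀ ∈ intrinsicInterior ℝ X) :
    ∃ r > 0, ∀ y ∈ S, ‖y - x₀‖ < r → y ∈ X := by
  subst hS
  obtain ⟨y, hy, rfl⟩ := mem_intrinsicInterior.1 hx₀
  obtain ⟨r, hr, hball⟩ := Metric.mem_nhds_iff.1 (mem_interior_iff_mem_nhds.1 hy)
  refine ⟨r, hr, fun z hz hzr => ?_⟩
  have : (⟨z, hz⟩ : affineSpan ℝ X) ∈ Metric.ball y r := by
    rw [Metric.mem_ball, Subtype.dist_eq, dist_eq_norm]; exact hzr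
  exact hball this

lemma StrongConvexOn.convex_le (hf : StrongConvexOn X γ f) (hγ : 0 ≤ γ) {x y : Vec n} (hx : x ∈ X)
    (hy : y ∈ X) {s : ℝ} (h0 : 0 ≤ s) (h1 : s ≤ 1) :
    f ((1 - s) • x + s • y) ≤ (1 - s) * f x + s * f y := by
  have := hf.2 hx hy (sub_nonneg.2 h1) h0 (by ring)
  simp only [smul_eq_mul] at this
  have h2 : 0 ≤ (1 - s) * s * (γ / 2 * ‖x - y‖ ^ 2) :=
    mul_nonneg (mul_nonneg (sub_nonneg.2 h1) h0) (by positivity)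
  linarith

/-- A strongly convex function is locally Lipschitz from above near a relative interior point of
differentiability. -/
lemma StrongConvexOn.eventually_lipschitz_above (hf : StrongConvexOn X γ f) (hγ : 0 ≤ γ)
    {S : AffineSubspace ℝ (Vec n)} {x₀ g : Vec n} (hS : affineSpan ℝ X = S)
    (hx₀ : x₀ ∈ intrinsicInterior ℝ X) (hg : HasGradientWithinAt f g X x₀) {b : ℝ}
    (hb : ‖g‖ ≤ b) :
    ∀ᶠ r in nhdsWithin (0 : ℝ) (Set.Ioi 0), ∀ x ∈ X, ‖x - x₀‖ ≤ r → ∀ y ∈ S, ‖y - x‖ ≤ r →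
      y ∈ X ∧ f y ≤ f x + (3 * b + 2) * ‖y - x‖ := by
  have hx₀X : x₀ ∈ X := intrinsicInterior_subset hx₀
  obtain ⟨r₁, hr₁, hball⟩ := exists_ball_subset_of_mem_intrinsicInterior hS hx₀
  have hlit := hasGradientWithinAt_iff_isLittleO.1 hg
  have hbd := hlit.bound one_pos
  rw [Filter.Eventually, Metric.mem_nhdsWithin_iff] at hbd
  obtain ⟨r₂, hr₂, hbd⟩ := hbd
  filter_upwards [Ioo_mem_nhdsGT (show (0 : ℝ) < min r₁ r₂ / 3 by positivity)] with r hr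
  obtain ⟨hr0, hr3⟩ := hr
  have hr1 : 3 * r < r₁ := by have := min_le_left r₁ r₂; linarith
  have hr2 : 3 * r < r₂ := by have := min_le_right r₁ r₂; linarith
  intro x hx hxr y hy hyr
  have hyX : y ∈ X := by
    refine hball y hy ?_
    have : y - x₀ = (y - x) + (x - x₀) := by abel
    rw [this]
    exact (norm_add_le _ _).trans_lt (by linarith)
  refine ⟨hyX, ?_⟩
  rcases eq_or_ne y x with rfl | hne
  · simp
  have hd : 0 < ‖y - x‖ := norm_pos_iff.2 (sub_ne_zero.2 hne)
  set s := ‖y - x‖ / r with hs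
  have hs0 : 0 < s := by positivity
  have hs1 : s ≤ 1 := (div_le_one hr0).2 hyr
  -- Extend the segment from x through y to length r. Convexity then gives f y - f x ≤ s (f w - f x)
  -- with s = ‖y - x‖ / r.
  set w := x + s⁻¹ • (y - x) with hw
  have hxS : x ∈ S := hS ▸ subset_affineSpan ℝ X hx
  have hwS : w ∈ S := by
    have := AffineMap.lineMap_mem s⁻¹ hxS hy
    rw [AffineMap.lineMap_apply] at this
    simpa [hw, add_comm] using this
  have hwn : ‖w - x‖ = r := by
    rw [hw, add_sub_cancel_left, norm_smul, norm_inv, Real.norm_of_nonneg hs0.le, hs]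
    field_simp
  have hwx : ‖w - x₀‖ ≤ 2 * r := by
    have : w - x₀ = (w - x) + (x - x₀) := by abel
    rw [this]
    exact (norm_add_le _ _).trans (by linarith)
  have hwX : w ∈ X := hball w hwS (by linarith)
  have hy' : y = (1 - s) • x + s • w := by
    rw [hw, smul_add, smul_smul, mul_inv_cancel₀ hs0.ne']; module
  have h1 := hf.convex_le hγ hx hwX hs0.le hs1
  rw [← hy'] at h1
  have hb0 : 0 ≤ b := (norm_nonneg _).trans hb
  have h2 : f w ≤ f x₀ + (b + 1) * (2 * r) := by
    have h3 := hbd ⟨(by rw [Metric.mem_ball, dist_eq_norm]; linarith : w ∈ Metric.ball x₀ r₂), hwX⟩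
    simp only [Set.mem_ofPred_eq, one_mul, Real.norm_eq_abs] at h3
    have h4 := (abs_le.1 h3).2
    have h5 := real_inner_le_norm g (w - x₀)
    have h6 : ‖g‖ * ‖w - x₀‖ ≤ b * (2 * r) := mul_le_mul hb hwx (norm_nonneg _) hb0
    linarith
  have h3 : f x₀ - b * r ≤ f x := by
    have h4 := hf.subgradient hg hx₀X hx
    have h5 := (abs_le.1 (abs_real_inner_le_norm g (x - x₀))).1
    have h6 : ‖g‖ * ‖x - x₀‖ ≤ b * r := mul_le_mul hb hxr (norm_nonneg _) hb0
    have h7 : 0 ≤ γ / 2 * ‖x - x₀‖ ^ 2 := by positivity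
    linarith
  -- The constant adds the upper bound 2(b + 1)r at w, from differentiability at x₀, and the lower
  -- bound -br at x, from the subgradient inequality.
  have h4 : s * (f w - f x) ≤ s * ((3 * b + 2) * r) := mul_le_mul_of_nonneg_left (by linarith) hs0.le
  have h5 : s * ((3 * b + 2) * r) = (3 * b + 2) * ‖y - x‖ := by rw [hs]; field_simp
  linarith

end LocalLipschitz

/-! ### Lagrange duality between the consensus problem and the dual function -/

section Duality

variable {V : Type u} [Fintype V] {n : ℕ} {X : V → Set (Vec n)}
  {f : V → Vec n → ℝ} {γ : ℝ} {xs gs : Tab V n}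

/-- Freeze all other nodes at xs and vary node i only: distances are unchanged, and the factor 1/m
of the objective cancels against γ/m. -/
lemma StrongConvexOn.component [DecidableEq V] [Nonempty V] (hxs : ∀ i, xs i ∈ X i)
    (hf : StrongConvexOn {x : Tab V n | ∀ i, x i ∈ X i} (γ / Fintype.card V) (objective f)) (i : V) :
    StrongConvexOn (X i) γ (f i) := by
  let up : Vec n → Tab V n := fun x => WithLp.toLp 2 (Function.update xs.ofLp i x)
  have hup : ∀ x ∈ X i, up x ∈ {x : Tab V n | ∀ i, x i ∈ X i} := by
    intro x hx j
    rcases eq_or_ne j i with rfl | hj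
    · simpa [up] using hx
    · simpa [up, hj] using hxs j
  have hcomb : ∀ (x y : Vec n) (a b : ℝ), a + b = 1 → a • up x + b • up y = up (a • x + b • y) := by
    intro x y a b hab
    refine PiLp.ext fun j => ?_
    rcases eq_or_ne j i with rfl | hj
    · simp [up]
    · simp only [up, PiLp.add_apply, PiLp.smul_apply, Function.update_of_ne hj]
      rw [← add_smul, hab, one_smul]
  have hobj : ∀ x, objective f (up x) = (1 / (Fintype.card V : ℝ)) *
      (f i x + ∑ j ∈ Finset.univ.erase i, f j (xs j)) := by
    intro x
    rw [objective, ← Finset.add_sum_erase _ _ (Finset.mem_univ i)]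
    congr 2
    · simp [up]
    · refine Finset.sum_congr rfl fun j hj => ?_
      simp [up, Finset.ne_of_mem_erase hj]
  have hnorm : ∀ x y, ‖up x - up y‖ = ‖x - y‖ := by
    intro x y
    have : ‖up x - up y‖ ^ 2 = ‖x - y‖ ^ 2 := by
      rw [PiLp.norm_sq_eq_of_L2, Finset.sum_eq_single i]
      · simp [up]
      · intro j _ hj; simp [up, hj]
      · simp
    exact (pow_left_inj₀ (norm_nonneg _) (norm_nonneg _) two_ne_zero).1 this
  have hm : (0 : ℝ) < Fintype.card V := Nat.cast_pos.2 Fintype.card_pos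
  refine ⟨fun x hx y hy a b ha hb hab => ?_, fun x hx y hy a b ha hb hab => ?_⟩
  · have := hf.1 (hup x hx) (hup y hy) ha hb hab
    rw [hcomb _ _ _ _ hab] at this
    simpa [up] using this i
  · have := hf.2 (hup x hx) (hup y hy) ha hb hab
    rw [hcomb _ _ _ _ hab, hobj, hobj, hobj, hnorm] at this
    simp only [smul_eq_mul] at this ⊢
    have h2 := mul_le_mul_of_nonneg_left this hm.le
    have h3 : ∀ c d : ℝ, (Fintype.card V : ℝ) * (1 / Fintype.card V * (c + d)) = c + d := by
      intro c d; field_simp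
    have h4 : (Fintype.card V : ℝ) * (γ / Fintype.card V / 2 * ‖x - y‖ ^ 2) = γ / 2 * ‖x - y‖ ^ 2 := by
      field_simp
    set c := ∑ j ∈ Finset.univ.erase i, f j (xs j)
    have hb' : b = 1 - a := by linarith
    subst hb'
    have h5 : (Fintype.card V : ℝ) * (a * (1 / Fintype.card V * (f i x + c)) +
        (1 - a) * (1 / Fintype.card V * (f i y + c)) - a * (1 - a) *
          (γ / Fintype.card V / 2 * ‖x - y‖ ^ 2)) =
        a * (f i x + c) + (1 - a) * (f i y + c) - a * (1 - a) * (γ / 2 * ‖x - y‖ ^ 2) := by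
      field_simp
    rw [h3, h5] at h2
    linarith

/-- First-order optimality: the tangential gradients at the solution sum to zero. -/
lemma sum_gradient_eq_zero [DecidableEq V] {G : SimpleGraph V} [DecidableRel G.Adj]
    (hG : G.Connected) {S : AffineSubspace ℝ (Vec n)} (hS : ∀ i, affineSpan ℝ (X i) = S)
    (hxs0 : kronAct (sqrtLap G) xs = 0)
    (hmin : IsMinOn (objective f)
      {x : Tab V n | (∀ i, x i ∈ X i) ∧ kronAct (sqrtLap G) x = 0} xs)
    (hint : ∀ i, xs i ∈ intrinsicInterior ℝ (X i))
    (hg : ∀ i, gs i ∈ S.direction ∧ HasGradientWithinAt (f i) (gs i) (X i) (xs i)) :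
    ∑ i, gs i = 0 := by
  obtain ⟨i₀⟩ := hG.nonempty
  have hm : (0 : ℝ) < Fintype.card V := Nat.cast_pos.2 (Fintype.card_pos_iff.2 ⟨i₀⟩)
  -- Moving all nodes simultaneously along v keeps consensus, so minimality makes the directional
  -- derivative -‖v‖² non-negative.
  set v : Vec n := -∑ i, gs i with hv
  have hvS : v ∈ S.direction := S.direction.neg_mem (S.direction.sum_mem fun i _ => (hg i).1)
  have hcons := (kronAct_sqrtLap_eq_zero_iff hG xs).1 hxs0
  have hxsX : ∀ i, xs i ∈ X i := fun i => intrinsicInterior_subset (hint i)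
  choose r hr hball using fun i => exists_ball_subset_of_mem_intrinsicInterior (hS i) (hint i)
  have hmem : ∀ i, ∀ t : ℝ, 0 ≤ t → t ≤ r i / (2 * (‖v‖ + 1)) → xs i + t • v ∈ X i := by
    intro i t h0 ht
    refine hball i _ ?_ ?_
    · have hxS : xs i ∈ S := hS i ▸ subset_affineSpan ℝ _ (hxsX i)
      have := AffineSubspace.vadd_mem_of_mem_direction (S.direction.smul_mem t hvS) hxS
      rwa [vadd_eq_add, add_comm] at this
    · rw [add_sub_cancel_left, norm_smul, Real.norm_of_nonneg h0]
      rw [le_div_iff₀ (by positivity)] at ht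
      nlinarith [hr i, norm_nonneg v]
  have hpos : ∀ i, 0 < r i / (2 * (‖v‖ + 1)) := fun i => by have := hr i; positivity
  have hlim : Filter.Tendsto (fun t : ℝ => ∑ i, t⁻¹ * (f i (xs i + t • v) - f i (xs i)))
      (nhdsWithin 0 (Set.Ioi 0)) (nhds (∑ i, ⟪gs i, v⟫)) :=
    tendsto_finsetSum _ fun i _ => (hg i).2.tendsto_slope_segment (hpos i) (hmem i)
  have hev : ∀ᶠ t in nhdsWithin (0 : ℝ) (Set.Ioi 0),
      0 ≤ ∑ i, t⁻¹ * (f i (xs i + t • v) - f i (xs i)) := by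
    have hall : ∀ᶠ t in nhdsWithin (0 : ℝ) (Set.Ioi 0), ∀ i, xs i + t • v ∈ X i := by
      refine Filter.eventually_all.2 fun i => ?_
      filter_upwards [Ioo_mem_nhdsGT (hpos i)] with t ht
      exact hmem i t ht.1.le ht.2.le
    filter_upwards [hall, self_mem_nhdsWithin] with t ht ht0
    have ht0 : 0 < t := ht0
    let x : Tab V n := WithLp.toLp 2 fun i => xs i + t • v
    have hx : x ∈ {x : Tab V n | (∀ i, x i ∈ X i) ∧ kronAct (sqrtLap G) x = 0} := by
      refine ⟨ht, (kronAct_sqrtLap_eq_zero_iff hG x).2 fun i j => ?_⟩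
      simp only [x, hcons i j]
    have h1 : objective f xs ≤ objective f x := hmin hx
    rw [objective, objective] at h1
    have h2 := le_of_mul_le_mul_left h1 (by positivity)
    rw [← Finset.mul_sum, Finset.sum_sub_distrib]
    have h3 : ∑ i, f i (x i) = ∑ i, f i (xs i + t • v) := rfl
    exact mul_nonneg (inv_nonneg.2 ht0.le) (by linarith)
  have h := ge_of_tendsto hlim hev
  rw [← sum_inner] at h
  have h2 : ∑ i, gs i = -v := by rw [hv, neg_neg]
  rw [h2, inner_neg_left, real_inner_self_eq_norm_sq] at h
  have h3 : ‖v‖ = 0 := by nlinarith [norm_nonneg v]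
  rw [h2, norm_eq_zero.1 h3, neg_zero]

/-- The tabulated maximizers. -/
noncomputable def tabArgmax (xb : V → Vec n → Vec n) (μ : Tab V n) : Tab V n :=
  WithLp.toLp 2 fun i => xb i (μ i)

/-- The dual function in the variable transformed by the symmetric matrix `A`. -/
noncomputable def dualFun (X : V → Set (Vec n)) (f : V → Vec n → ℝ) (A : Matrix V V ℝ)
    (l : Tab V n) : ℝ := ∑ i, conjOn (X i) (f i) (kronAct A l i)

/-- The gradient of the dual function. -/
noncomputable def dualGrad (xb : V → Vec n → Vec n) (A : Matrix V V ℝ) (l : Tab V n) : Tab V n :=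
  kronAct A (tabArgmax xb (kronAct A l))

variable {xb : V → Vec n → Vec n} {A : Matrix V V ℝ}

lemma kronAct_sub (A : Matrix V V ℝ) (x y : Tab V n) :
    kronAct A (x - y) = kronAct A x - kronAct A y := map_sub (kronLin A) x y

lemma kronAct_zero (A : Matrix V V ℝ) : kronAct A (0 : Tab V n) = 0 := map_zero (kronLin A)

lemma kronAct_sum {ι : Type*} (A : Matrix V V ℝ) (s : Finset ι) (x : ι → Tab V n) :
    kronAct A (∑ k ∈ s, x k) = ∑ k ∈ s, kronAct A (x k) := map_sum (kronLin A) x s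

lemma dualFun_lower (hA : A.IsSymm) (hxb : ∀ i, IsConjArgmax (X i) (f i) γ (xb i)) (hγ : 0 < γ)
    (l l' : Tab V n) : dualFun X f A l + ⟪dualGrad xb A l, l' - l⟫ ≤ dualFun X f A l' := by
  rw [dualGrad, inner_kronAct_left hA, kronAct_sub, PiLp.inner_apply, dualFun, dualFun,
    ← Finset.sum_add_distrib]
  exact Finset.sum_le_sum fun i _ => (hxb i).lower hγ.le _ _

lemma dualFun_upper (hA : A.IsSymm) (hxb : ∀ i, IsConjArgmax (X i) (f i) γ (xb i)) (hγ : 0 < γ)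
    {L : ℝ} (hL : ∀ x : Tab V n, ‖kronAct A x‖ ^ 2 ≤ L * γ * ‖x‖ ^ 2) (l l' : Tab V n) :
    dualFun X f A l' ≤
      dualFun X f A l + ⟪dualGrad xb A l, l' - l⟫ + L / 2 * ‖l' - l‖ ^ 2 := by
  have h1 : dualFun X f A l' ≤ dualFun X f A l + ⟪dualGrad xb A l, l' - l⟫
      + ‖kronAct A (l' - l)‖ ^ 2 / (2 * γ) := by
    rw [dualGrad, inner_kronAct_left hA, kronAct_sub, PiLp.inner_apply, dualFun, dualFun,
      PiLp.norm_sq_eq_of_L2, Finset.sum_div, ← Finset.sum_add_distrib, ← Finset.sum_add_distrib]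
    exact Finset.sum_le_sum fun i _ => (hxb i).upper hγ _ _
  have h2 : ‖kronAct A (l' - l)‖ ^ 2 / (2 * γ) ≤ L / 2 * ‖l' - l‖ ^ 2 := by
    rw [div_le_iff₀ (by positivity)]
    have := hL (l' - l)
    linarith
  linarith

/-- By Fenchel's equality at the maximizers, a linear model of the dual function carries primal
objective values and the constraint residual paired with u. This is the bridge from the dual
estimate to primal accuracy. -/
lemma dualFun_add_inner (hA : A.IsSymm) (hxb : ∀ i, IsConjArgmax (X i) (f i) γ (xb i))
    (m u : Tab V n) : dualFun X f A m + ⟪dualGrad xb A m, u - m⟫ =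
      ⟪tabArgmax xb (kronAct A m), kronAct A u⟫ - ∑ i, f i (tabArgmax xb (kronAct A m) i) := by
  rw [dualGrad, inner_kronAct_left hA, kronAct_sub, inner_sub_right]
  have : dualFun X f A m = ⟪tabArgmax xb (kronAct A m), kronAct A m⟫
      - ∑ i, f i (tabArgmax xb (kronAct A m) i) := by
    rw [dualFun, PiLp.inner_apply, ← Finset.sum_sub_distrib]
    refine Finset.sum_congr rfl fun i _ => ?_
    rw [(hxb i _).2.1, real_inner_comm]
    rfl
  rw [this]; ring

lemma neg_sum_le_dualFun (hA : A.IsSymm) (hxb : ∀ i, IsConjArgmax (X i) (f i) γ (xb i))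
    (hγ : 0 < γ) (hxs : ∀ i, xs i ∈ X i) (hxs0 : kronAct A xs = 0) (l : Tab V n) :
    -∑ i, f i (xs i) ≤ dualFun X f A l := by
  have h1 : ∑ i, (⟪kronAct A l i, xs i⟫ - f i (xs i)) ≤ dualFun X f A l :=
    Finset.sum_le_sum fun i _ => (hxb i).le_conj hγ.le (hxs i) _
  rw [Finset.sum_sub_distrib, ← PiLp.inner_apply, inner_kronAct_left hA, hxs0,
    inner_zero_right] at h1
  linarith

/-- Strong duality: the gradients at the solution are subgradients, so their preimage ls attains the
weak duality bound `neg_sum_le_dualFun` and minimizes the dual function. -/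
lemma dualFun_le_neg_sum (hA : A.IsSymm) (hxb : ∀ i, IsConjArgmax (X i) (f i) γ (xb i))
    (hγ : 0 ≤ γ) (hxs0 : kronAct A xs = 0) {ls : Tab V n} (hls : kronAct A ls = gs)
    (hsub : ∀ i, ∀ x ∈ X i, f i (xs i) + ⟪gs i, x - xs i⟫ + γ / 2 * ‖x - xs i‖ ^ 2 ≤ f i x) :
    dualFun X f A ls ≤ -∑ i, f i (xs i) := by
  have h1 : dualFun X f A ls ≤ ∑ i, (⟪gs i, xs i⟫ - f i (xs i)) := by
    refine Finset.sum_le_sum fun i _ => ?_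
    rw [hls, (hxb i _).2.1]
    have := hsub i _ (hxb i (gs i)).1
    rw [inner_sub_right] at this
    have h2 : 0 ≤ γ / 2 * ‖xb i (gs i) - xs i‖ ^ 2 := by positivity
    linarith
  rw [Finset.sum_sub_distrib, ← PiLp.inner_apply, ← hls, inner_kronAct_left hA, hxs0,
    inner_zero_right] at h1
  linarith

/-- Primal accuracy of the averaged maximizers from the dual estimate. -/
theorem primal_of_dual (hA : A.IsSymm) (hxb : ∀ i, IsConjArgmax (X i) (f i) γ (xb i))
    (hγ : 0 < γ) (hconv : ∀ i, StrongConvexOn (X i) γ (f i)) (hxs : ∀ i, xs i ∈ X i)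
    (hxs0 : kronAct A xs = 0) {ls : Tab V n} (hls : kronAct A ls = gs)
    (hsub : ∀ i, ∀ x ∈ X i, f i (xs i) + ⟪gs i, x - xs i⟫ + γ / 2 * ‖x - xs i‖ ^ 2 ≤ f i x)
    {α : ℕ → ℝ} (hα : ∀ t, 0 < α t) {m : ℕ → Tab V n} {l : Tab V n} {T : ℕ} {η : ℝ}
    (hbound : ∀ u : Tab V n, ‖u‖ ≤ ‖ls‖ + 1 → partialSum α T * dualFun X f A l ≤
      ∑ k ∈ Finset.range (T + 1), α k * (dualFun X f A (m k) + ⟪dualGrad xb A (m k), u - m k⟫)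
        + partialSum α T * η) {x : Tab V n}
    (hx : partialSum α T • x =
      ∑ k ∈ Finset.range (T + 1), α k • tabArgmax xb (kronAct A (m k))) :
    (∀ i, x i ∈ X i) ∧ ∑ i, f i (x i) - ∑ i, f i (xs i) ≤ η ∧ ‖kronAct A x‖ ≤ η ∧
      γ / 2 * ‖x - xs‖ ^ 2 ≤ η := by
  have hS : 0 < partialSum α T := Finset.sum_pos (fun k _ => hα k) ⟨0, by simp⟩
  set S := partialSum α T with hSdef
  set y : ℕ → Tab V n := fun k => tabArgmax xb (kronAct A (m k)) with hy
  have hyX : ∀ k i, y k i ∈ X i := fun k i => (hxb i _).1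
  have hx' : x = ∑ k ∈ Finset.range (T + 1), (α k / S) • y k := by
    have : x = S⁻¹ • (S • x) := by rw [smul_smul, inv_mul_cancel₀ hS.ne', one_smul]
    rw [this, hx, Finset.smul_sum]
    refine Finset.sum_congr rfl fun k _ => ?_
    rw [smul_smul, div_eq_inv_mul]
  have hxi : ∀ i, x i = ∑ k ∈ Finset.range (T + 1), (α k / S) • y k i := by
    intro i; rw [hx']; simp
  have hw0 : ∀ k ∈ Finset.range (T + 1), 0 ≤ α k / S := fun k _ => (div_pos (hα k) hS).le
  have hw1 : ∑ k ∈ Finset.range (T + 1), α k / S = 1 := by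
    rw [← Finset.sum_div]; exact div_self hS.ne'
  have hcvx : ∀ i, ConvexOn ℝ (X i) (f i) := fun i =>
    UniformConvexOn.convexOn (hconv i) fun r => by simp only [Pi.zero_apply]; positivity
  have hxX : ∀ i, x i ∈ X i := fun i => by
    rw [hxi]; exact (hcvx i).1.sum_mem hw0 hw1 fun k _ => hyX k i
  have hjensen : S * ∑ i, f i (x i) ≤ ∑ k ∈ Finset.range (T + 1), α k * ∑ i, f i (y k i) := by
    have : ∑ i, f i (x i) ≤ ∑ i, ∑ k ∈ Finset.range (T + 1), (α k / S) * f i (y k i) := by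
      refine Finset.sum_le_sum fun i _ => ?_
      rw [hxi]; exact (hcvx i).map_sum_le hw0 hw1 fun k _ => hyX k i
    rw [Finset.sum_comm] at this
    have h2 := mul_le_mul_of_nonneg_left this hS.le
    refine h2.trans (le_of_eq ?_)
    rw [Finset.mul_sum]
    refine Finset.sum_congr rfl fun k _ => ?_
    rw [← Finset.mul_sum]
    field_simp
  have hmain : ∀ u : Tab V n, ‖u‖ ≤ ‖ls‖ + 1 →
      ∑ i, f i (x i) - ∑ i, f i (xs i) ≤ ⟪kronAct A x, u⟫ + η := by
    intro u hu
    have h1 := hbound u hu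
    have h2 := mul_le_mul_of_nonneg_left (neg_sum_le_dualFun (f := f) hA hxb hγ hxs hxs0 l) hS.le
    have h3 : ∑ k ∈ Finset.range (T + 1),
        α k * (dualFun X f A (m k) + ⟪dualGrad xb A (m k), u - m k⟫) =
        S * ⟪kronAct A x, u⟫ - ∑ k ∈ Finset.range (T + 1), α k * ∑ i, f i (y k i) := by
      rw [inner_kronAct_left hA, ← real_inner_smul_left, hx, sum_inner, ← Finset.sum_sub_distrib]
      refine Finset.sum_congr rfl fun k _ => ?_
      rw [dualFun_add_inner hA hxb, real_inner_smul_left]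
      ring
    rw [h3] at h1
    refine le_of_mul_le_mul_left ?_ hS
    linarith
  -- An infeasible x may undercut the optimal value, but by no more than the multiplier ls paired
  -- with the residual.
  have hlowF : ⟪kronAct A x, ls⟫ + γ / 2 * ‖x - xs‖ ^ 2 ≤ ∑ i, f i (x i) - ∑ i, f i (xs i) := by
    have h1 : ∑ i, (f i (xs i) + ⟪gs i, x i - xs i⟫ + γ / 2 * ‖x i - xs i‖ ^ 2) ≤ ∑ i, f i (x i) :=
      Finset.sum_le_sum fun i _ => hsub i _ (hxX i)
    rw [Finset.sum_add_distrib, Finset.sum_add_distrib, ← Finset.mul_sum] at h1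
    have h2 : ∑ i, ⟪gs i, x i - xs i⟫ = ⟪kronAct A x, ls⟫ := by
      have : ∑ i, ⟪gs i, x i - xs i⟫ = ⟪gs, x - xs⟫ := by rw [PiLp.inner_apply]; rfl
      rw [this, ← hls, inner_kronAct_left hA, kronAct_sub, hxs0, sub_zero, real_inner_comm]
    have h3 : ∑ i, ‖x i - xs i‖ ^ 2 = ‖x - xs‖ ^ 2 := by rw [PiLp.norm_sq_eq_of_L2]; rfl
    rw [h2, h3] at h1
    linarith
  have hη0 := hmain 0 (by rw [norm_zero]; positivity)
  rw [inner_zero_right, zero_add] at hη0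
  have hkey : ‖kronAct A x‖ + γ / 2 * ‖x - xs‖ ^ 2 ≤ η := by
    rcases eq_or_ne (kronAct A x) 0 with h0 | h0
    · rw [h0, inner_zero_left] at hlowF
      rw [h0, norm_zero]; linarith
    · have hn : 0 < ‖kronAct A x‖ := norm_pos_iff.2 h0
      -- Shifting ls by the unit vector against the residual makes ‖Ax‖ appear while the ls-terms
      -- cancel against `hlowF`. This is what the radius ‖ls‖ + 1 is for.
      have h1 := hmain (ls - ‖kronAct A x‖⁻¹ • kronAct A x) (by
        refine (norm_sub_le _ _).trans ?_
        rw [norm_smul, norm_inv, norm_norm, inv_mul_cancel₀ hn.ne'])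
      rw [inner_sub_right, real_inner_smul_right, real_inner_self_eq_norm_sq] at h1
      have h2 : ‖kronAct A x‖⁻¹ * ‖kronAct A x‖ ^ 2 = ‖kronAct A x‖ := by field_simp
      rw [h2] at h1
      linarith
  have hq : 0 ≤ γ / 2 * ‖x - xs‖ ^ 2 := by positivity
  exact ⟨hxX, hη0, by linarith, by linarith [norm_nonneg (kronAct A x)]⟩

end Duality

/-! ### Resampling coordinates of a product measure -/

section Resample

lemma measurable_update_prod {ι : Type*} [DecidableEq ι] {X : ι → Type*}
    [∀ i, MeasurableSpace (X i)] (q : ι) :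
    Measurable fun p : (∀ i, X i) × X q => Function.update p.1 q p.2 := by
  refine measurable_pi_iff.2 fun i => ?_
  rcases eq_or_ne i q with rfl | hi
  · simpa using measurable_snd
  · simp only [Function.update_of_ne hi]
    exact (measurable_pi_apply i).comp measurable_fst

/-- A product law is invariant under replacing one coordinate by a fresh draw, as checked on
cylinder sets. This replaces conditional expectation given all other coordinates. -/
lemma lintegral_infinitePi_update {ι : Type*} [DecidableEq ι] {X : ι → Type*}
    [∀ i, MeasurableSpace (X i)] (μ : ∀ i, Measure (X i)) [∀ i, IsProbabilityMeasure (μ i)] (q : ι)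
    {F : (∀ i, X i) → ENNReal} (hF : Measurable F) :
    ∫⁻ ω, F ω ∂Measure.infinitePi μ =
      ∫⁻ ω, ∫⁻ x, F (Function.update ω q x) ∂μ q ∂Measure.infinitePi μ := by
  have hmap : Measure.map (fun p : (∀ i, X i) × X q => Function.update p.1 q p.2)
      ((Measure.infinitePi μ).prod (μ q)) = Measure.infinitePi μ := by
    refine Measure.eq_infinitePi μ fun s t ht => ?_
    have hms : MeasurableSet ((s : Set ι).pi t) :=
      MeasurableSet.pi s.countable_toSet fun i _ => ht i
    rw [Measure.map_apply (measurable_update_prod q) hms]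
    by_cases hq : q ∈ s
    · have hpre : (fun p : (∀ i, X i) × X q => Function.update p.1 q p.2) ⁻¹' ((s : Set ι).pi t) =
          (((s.erase q : Finset ι) : Set ι).pi t) ×ˢ t q := by
        ext ⟨ω, x⟩
        simp only [Set.mem_preimage, Set.mem_pi, Finset.mem_coe, Set.mem_prod, Finset.mem_erase]
        constructor
        · intro h
          refine ⟨fun i hi => ?_, by simpa using h q hq⟩
          simpa [Function.update_of_ne hi.1] using h i hi.2
        · rintro ⟨h1, h2⟩ i hi
          rcases eq_or_ne i q with rfl | hne
          · simpa using h2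
          · simpa [Function.update_of_ne hne] using h1 i ⟨hne, hi⟩
      rw [hpre, Measure.prod_prod, Measure.infinitePi_pi μ fun i _ => ht i,
        Finset.prod_erase_mul _ _ hq]
    · have hpre : (fun p : (∀ i, X i) × X q => Function.update p.1 q p.2) ⁻¹' ((s : Set ι).pi t) =
          ((s : Set ι).pi t) ×ˢ Set.univ := by
        ext ⟨ω, x⟩
        simp only [Set.mem_preimage, Set.mem_pi, Finset.mem_coe, Set.mem_prod, Set.mem_univ,
          and_true]
        refine forall₂_congr fun i hi => ?_
        rw [Function.update_of_ne (by rintro rfl; exact hq hi)]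
      rw [hpre, Measure.prod_prod, Measure.infinitePi_pi μ fun i _ => ht i, measure_univ, mul_one]
  conv_lhs => rw [← hmap]
  rw [lintegral_map hF (measurable_update_prod q)]
  exact lintegral_prod _ (hF.comp (measurable_update_prod q)).aemeasurable

variable {ι : Type*} [DecidableEq ι] {A B : Type*} [MeasurableSpace A] [MeasurableSpace B]
  (a : ι → Measure A) (b : ι → Measure B) [∀ i, IsProbabilityMeasure (a i)]
  [∀ i, IsProbabilityMeasure (b i)]

/-- Resampling one half of a seed: resample the whole coordinate on both sides, whereupon the
superfluous integral has total mass one. Oracle samples and quantization seeds can thus be averaged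
out separately. -/
lemma lintegral_infinitePi_update_fst (q : ι) {F : (ι → A × B) → ENNReal} (hF : Measurable F) :
    ∫⁻ ω, F ω ∂Measure.infinitePi (fun i => (a i).prod (b i)) =
      ∫⁻ ω, ∫⁻ x, F (Function.update ω q (x, (ω q).2)) ∂a q
        ∂Measure.infinitePi (fun i => (a i).prod (b i)) := by
  have hm : Measurable fun p : (ι → A × B) × A =>
      F (Function.update p.1 q (p.2, (p.1 q).2)) := by
    have h1 : Measurable fun p : (ι → A × B) × A => (p.1, (p.2, (p.1 q).2)) := by fun_prop
    exact hF.comp ((measurable_update_prod (X := fun _ => A × B) q).comp h1)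
  rw [lintegral_infinitePi_update _ q hF, lintegral_infinitePi_update _ q hm.lintegral_prod_right']
  refine lintegral_congr fun ω => ?_
  have h2 : Measurable fun p : A × B => F (Function.update ω q p) :=
    hF.comp ((measurable_update_prod (X := fun _ => A × B) q).comp
      (measurable_const.prodMk measurable_id))
  simp only [Function.update_idem, Function.update_self]
  rw [lintegral_prod_symm _ h2.aemeasurable, lintegral_prod_symm]
  · simp
  · have h3 : Measurable fun p : (A × B) × A => F (Function.update ω q (p.2, p.1.2)) :=
      h2.comp (by fun_prop)
    exact h3.lintegral_prod_right'.aemeasurable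

lemma lintegral_infinitePi_update_snd (q : ι) {F : (ι → A × B) → ENNReal} (hF : Measurable F) :
    ∫⁻ ω, F ω ∂Measure.infinitePi (fun i => (a i).prod (b i)) =
      ∫⁻ ω, ∫⁻ y, F (Function.update ω q ((ω q).1, y)) ∂b q
        ∂Measure.infinitePi (fun i => (a i).prod (b i)) := by
  have hm : Measurable fun p : (ι → A × B) × B =>
      F (Function.update p.1 q ((p.1 q).1, p.2)) := by
    have h1 : Measurable fun p : (ι → A × B) × B => (p.1, ((p.1 q).1, p.2)) := by fun_prop
    exact hF.comp ((measurable_update_prod (X := fun _ => A × B) q).comp h1)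
  rw [lintegral_infinitePi_update _ q hF, lintegral_infinitePi_update _ q hm.lintegral_prod_right']
  refine lintegral_congr fun ω => ?_
  have h2 : Measurable fun p : A × B => F (Function.update ω q p) :=
    hF.comp ((measurable_update_prod (X := fun _ => A × B) q).comp
      (measurable_const.prodMk measurable_id))
  simp only [Function.update_idem, Function.update_self]
  rw [lintegral_prod _ h2.aemeasurable, lintegral_prod]
  · simp
  · have h3 : Measurable fun p : (A × B) × B => F (Function.update ω q (p.1.1, p.2)) :=
      h2.comp (by fun_prop)
    exact h3.lintegral_prod_right'.aemeasurable

/-- A product of factors, each depending on its own resampled component only and of conditional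
mean at most one, does not increase an integral. -/
lemma lintegral_mul_prod_le {Ω κ : Type*} [MeasurableSpace Ω] {μ : Measure Ω} {C : Type*}
    [MeasurableSpace C] (ν : κ → Measure C) (ρ : κ → Ω → C → Ω)
    (hρ : ∀ q, ∀ F : Ω → ENNReal, Measurable F →
      ∫⁻ ω, F ω ∂μ = ∫⁻ ω, ∫⁻ x, F (ρ q ω x) ∂ν q ∂μ)
    (Y : κ → Ω → ENNReal) (hY : ∀ q, Measurable (Y q)) (hYρ : ∀ q ω, Measurable fun x => Y q (ρ q ω x))
    (hdep : ∀ q q', q ≠ q' → ∀ ω x, Y q (ρ q' ω x) = Y q ω)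
    (hone : ∀ q ω, ∫⁻ x, Y q (ρ q ω x) ∂ν q ≤ 1)
    {Z : Ω → ENNReal} (hZ : Measurable Z) (hZdep : ∀ q ω x, Z (ρ q ω x) = Z ω) (I : Finset κ) :
    ∫⁻ ω, Z ω * ∏ q ∈ I, Y q ω ∂μ ≤ ∫⁻ ω, Z ω ∂μ := by
  classical
  induction I using Finset.induction_on with
  | empty => simp
  | insert q I hq ih =>
    refine le_trans ?_ ih
    -- Resampling seed q affects only the factor Y q. The rest leaves the inner integral, and what
    -- remains is at most one.
    rw [hρ q (fun ω => Z ω * ∏ q ∈ insert q I, Y q ω)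
      (hZ.mul (Finset.measurable_fun_prod _ fun q _ => hY q))]
    refine lintegral_mono fun ω => ?_
    have h1 : ∀ x, Z (ρ q ω x) * ∏ q' ∈ insert q I, Y q' (ρ q ω x) =
        (Z ω * ∏ q' ∈ I, Y q' ω) * Y q (ρ q ω x) := by
      intro x
      rw [Finset.prod_insert hq, hZdep, Finset.prod_congr rfl fun q' hq' =>
        hdep q' q (fun h => hq (h ▸ hq')) ω x]
      ring
    simp only [h1]
    rw [lintegral_const_mul _ (hYρ q ω)]
    exact mul_le_of_le_one_right' (hone q ω)

/-- Hoeffding's lemma. -/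
lemma lintegral_exp_sub_le_one {C : Type*} [MeasurableSpace C] {ν : Measure C}
    [IsProbabilityMeasure ν] {Z : C → ℝ} (hZ : Measurable Z) {c : ℝ} (hc : ∀ x, |Z x| ≤ c)
    (hmean : ∫ x, Z x ∂ν = 0) :
    ∫⁻ x, ENNReal.ofReal (Real.exp (Z x - c ^ 2 / 2)) ∂ν ≤ 1 := by
  have h1 := ProbabilityTheory.mgf_le_of_mem_Icc_of_integral_eq_zero (μ := ν) (X := Z) (a := -c)
    (b := c) (t := 1) hZ.aemeasurable
    (Filter.Eventually.of_forall fun x => abs_le.1 (hc x)) hmean one_pos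
  have h2 : ((‖c - -c‖₊ : ℝ) / 2) ^ 2 * 1 ^ 2 / 2 = c ^ 2 / 2 := by
    rw [coe_nnnorm, Real.norm_eq_abs, div_pow, sq_abs]; ring
  rw [h2, ProbabilityTheory.mgf] at h1
  simp only [one_mul] at h1
  have hint : Integrable (fun x => Real.exp (Z x - c ^ 2 / 2)) ν := by
    refine Integrable.of_bound (C := Real.exp (c - c ^ 2 / 2)) (by fun_prop)
      (Filter.Eventually.of_forall fun x => ?_)
    rw [Real.norm_of_nonneg (Real.exp_pos _).le]
    exact Real.exp_le_exp.2 (by linarith [(abs_le.1 (hc x)).2])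
  rw [← ofReal_integral_eq_lintegral_ofReal hint
    (Filter.Eventually.of_forall fun x => (Real.exp_pos _).le)]
  rw [← ENNReal.ofReal_one]
  refine ENNReal.ofReal_le_ofReal ?_
  simp only [Real.exp_sub]
  rw [integral_div]
  exact (div_le_one (Real.exp_pos _)).2 h1

end Resample

/-! ### The quantization noise -/

section Quantization

variable {n : ℕ}

lemma catVec_apply (w : Vec n) (u : ℝ) (k : Fin n) : catVec w u k =
    if (∑ j with j < k, w j) < u * ∑ j, w j ∧ u * ∑ j, w j ≤ ∑ j with j ≤ k, w j
    then 1 else 0 := rfl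

lemma posVec_apply (w : Vec n) (k : Fin n) : posVec w k = max 0 (w k) := rfl

lemma l1Norm_posVec (w : Vec n) : l1Norm (posVec w) = ∑ k, posVec w k :=
  Finset.sum_congr rfl fun _ _ => abs_of_nonneg (le_max_left _ _)

lemma measurable_catVec : Measurable fun p : Vec n × ℝ => catVec p.1 p.2 := by
  have hcoord : ∀ j, Measurable fun p : Vec n × ℝ => p.1 j := fun j => by fun_prop
  have : Measurable fun p : Vec n × ℝ => (catVec p.1 p.2).ofLp := by
    refine measurable_pi_iff.2 fun k => ?_
    simp only [catVec_apply]
    have hsum : ∀ s : Finset (Fin n), Measurable fun p : Vec n × ℝ => ∑ j ∈ s, p.1 j :=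
      fun s => Finset.measurable_fun_sum _ fun j _ => hcoord j
    have hs : MeasurableSet {p : Vec n × ℝ | (∑ j with j < k, p.1 j) < p.2 * ∑ j, p.1 j ∧
        p.2 * ∑ j, p.1 j ≤ ∑ j with j ≤ k, p.1 j} :=
      (measurableSet_lt (hsum _) (measurable_snd.mul (hsum _))).inter
        (measurableSet_le (measurable_snd.mul (hsum _)) (hsum _))
    exact Measurable.ite hs measurable_const measurable_const
  exact (WithLp.measurable_toLp 2 _).comp this

lemma measurable_posVec : Measurable (posVec : Vec n → Vec n) := by
  refine (WithLp.measurable_toLp 2 _).comp (measurable_pi_iff.2 fun k => ?_)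
  exact measurable_const.max (by fun_prop)

lemma measurable_l1Norm : Measurable (l1Norm : Vec n → ℝ) :=
  Finset.measurable_fun_sum _ fun k _ => by
    have : Measurable fun v : Vec n => v k := by fun_prop
    exact this.abs

/-- Index k is drawn when the seed falls into an interval of length w_k / ∑ w_j between consecutive
values of the distribution function. If all weights vanish, both sides are 0. -/
lemma integral_catVec (w : Vec n) (hw : ∀ k, 0 ≤ w k) (k : Fin n) :
    ∫ u : unitInterval, (∑ j, w j) * catVec w u k = w k := by
  rw [integral_const_mul]
  have hW0 : 0 ≤ ∑ j, w j := Finset.sum_nonneg fun j _ => hw j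
  rcases hW0.eq_or_lt with hW | hW
  · rw [← hW, zero_mul]
    exact ((Finset.sum_eq_zero_iff_of_nonneg fun j _ => hw j).1 hW.symm k (Finset.mem_univ k)).symm
  set W := ∑ j, w j
  set l := ∑ j with j < k, w j with hl
  set m := ∑ j with j ≤ k, w j with hm
  have hlm : m = l + w k := by
    have : (Finset.univ.filter fun j : Fin n => j ≤ k) =
        insert k (Finset.univ.filter fun j : Fin n => j < k) := by
      ext j; simp [le_iff_eq_or_lt]
    rw [hm, this, Finset.sum_insert (by simp), add_comm]
  have hl0 : 0 ≤ l := Finset.sum_nonneg fun j _ => hw j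
  have hmW : m ≤ W := Finset.sum_le_sum_of_subset_of_nonneg (Finset.filter_subset _ _)
    fun j _ _ => hw j
  have h1 : ∀ u : unitInterval, catVec w u k =
      (Set.Ioc (l / W) (m / W)).indicator (fun _ => (1 : ℝ)) (u : ℝ) := by
    intro u
    rw [catVec_apply, Set.indicator_apply]
    simp only [Set.mem_Ioc, div_lt_iff₀ hW, le_div_iff₀ hW]
    rfl
  simp only [h1]
  have h2 := unitInterval.measurePreserving_coe.integral_comp
    (MeasurableEmbedding.subtype_coe measurableSet_Icc)
    ((Set.Ioc (l / W) (m / W)).indicator (fun _ => (1 : ℝ)))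
  rw [h2, integral_indicator measurableSet_Ioc, Measure.restrict_restrict measurableSet_Ioc]
  have hsub : Set.Ioc (l / W) (m / W) ∩ unitInterval = Set.Ioc (l / W) (m / W) :=
    Set.inter_eq_left.2 fun x hx => ⟨(div_nonneg hl0 hW.le).trans hx.1.le,
      hx.2.trans ((div_le_one hW).2 hmW)⟩
  rw [hsub]
  have hle : l / W ≤ m / W := by gcongr; linarith [hw k]
  simp only [integral_const, smul_eq_mul, mul_one, measureReal_restrict_apply_univ,
    Real.volume_real_Ioc_of_le hle]
  rw [hlm]; field_simp; ring

/-- One sample of the quantization of `g`. -/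
noncomputable def ppsSample (g : Vec n) (y : unitInterval × unitInterval) : Vec n :=
  l1Norm (posVec g) • catVec (posVec g) y.1 - l1Norm (posVec (-g)) • catVec (posVec (-g)) y.2

lemma pps_eq (M : ℕ) (g : Vec n) (a b : ℕ → unitInterval) :
    pps M g a b = (1 / (M : ℝ)) • ∑ s ∈ Finset.range M, ppsSample g (a s, b s) := by
  simp only [pps, ppsSample, Finset.sum_sub_distrib, smul_sub, ← Finset.smul_sum, smul_smul]
  congr 2 <;> ring

lemma measurable_ppsSample :
    Measurable fun p : Vec n × unitInterval × unitInterval => ppsSample p.1 p.2 := by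
  have h1 : Measurable fun p : Vec n × unitInterval × unitInterval => posVec p.1 :=
    measurable_posVec.comp measurable_fst
  have h2 : Measurable fun p : Vec n × unitInterval × unitInterval => posVec (-p.1) :=
    measurable_posVec.comp measurable_fst.neg
  have h3 : Measurable fun p : Vec n × unitInterval × unitInterval => (p.2.1 : ℝ) := by fun_prop
  have h4 : Measurable fun p : Vec n × unitInterval × unitInterval => (p.2.2 : ℝ) := by fun_prop
  exact ((measurable_l1Norm.comp h1).smul (measurable_catVec.comp (h1.prodMk h3))).sub
    ((measurable_l1Norm.comp h2).smul (measurable_catVec.comp (h2.prodMk h4)))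

/-- A crude bound, sufficient because dimension factors disappear in the problem constants. -/
lemma norm_catVec_le (w : Vec n) (u : ℝ) : ‖catVec w u‖ ≤ n := by
  refine (EuclideanSpace.norm_eq _).trans_le (Real.sqrt_le_iff.2 ⟨Nat.cast_nonneg n, ?_⟩)
  have : ∀ k ∈ Finset.univ, ‖catVec w u k‖ ^ 2 ≤ 1 := by
    intro k _
    rw [catVec_apply]; split_ifs <;> simp
  refine (Finset.sum_le_sum this).trans ?_
  simp only [Finset.sum_const, Finset.card_univ, Fintype.card_fin, nsmul_eq_mul, mul_one]
  exact_mod_cast Nat.le_self_pow two_ne_zero n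

lemma l1Norm_posVec_le (g : Vec n) : l1Norm (posVec g) ≤ l1Norm g := by
  refine Finset.sum_le_sum fun k _ => ?_
  rw [posVec_apply, abs_of_nonneg (le_max_left _ _)]
  exact max_le (abs_nonneg _) (le_abs_self _)

lemma l1Norm_nonneg (g : Vec n) : 0 ≤ l1Norm g := Finset.sum_nonneg fun _ _ => abs_nonneg _

lemma norm_ppsSample_le (g : Vec n) (y : unitInterval × unitInterval) :
    ‖ppsSample g y‖ ≤ 2 * n * l1Norm g := by
  have h : ∀ g : Vec n, ∀ u : ℝ, ‖l1Norm (posVec g) • catVec (posVec g) u‖ ≤ l1Norm g * n := by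
    intro g u
    rw [norm_smul, Real.norm_of_nonneg (l1Norm_nonneg _)]
    exact mul_le_mul (l1Norm_posVec_le g) (norm_catVec_le _ _) (norm_nonneg _) (l1Norm_nonneg _)
  have hneg : l1Norm (-g) = l1Norm g := by simp [l1Norm]
  refine (norm_sub_le _ _).trans ?_
  have h1 := h g y.1
  have h2 := h (-g) y.2
  rw [hneg] at h2
  linarith

lemma integrable_ppsSample (g : Vec n) :
    Integrable (ppsSample g) ((volume : Measure unitInterval).prod volume) :=
  Integrable.of_bound (C := 2 * n * l1Norm g)
    (measurable_ppsSample.comp (measurable_const.prodMk measurable_id)).aestronglyMeasurable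
    (Filter.Eventually.of_forall (norm_ppsSample_le g))

lemma integral_ppsSample (g : Vec n) :
    ∫ y, ppsSample g y ∂((volume : Measure unitInterval).prod volume) = g := by
  ext k
  have h0 : (∫ y, ppsSample g y ∂((volume : Measure unitInterval).prod volume)) k =
      ∫ y, ppsSample g y k ∂((volume : Measure unitInterval).prod volume) :=
    ((EuclideanSpace.proj (𝕜 := ℝ) k).integral_comp_comm (integrable_ppsSample g)).symm
  have hbd : ∀ w : Vec n, Integrable (fun u : unitInterval => (∑ j, posVec w j) * catVec (posVec w) u k) := by
    intro w
    refine Integrable.const_mul (Integrable.of_bound (C := 1) ?_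
      (Filter.Eventually.of_forall fun u => ?_)) _
    · have h1 : Measurable fun u : unitInterval => (posVec w, (u : ℝ)) := by fun_prop
      have h2 : Measurable fun v : Vec n => v k := by fun_prop
      exact (h2.comp (measurable_catVec.comp h1)).aestronglyMeasurable
    · rw [catVec_apply]; split_ifs <;> simp
  rw [h0]
  have h1 : ∀ y : unitInterval × unitInterval, ppsSample g y k =
      (∑ j, posVec g j) * catVec (posVec g) y.1 k
        - (∑ j, posVec (-g) j) * catVec (posVec (-g)) y.2 k := by
    intro y
    simp [ppsSample, l1Norm_posVec]
  simp only [h1]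
  rw [integral_sub ((hbd g).comp_fst _) ((hbd (-g)).comp_snd _)]
  have e1 := integral_fun_fst (μ := (volume : Measure unitInterval)) (ν := (volume : Measure unitInterval))
    (fun u : unitInterval => (∑ j, posVec g j) * catVec (posVec g) u k)
  have e2 := integral_fun_snd (μ := (volume : Measure unitInterval)) (ν := (volume : Measure unitInterval))
    (fun u : unitInterval => (∑ j, posVec (-g) j) * catVec (posVec (-g)) u k)
  rw [e1, e2, integral_catVec _ (fun k => le_max_left _ _), integral_catVec _ (fun k => le_max_left _ _)]
  simp only [posVec_apply, PiLp.neg_apply, probReal_univ, one_smul]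
  rcases le_total 0 (g k) with h | h
  · rw [max_eq_right h, max_eq_left (by linarith)]; ring
  · rw [max_eq_left h, max_eq_right (by linarith)]; ring

end Quantization

/-! ### The noise of the messages -/

section Noise

set_option linter.unusedSectionVars false

variable {V : Type u} [Fintype V] {Ξ : Type v} [MeasurableSpace Ξ] {n : ℕ}

/-- `g i` is a bounded unbiased oracle for `xb i`. -/
structure IsBoundedOracle (P : V → Measure Ξ) (g : V → Vec n → Ξ → Vec n) (xb : V → Vec n → Vec n)
    (B : ℝ) : Prop where
  measurable : ∀ i, Measurable fun p : Vec n × Ξ => g i p.1 p.2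
  l1Norm_le : ∀ i μ ξ, l1Norm (g i μ ξ) ≤ B
  integral_eq : ∀ i μ, ∫ ξ, g i μ ξ ∂P i = xb i μ
  measurable_mean : ∀ i, Measurable (xb i)
  norm_mean_le : ∀ i μ, ‖xb i μ‖ ≤ B

/-- `F` depends only on the seeds before iteration `t`. -/
def DependsBefore {β : Type*} (t : ℕ) (F : Seeds V Ξ → β) : Prop :=
  ∀ ω ω' : Seeds V Ξ, (∀ q, q.1 < t → ω q = ω' q) → F ω = F ω'

lemma DependsBefore.mono {β : Type*} {s t : ℕ} (hst : s ≤ t) {F : Seeds V Ξ → β}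
    (hF : DependsBefore s F) : DependsBefore t F :=
  fun ω ω' h => hF ω ω' fun q hq => h q (hq.trans_le hst)

lemma DependsBefore.update [DecidableEq V] {β : Type*} {t : ℕ} {F : Seeds V Ξ → β}
    (hF : DependsBefore t F) (ω : Seeds V Ξ) (i : V) (s : ℕ)
    (x : Ξ × unitInterval × unitInterval) : F (Function.update ω (t, i, s) x) = F ω :=
  hF _ _ fun q' hq' => Function.update_of_ne (by rintro rfl; exact lt_irrefl _ hq') _ _

lemma measurable_tab {Ω : Type*} [MeasurableSpace Ω] {F : Ω → Tab V n}
    (h : ∀ i, Measurable fun ω => F ω i) : Measurable F :=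
  (WithLp.measurable_toLp 2 _).comp (measurable_pi_iff.2 h)

lemma Measurable.tab_apply {Ω : Type*} [MeasurableSpace Ω] {F : Ω → Tab V n} (h : Measurable F)
    (i : V) : Measurable fun ω => F ω i :=
  (measurable_pi_apply i).comp ((WithLp.measurable_ofLp 2 _).comp h)

variable {P : V → Measure Ξ} {g : V → Vec n → Ξ → Vec n} {xb : V → Vec n → Vec n} {B : ℝ}

lemma IsBoundedOracle.measurable_nodeGrad (hg : IsBoundedOracle P g xb B) (r : ℕ → ℕ) (t : ℕ)
    {μ : Seeds V Ξ → Tab V n} (hμ : Measurable μ) :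
    Measurable fun ω : Seeds V Ξ => nodeGrad g r ω t (μ ω) := by
  refine measurable_tab fun i => ?_
  have h1 : ∀ s, Measurable fun ω : Seeds V Ξ => (μ ω i, (ω (t, i, s)).1) := fun s =>
    (hμ.tab_apply i).prodMk (measurable_fst.comp (measurable_pi_apply _))
  have h2 : Measurable fun ω : Seeds V Ξ =>
      ∑ s ∈ Finset.range (r t), g i (μ ω i) (ω (t, i, s)).1 :=
    Finset.measurable_fun_sum _ fun s _ => (hg.measurable i).comp (h1 s)
  exact h2.const_smul (1 / (r t : ℝ))

lemma nodeMsg_apply (g : V → Vec n → Ξ → Vec n) (r M : ℕ → ℕ) (ω : Seeds V Ξ) (t : ℕ)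
    (μ : Tab V n) (i : V) : nodeMsg g r M ω t μ i =
      (1 / (M t : ℝ)) • ∑ s ∈ Finset.range (M t), ppsSample (nodeGrad g r ω t μ i)
        (ω (t, i, s)).2 := pps_eq _ _ _ _

lemma nodeGrad_apply (g : V → Vec n → Ξ → Vec n) (r : ℕ → ℕ) (ω : Seeds V Ξ) (t : ℕ)
    (μ : Tab V n) (i : V) : nodeGrad g r ω t μ i =
      (1 / (r t : ℝ)) • ∑ s ∈ Finset.range (r t), g i (μ i) (ω (t, i, s)).1 := rfl

lemma measurable_ppsSample_comp {Ω : Type*} [MeasurableSpace Ω] {x : Ω → Vec n}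
    {y : Ω → unitInterval × unitInterval} (hx : Measurable x) (hy : Measurable y) :
    Measurable fun ω => ppsSample (x ω) (y ω) := by
  have h := measurable_ppsSample.comp (hx.prodMk hy)
  exact h

lemma IsBoundedOracle.measurable_nodeMsg (hg : IsBoundedOracle P g xb B) (r M : ℕ → ℕ) (t : ℕ)
    {μ : Seeds V Ξ → Tab V n} (hμ : Measurable μ) :
    Measurable fun ω : Seeds V Ξ => nodeMsg g r M ω t (μ ω) := by
  have h0 := hg.measurable_nodeGrad r t hμ
  refine measurable_tab fun i => ?_
  have h3 : ∀ s, Measurable fun ω : Seeds V Ξ =>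
      ppsSample (nodeGrad g r ω t (μ ω) i) (ω (t, i, s)).2 := fun s =>
    measurable_ppsSample_comp (h0.tab_apply i) (measurable_snd.comp (measurable_pi_apply (t, i, s)))
  have h2 : Measurable fun ω : Seeds V Ξ => (1 / (M t : ℝ)) • ∑ s ∈ Finset.range (M t),
      ppsSample (nodeGrad g r ω t (μ ω) i) (ω (t, i, s)).2 :=
    (Finset.measurable_fun_sum (Finset.range (M t)) fun s _ => h3 s).const_smul (1 / (M t : ℝ))
  simp only [nodeMsg_apply]
  exact h2

lemma IsBoundedOracle.measurable_tabArgmax (hg : IsBoundedOracle P g xb B)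
    {μ : Seeds V Ξ → Tab V n} (hμ : Measurable μ) :
    Measurable fun ω : Seeds V Ξ => tabArgmax xb (μ ω) :=
  measurable_tab fun i => (hg.measurable_mean i).comp (hμ.tab_apply i)

lemma IsBoundedOracle.l1Norm_nodeGrad_le (hg : IsBoundedOracle P g xb B) (hB : 0 ≤ B) (r : ℕ → ℕ)
    (ω : Seeds V Ξ) (t : ℕ) (μ : Tab V n) (i : V) : l1Norm (nodeGrad g r ω t μ i) ≤ B := by
  rcases Nat.eq_zero_or_pos (r t) with h0 | h0
  · rw [nodeGrad_apply, h0]; simpa [l1Norm] using hB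
  have h0' : (0 : ℝ) < r t := Nat.cast_pos.2 h0
  have h1 : l1Norm (nodeGrad g r ω t μ i) ≤
      ∑ k, (1 / (r t : ℝ)) * ∑ s ∈ Finset.range (r t), |g i (μ i) (ω (t, i, s)).1 k| := by
    refine Finset.sum_le_sum fun k _ => ?_
    rw [nodeGrad_apply, PiLp.smul_apply, smul_eq_mul, abs_mul, abs_of_pos (by positivity)]
    refine mul_le_mul_of_nonneg_left ?_ (by positivity)
    rw [WithLp.ofLp_sum, Finset.sum_apply]
    exact Finset.abs_sum_le_sum_abs _ _
  refine h1.trans ?_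
  rw [← Finset.mul_sum, Finset.sum_comm]
  have h2 : ∑ s ∈ Finset.range (r t), ∑ k, |g i (μ i) (ω (t, i, s)).1 k| ≤ r t * B := by
    refine (Finset.sum_le_sum fun s _ => hg.l1Norm_le i (μ i) (ω (t, i, s)).1).trans ?_
    simp
  rw [one_div, inv_mul_le_iff₀ h0']
  exact h2

/-- The scaled conditional exponents of the two noise components at iteration `t`. -/
noncomputable def noiseExp (g : V → Vec n → Ξ → Vec n) (xb : V → Vec n → Vec n) (r M : ℕ → ℕ)
    (c : ℝ) (t : ℕ) (μ h h' : Seeds V Ξ → Tab V n) (ω : Seeds V Ξ) : ℝ :=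
  (⟪h ω, nodeGrad g r ω t (μ ω) - tabArgmax xb (μ ω)⟫ - c ^ 2 / 2 * (‖h ω‖ ^ 2 / r t))
    + (⟪h' ω, nodeMsg g r M ω t (μ ω) - nodeGrad g r ω t (μ ω)⟫ - c ^ 2 / 2 * (‖h' ω‖ ^ 2 / M t))

/-- Variance reduction by averaging: each of N samples has weight 1/N, so the N Hoeffding
corrections of a node add up to order 1/N. -/
lemma sum_batch_exponent {h y : Tab V n} {N : ℕ} (hN : N ≠ 0) (c : ℝ) (w : V → ℕ → Vec n) :
    ∑ q ∈ (Finset.univ : Finset V) ×ˢ Finset.range N,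
        (1 / (N : ℝ) * ⟪h q.1, w q.1 q.2 - y q.1⟫ - (c / N * ‖h q.1‖) ^ 2 / 2) =
      ⟪h, WithLp.toLp 2 (fun i => (1 / (N : ℝ)) • ∑ s ∈ Finset.range N, w i s) - y⟫
        - c ^ 2 / 2 * (‖h‖ ^ 2 / N) := by
  have hN' : (N : ℝ) ≠ 0 := Nat.cast_ne_zero.2 hN
  rw [Finset.sum_product, PiLp.inner_apply, PiLp.norm_sq_eq_of_L2, Finset.sum_div, Finset.mul_sum,
    ← Finset.sum_sub_distrib]
  refine Finset.sum_congr rfl fun i _ => ?_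
  dsimp only
  rw [Finset.sum_sub_distrib, ← Finset.mul_sum, Finset.sum_const, Finset.card_range, nsmul_eq_mul]
  simp only [PiLp.sub_apply, inner_sub_right, Finset.sum_sub_distrib, inner_smul_right, inner_sum,
    Finset.sum_const, Finset.card_range, nsmul_eq_mul]
  field_simp

lemma integral_inner_sub_eq_zero {Ω : Type*} [MeasurableSpace Ω] {ν : Measure Ω}
    [IsProbabilityMeasure ν] {y : Ω → Vec n} (hy : Integrable y ν) {m : Vec n}
    (hm : ∫ ω, y ω ∂ν = m) (a : Vec n) : ∫ ω, ⟪a, y ω - m⟫ ∂ν = 0 := by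
  have h1 : Integrable (fun ω => y ω - m) ν := hy.sub (integrable_const m)
  rw [integral_inner h1, integral_sub hy (integrable_const m), hm]
  simp

lemma measurable_exp_inner {Ω : Type*} [MeasurableSpace Ω] {x y : Ω → Vec n} (hx : Measurable x)
    (hy : Measurable y) (a b : ℝ) : Measurable fun ω =>
      ENNReal.ofReal (Real.exp (a * ⟪x ω, y ω⟫ - (b * ‖x ω‖) ^ 2 / 2)) := by
  have h1 : Measurable fun ω => ⟪x ω, y ω⟫ := hx.inner hy
  have h2 : Measurable fun ω => ‖x ω‖ := hx.norm
  fun_prop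

variable [DecidableEq V] [∀ i, IsProbabilityMeasure (P i)]

/-- With the oracle samples fixed, the quantization error is an average of M_t centred bounded
terms. Z may involve the oracle samples of iteration t, and only its independence of the
quantization seeds matters. -/
lemma IsBoundedOracle.lintegral_quant_le (hg : IsBoundedOracle P g xb B) (hB : 0 ≤ B) {r M : ℕ → ℕ}
    {t : ℕ} (hM : M t ≠ 0) {c : ℝ} (hc : (2 * n + 1) * B ≤ c)
    {μ h' : Seeds V Ξ → Tab V n} (hμ : Measurable μ) (hh' : Measurable h')
    (hμd : DependsBefore t μ) (hh'd : DependsBefore t h') {Z : Seeds V Ξ → ENNReal}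
    (hZ : Measurable Z)
    (hZd : ∀ (ω : Seeds V Ξ) (i : V) (s : ℕ) (y : unitInterval × unitInterval),
      Z (Function.update ω (t, i, s) ((ω (t, i, s)).1, y)) = Z ω) :
    ∫⁻ ω, Z ω * ENNReal.ofReal (Real.exp
      (⟪h' ω, nodeMsg g r M ω t (μ ω) - nodeGrad g r ω t (μ ω)⟫ - c ^ 2 / 2 * (‖h' ω‖ ^ 2 / M t)))
      ∂seedMeasure P ≤ ∫⁻ ω, Z ω ∂seedMeasure P := by
  have hgradinv : ∀ (ω : Seeds V Ξ) (q : V × ℕ) (y : unitInterval × unitInterval),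
      nodeGrad g r (Function.update ω (t, q.1, q.2) ((ω (t, q.1, q.2)).1, y)) t
        (μ (Function.update ω (t, q.1, q.2) ((ω (t, q.1, q.2)).1, y))) =
      nodeGrad g r ω t (μ ω) := by
    intro ω q y
    rw [hμd.update ω]
    refine PiLp.ext fun i => ?_
    rw [nodeGrad_apply, nodeGrad_apply]
    congr 1
    refine Finset.sum_congr rfl fun s _ => ?_
    congr 1
    rcases eq_or_ne (t, i, s) (t, q.1, q.2) with he | he
    · rw [he, Function.update_self]
    · rw [Function.update_of_ne he]
  let Y : V × ℕ → Seeds V Ξ → ENNReal := fun q ω => ENNReal.ofReal (Real.exp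
    (1 / (M t : ℝ) * ⟪h' ω q.1, ppsSample (nodeGrad g r ω t (μ ω) q.1) (ω (t, q.1, q.2)).2
      - nodeGrad g r ω t (μ ω) q.1⟫ - (c / M t * ‖h' ω q.1‖) ^ 2 / 2))
  have hmain := lintegral_mul_prod_le (μ := seedMeasure P)
    (fun _ : V × ℕ => (volume : Measure unitInterval).prod (volume : Measure unitInterval))
    (fun q ω y => Function.update ω (t, q.1, q.2) ((ω (t, q.1, q.2)).1, y))
    (fun q F hF => lintegral_infinitePi_update_snd (fun q : ℕ × V × ℕ => P q.2.1)
      (fun _ => (volume : Measure unitInterval).prod (volume : Measure unitInterval))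
      (t, q.1, q.2) hF) Y ?_ ?_ ?_ ?_ hZ (fun q ω y => hZd ω q.1 q.2 y)
      ((Finset.univ : Finset V) ×ˢ Finset.range (M t))
  · refine le_trans (le_of_eq ?_) hmain
    refine lintegral_congr fun ω => ?_
    simp only [Y]
    rw [← ENNReal.ofReal_prod_of_nonneg fun _ _ => (Real.exp_pos _).le, ← Real.exp_sum,
      sum_batch_exponent (h := h' ω) (y := nodeGrad g r ω t (μ ω)) hM c
        (fun i s => ppsSample (nodeGrad g r ω t (μ ω) i) (ω (t, i, s)).2)]
    congr 6
    exact PiLp.ext fun i => nodeMsg_apply _ _ _ _ _ _ _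
  · intro q
    have h1 : Measurable fun ω : Seeds V Ξ => nodeGrad g r ω t (μ ω) q.1 :=
      (hg.measurable_nodeGrad r t hμ).tab_apply q.1
    have h2 : Measurable fun ω : Seeds V Ξ => (ω (t, q.1, q.2)).2 :=
      measurable_snd.comp (measurable_pi_apply _)
    exact measurable_exp_inner (hh'.tab_apply q.1)
      ((measurable_ppsSample_comp h1 h2).sub h1) _ _
  · intro q ω
    simp only [Y, hgradinv, hh'd.update ω, Function.update_self]
    exact measurable_exp_inner measurable_const
      ((measurable_ppsSample.comp (measurable_const.prodMk measurable_id)).sub measurable_const) _ _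
  · intro q q' hqq ω y
    simp only [Y, hgradinv, hh'd.update ω]
    rw [Function.update_of_ne]
    intro he
    simp only [Prod.mk.injEq, true_and] at he
    exact hqq (Prod.ext he.1 he.2)
  · intro q ω
    simp only [Y, hgradinv, hh'd.update ω, Function.update_self]
    set G := nodeGrad g r ω t (μ ω) q.1
    have hG : l1Norm G ≤ B := hg.l1Norm_nodeGrad_le hB r ω t (μ ω) q.1
    refine lintegral_exp_sub_le_one (Z := fun y => 1 / (M t : ℝ) * ⟪h' ω q.1, ppsSample G y - G⟫)
      ?_ (fun y => ?_) ?_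
    · exact ((measurable_const.inner ((measurable_ppsSample.comp
        (measurable_const.prodMk measurable_id)).sub measurable_const))).const_mul _
    · rw [abs_mul, abs_of_nonneg (by positivity)]
      have h1 := abs_real_inner_le_norm (h' ω q.1) (ppsSample G y - G)
      have h2 : ‖ppsSample G y - G‖ ≤ c := by
        refine (norm_sub_le _ _).trans (le_trans ?_ hc)
        have h3 := norm_ppsSample_le G y
        have h4 := norm_le_l1Norm G
        have h5 : 2 * n * l1Norm G ≤ 2 * n * B := by gcongr
        linarith
      have h3 : ‖h' ω q.1‖ * ‖ppsSample G y - G‖ ≤ ‖h' ω q.1‖ * c := by gcongr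
      have h4 := mul_le_mul_of_nonneg_left (h1.trans h3) (show (0 : ℝ) ≤ 1 / M t by positivity)
      refine h4.trans (le_of_eq ?_)
      ring
    · rw [integral_const_mul, integral_inner_sub_eq_zero (integrable_ppsSample G)
        (integral_ppsSample G), mul_zero]

lemma IsBoundedOracle.lintegral_batch_le (hg : IsBoundedOracle P g xb B) {r : ℕ → ℕ}
    {t : ℕ} (hr : r t ≠ 0) {c : ℝ} (hc : 2 * B ≤ c)
    {μ h : Seeds V Ξ → Tab V n} (hμ : Measurable μ) (hh : Measurable h)
    (hμd : DependsBefore t μ) (hhd : DependsBefore t h) {Z : Seeds V Ξ → ENNReal}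
    (hZ : Measurable Z) (hZd : DependsBefore t Z) :
    ∫⁻ ω, Z ω * ENNReal.ofReal (Real.exp
      (⟪h ω, nodeGrad g r ω t (μ ω) - tabArgmax xb (μ ω)⟫ - c ^ 2 / 2 * (‖h ω‖ ^ 2 / r t)))
      ∂seedMeasure P ≤ ∫⁻ ω, Z ω ∂seedMeasure P := by
  let Y : V × ℕ → Seeds V Ξ → ENNReal := fun q ω => ENNReal.ofReal (Real.exp
    (1 / (r t : ℝ) * ⟪h ω q.1, g q.1 (μ ω q.1) (ω (t, q.1, q.2)).1 - tabArgmax xb (μ ω) q.1⟫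
      - (c / r t * ‖h ω q.1‖) ^ 2 / 2))
  have hmain := lintegral_mul_prod_le (μ := seedMeasure P)
    (fun q : V × ℕ => P q.1)
    (fun q ω x => Function.update ω (t, q.1, q.2) (x, (ω (t, q.1, q.2)).2))
    (fun q F hF => lintegral_infinitePi_update_fst (fun q : ℕ × V × ℕ => P q.2.1)
      (fun _ => (volume : Measure unitInterval).prod (volume : Measure unitInterval))
      (t, q.1, q.2) hF) Y ?_ ?_ ?_ ?_ hZ (fun q ω x => hZd.update ω _ _ _)
      ((Finset.univ : Finset V) ×ˢ Finset.range (r t))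
  · refine le_trans (le_of_eq ?_) hmain
    refine lintegral_congr fun ω => ?_
    simp only [Y]
    rw [← ENNReal.ofReal_prod_of_nonneg fun _ _ => (Real.exp_pos _).le, ← Real.exp_sum,
      sum_batch_exponent (h := h ω) (y := tabArgmax xb (μ ω)) hr c
        (fun i s => g i (μ ω i) (ω (t, i, s)).1)]
    rfl
  · intro q
    have h1 : Measurable fun ω : Seeds V Ξ => (μ ω q.1, (ω (t, q.1, q.2)).1) :=
      (hμ.tab_apply q.1).prodMk (measurable_fst.comp (measurable_pi_apply _))
    exact measurable_exp_inner (hh.tab_apply q.1)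
      (((hg.measurable q.1).comp h1).sub ((hg.measurable_tabArgmax hμ).tab_apply q.1)) _ _
  · intro q ω
    simp only [Y, hμd.update ω, hhd.update ω, Function.update_self]
    exact measurable_exp_inner measurable_const
      (((hg.measurable q.1).comp (measurable_const.prodMk measurable_id)).sub measurable_const) _ _
  · intro q q' hqq ω x
    simp only [Y, hμd.update ω, hhd.update ω]
    rw [Function.update_of_ne]
    intro he
    simp only [Prod.mk.injEq, true_and] at he
    exact hqq (Prod.ext he.1 he.2)
  · intro q ω
    simp only [Y, hμd.update ω, hhd.update ω, Function.update_self]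
    have hmeas : Measurable fun x : Ξ => g q.1 (μ ω q.1) x :=
      (hg.measurable q.1).comp (measurable_const.prodMk measurable_id)
    have hnorm : ∀ x, ‖g q.1 (μ ω q.1) x‖ ≤ B := fun x =>
      (norm_le_l1Norm _).trans (hg.l1Norm_le _ _ _)
    have hint : Integrable (fun x : Ξ => g q.1 (μ ω q.1) x) (P q.1) :=
      Integrable.of_bound (C := B) hmeas.aestronglyMeasurable (Filter.Eventually.of_forall hnorm)
    refine lintegral_exp_sub_le_one
      (Z := fun x => 1 / (r t : ℝ) * ⟪h ω q.1, g q.1 (μ ω q.1) x - tabArgmax xb (μ ω) q.1⟫)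
      ?_ (fun x => ?_) ?_
    · exact (measurable_const.inner (hmeas.sub measurable_const)).const_mul _
    · rw [abs_mul, abs_of_nonneg (by positivity)]
      have h1 := abs_real_inner_le_norm (h ω q.1) (g q.1 (μ ω q.1) x - tabArgmax xb (μ ω) q.1)
      have h2 : ‖g q.1 (μ ω q.1) x - tabArgmax xb (μ ω) q.1‖ ≤ c := by
        refine (norm_sub_le _ _).trans (le_trans ?_ hc)
        have h3 := hnorm x
        have h4 : ‖tabArgmax xb (μ ω) q.1‖ ≤ B := hg.norm_mean_le _ _
        linarith
      have h3 := mul_le_mul_of_nonneg_left h2 (norm_nonneg (h ω q.1))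
      have h4 := mul_le_mul_of_nonneg_left (h1.trans h3) (show (0 : ℝ) ≤ 1 / r t by positivity)
      refine h4.trans (le_of_eq ?_)
      ring
    · rw [integral_const_mul, integral_inner_sub_eq_zero hint
        (show _ = tabArgmax xb (μ ω) q.1 from hg.integral_eq _ _), mul_zero]

lemma IsBoundedOracle.measurable_noiseExp (hg : IsBoundedOracle P g xb B) {r M : ℕ → ℕ}
    {t : ℕ} {c : ℝ} {μ h h' : Seeds V Ξ → Tab V n} (hμ : Measurable μ) (hh : Measurable h)
    (hh' : Measurable h') : Measurable (noiseExp g xb r M c t μ h h') := by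
  have h1 := hg.measurable_nodeGrad r t hμ
  have h2 := hg.measurable_nodeMsg r M t hμ
  have h3 := hg.measurable_tabArgmax hμ
  have h4 : Measurable fun ω => ‖h ω‖ := hh.norm
  have h5 : Measurable fun ω => ‖h' ω‖ := hh'.norm
  exact ((hh.inner (h1.sub h3)).sub (((h4.pow_const 2).div_const _).const_mul _)).add
    ((hh'.inner (h2.sub h1)).sub (((h5.pow_const 2).div_const _).const_mul _))

lemma DependsBefore.nodeGrad {r : ℕ → ℕ} {t : ℕ} {μ : Seeds V Ξ → Tab V n}
    (hμ : DependsBefore t μ) : DependsBefore (t + 1) fun ω => nodeGrad g r ω t (μ ω) := by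
  intro ω ω' h
  simp only
  rw [hμ ω ω' fun q hq => h q (hq.trans t.lt_succ_self)]
  refine PiLp.ext fun i => ?_
  rw [nodeGrad_apply, nodeGrad_apply]
  congr 1
  exact Finset.sum_congr rfl fun s _ => by rw [h (t, i, s) t.lt_succ_self]

lemma DependsBefore.nodeMsg {r M : ℕ → ℕ} {t : ℕ} {μ : Seeds V Ξ → Tab V n}
    (hμ : DependsBefore t μ) : DependsBefore (t + 1) fun ω => nodeMsg g r M ω t (μ ω) := by
  intro ω ω' h
  refine PiLp.ext fun i => ?_
  have h1 := (DependsBefore.nodeGrad (g := g) (r := r) hμ) ω ω' h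
  simp only at h1
  rw [nodeMsg_apply, nodeMsg_apply, h1]
  congr 1
  exact Finset.sum_congr rfl fun s _ => by rw [h (t, i, s) t.lt_succ_self]

lemma DependsBefore.noiseExp {r M : ℕ → ℕ} {t : ℕ} {c : ℝ} {μ h h' : Seeds V Ξ → Tab V n}
    (hμ : DependsBefore t μ) (hh : DependsBefore t h) (hh' : DependsBefore t h') :
    DependsBefore (t + 1) (noiseExp g xb r M c t μ h h') := by
  intro ω ω' hω
  have hlt : ∀ q : ℕ × V × ℕ, q.1 < t → ω q = ω' q := fun q hq => hω q (hq.trans t.lt_succ_self)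
  have h1 := (DependsBefore.nodeGrad (g := g) (r := r) hμ) ω ω' hω
  have h2 := (DependsBefore.nodeMsg (g := g) (r := r) (M := M) hμ) ω ω' hω
  simp only at h1 h2
  rw [_root_.noiseExp, _root_.noiseExp, h1, h2, hμ ω ω' hlt, hh ω ω' hlt, hh' ω ω' hlt]

/-- The exponential supermartingale of the noise. -/
theorem IsBoundedOracle.lintegral_exp_noise_le_one (hg : IsBoundedOracle P g xb B) (hB : 0 ≤ B)
    {r M : ℕ → ℕ} (hr : ∀ t, r t ≠ 0) (hM : ∀ t, M t ≠ 0) {c : ℝ} (hc : (2 * n + 1) * B ≤ c)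
    (hc2 : 2 * B ≤ c) {μ h h' : ℕ → Seeds V Ξ → Tab V n} (hμ : ∀ t, Measurable (μ t))
    (hh : ∀ t, Measurable (h t)) (hh' : ∀ t, Measurable (h' t)) (hμd : ∀ t, DependsBefore t (μ t))
    (hhd : ∀ t, DependsBefore t (h t)) (hh'd : ∀ t, DependsBefore t (h' t)) (T : ℕ) :
    ∫⁻ ω, ENNReal.ofReal (Real.exp (∑ k ∈ Finset.range T,
      noiseExp g xb r M c k (μ k) (h k) (h' k) ω)) ∂seedMeasure P ≤ 1 := by
  induction T with
  | zero =>
    have : IsProbabilityMeasure (seedMeasure P) := by unfold seedMeasure; infer_instance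
    simp
  | succ t ih =>
    refine le_trans ?_ ih
    set Z : Seeds V Ξ → ENNReal := fun ω => ENNReal.ofReal (Real.exp (∑ k ∈ Finset.range t,
      noiseExp g xb r M c k (μ k) (h k) (h' k) ω)) with hZdef
    have hZ : Measurable Z := (Real.measurable_exp.comp (Finset.measurable_fun_sum _ fun k _ =>
      hg.measurable_noiseExp (hμ k) (hh k) (hh' k))).ennreal_ofReal
    have hZd : DependsBefore t Z := by
      intro ω ω' hω
      simp only [hZdef]
      congr 2
      refine Finset.sum_congr rfl fun k hk => ?_
      exact ((hμd k).noiseExp (hhd k) (hh'd k)).mono (Finset.mem_range.1 hk) ω ω' hω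
    set E : Seeds V Ξ → ENNReal := fun ω => ENNReal.ofReal (Real.exp
      (⟪h t ω, nodeGrad g r ω t (μ t ω) - tabArgmax xb (μ t ω)⟫
        - c ^ 2 / 2 * (‖h t ω‖ ^ 2 / r t))) with hEdef
    have hE : Measurable E := by
      have h1 := hg.measurable_nodeGrad r t (hμ t)
      have h3 := hg.measurable_tabArgmax (hμ t)
      have h4 : Measurable fun ω => ‖h t ω‖ := (hh t).norm
      exact (Real.measurable_exp.comp (((hh t).inner (h1.sub h3)).sub
        (((h4.pow_const 2).div_const _).const_mul _))).ennreal_ofReal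
    have h1 := hg.lintegral_batch_le (hr t) hc2 (hμ t) (hh t) (hμd t) (hhd t) hZ hZd
    refine le_trans ?_ h1
    -- The order matters: the message depends on the batch, so the quantization factor is integrated
    -- out first, with the batch factor E counted as part of Z.
    have h2 := hg.lintegral_quant_le hB (r := r) (hM t) hc (hμ t) (hh' t) (hμd t) (hh'd t)
      (hZ.mul hE) (fun ω i s y => by
        simp only [Pi.mul_apply, hEdef]
        rw [hZd.update ω, (hμd t).update ω, (hhd t).update ω]
        congr 6
        refine PiLp.ext fun j => ?_
        rw [nodeGrad_apply, nodeGrad_apply]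
        congr 1
        refine Finset.sum_congr rfl fun s' _ => ?_
        congr 1
        rcases eq_or_ne (t, j, s') (t, i, s) with he | he
        · rw [he, Function.update_self]
        · rw [Function.update_of_ne he])
    refine le_trans (le_of_eq ?_) h2
    refine lintegral_congr fun ω => ?_
    simp only [Pi.mul_apply, hZdef, hEdef]
    rw [← ENNReal.ofReal_mul (Real.exp_pos _).le, ← Real.exp_add,
      ← ENNReal.ofReal_mul (Real.exp_pos _).le, ← Real.exp_add, Finset.sum_range_succ, noiseExp,
      add_assoc]

/-- Markov's inequality for the exponential supermartingale. -/
theorem IsBoundedOracle.measure_noise_ge_le (hg : IsBoundedOracle P g xb B) (hB : 0 ≤ B)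
    {r M : ℕ → ℕ} (hr : ∀ t, r t ≠ 0) (hM : ∀ t, M t ≠ 0) {c : ℝ} (hc : (2 * n + 1) * B ≤ c)
    (hc2 : 2 * B ≤ c) {μ h h' : ℕ → Seeds V Ξ → Tab V n} (hμ : ∀ t, Measurable (μ t))
    (hh : ∀ t, Measurable (h t)) (hh' : ∀ t, Measurable (h' t)) (hμd : ∀ t, DependsBefore t (μ t))
    (hhd : ∀ t, DependsBefore t (h t)) (hh'd : ∀ t, DependsBefore t (h' t)) (T : ℕ) (Lam : ℝ) :
    MeasurableSet {ω : Seeds V Ξ | Lam ≤ ∑ k ∈ Finset.range T,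
      noiseExp g xb r M c k (μ k) (h k) (h' k) ω} ∧
    seedMeasure P {ω | Lam ≤ ∑ k ∈ Finset.range T,
      noiseExp g xb r M c k (μ k) (h k) (h' k) ω} ≤ ENNReal.ofReal (Real.exp (-Lam)) := by
  have hm : Measurable fun ω : Seeds V Ξ => ∑ k ∈ Finset.range T,
      noiseExp g xb r M c k (μ k) (h k) (h' k) ω :=
    Finset.measurable_fun_sum _ fun k _ => hg.measurable_noiseExp (hμ k) (hh k) (hh' k)
  refine ⟨measurableSet_le measurable_const hm, ?_⟩
  have h1 := hg.lintegral_exp_noise_le_one hB hr hM hc hc2 hμ hh hh' hμd hhd hh'd T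
  have h2 := meas_ge_le_lintegral_div (μ := seedMeasure P)
    (f := fun ω => ENNReal.ofReal (Real.exp (∑ k ∈ Finset.range T,
      noiseExp g xb r M c k (μ k) (h k) (h' k) ω)))
    (Real.measurable_exp.comp hm).ennreal_ofReal.aemeasurable
    (ε := ENNReal.ofReal (Real.exp Lam)) (ENNReal.ofReal_pos.2 (Real.exp_pos _)).ne'
    ENNReal.ofReal_ne_top
  have h3 : {ω : Seeds V Ξ | Lam ≤ ∑ k ∈ Finset.range T,
      noiseExp g xb r M c k (μ k) (h k) (h' k) ω} ⊆
      {ω | ENNReal.ofReal (Real.exp Lam) ≤ ENNReal.ofReal (Real.exp (∑ k ∈ Finset.range T,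
        noiseExp g xb r M c k (μ k) (h k) (h' k) ω))} :=
    fun ω hω => ENNReal.ofReal_le_ofReal (Real.exp_le_exp.2 hω)
  refine (measure_mono h3).trans (h2.trans ?_)
  refine (ENNReal.div_le_div_right h1 _).trans (le_of_eq ?_)
  rw [one_div, ← ENNReal.ofReal_inv_of_pos (Real.exp_pos _), Real.exp_neg]

end Noise

/-! ### The trajectory of the method -/

section Trajectory

set_option linter.unusedSectionVars false

variable {V : Type u} [Fintype V] {Ξ : Type v} {n : ℕ}
  (W A : Matrix V V ℝ) (g : V → Vec n → Ξ → Vec n) (α β : ℕ → ℝ) (r M : ℕ → ℕ)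

/-- The point `μ_t` at which the oracles are called. -/
noncomputable def queryPoint (ω : Seeds V Ξ) : ℕ → Tab V n
  | 0 => 0
  | t + 1 => (α (t + 1) / partialSum α (t + 1)) • (-(1 / β t) • (algorithm W g α β r M ω t).gsum)
      + (1 - α (t + 1) / partialSum α (t + 1)) • (algorithm W g α β r M ω t).lam

/-- The messages at iteration `t`. -/
noncomputable def msgAt (ω : Seeds V Ξ) (t : ℕ) : Tab V n :=
  nodeMsg g r M ω t (queryPoint W g α β r M ω t)

/-- The restored primal points at iteration `t`. -/
noncomputable def gradAt (ω : Seeds V Ξ) (t : ℕ) : Tab V n :=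
  nodeGrad g r ω t (queryPoint W g α β r M ω t)

/-- The dual averages before the transformation by `A`. -/
noncomputable def preZ (ω : Seeds V Ξ) (t : ℕ) : Tab V n :=
  -(1 / β t) • ∑ k ∈ Finset.range (t + 1), α k • kronAct A (msgAt W g α β r M ω k)

/-- The dual iterates before the transformation by `A`. -/
noncomputable def preLam (ω : Seeds V Ξ) : ℕ → Tab V n
  | 0 => -(α 0 / β 0) • kronAct A (msgAt W g α β r M ω 0)
  | t + 1 => (α (t + 1) / partialSum α (t + 1)) • (preZ W A g α β r M ω t
      - (α (t + 1) / β t) • kronAct A (msgAt W g α β r M ω (t + 1)))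
      + (1 - α (t + 1) / partialSum α (t + 1)) • preLam ω t

/-- The query points before the transformation by `A`. -/
noncomputable def preQuery (ω : Seeds V Ξ) : ℕ → Tab V n
  | 0 => 0
  | t + 1 => (α (t + 1) / partialSum α (t + 1)) • preZ W A g α β r M ω t
      + (1 - α (t + 1) / partialSum α (t + 1)) • preLam W A g α β r M ω t

variable {W A g α β r M}

lemma isAccelerated_pre (ω : Seeds V Ξ) :
    IsAccelerated α β (fun k => kronAct A (msgAt W g α β r M ω k)) (preLam W A g α β r M ω)
      (preZ W A g α β r M ω) (preQuery W A g α β r M ω) :=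
  ⟨rfl, rfl, fun _ => rfl, fun _ => rfl, fun _ => rfl⟩

lemma algorithm_gsum (ω : Seeds V Ξ) (t : ℕ) : (algorithm W g α β r M ω t).gsum =
    ∑ k ∈ Finset.range (t + 1), α k • kronAct W (msgAt W g α β r M ω k) := by
  induction t with
  | zero => simp only [zero_add, Finset.sum_range_one]; rfl
  | succ t ih => rw [Finset.sum_range_succ, ← ih]; rfl

lemma partialSum_smul_algorithm_x (hα : ∀ t, 0 < α t) (ω : Seeds V Ξ) (t : ℕ) :
    partialSum α t • (algorithm W g α β r M ω t).x =
      ∑ k ∈ Finset.range (t + 1), α k • gradAt W g α β r M ω k := by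
  have hpos : ∀ t, partialSum α t ≠ 0 := fun t =>
    (Finset.sum_pos (fun k _ => hα k) ⟨0, by simp⟩).ne'
  induction t with
  | zero => simp only [partialSum, zero_add, Finset.sum_range_one]; rfl
  | succ t ih =>
    have hx : (algorithm W g α β r M ω (t + 1)).x =
        (α (t + 1) / partialSum α (t + 1)) • gradAt W g α β r M ω (t + 1)
        + (partialSum α t / partialSum α (t + 1)) • (algorithm W g α β r M ω t).x := rfl
    rw [Finset.sum_range_succ, ← ih, hx, smul_add, smul_smul, smul_smul,
      mul_div_cancel₀ _ (hpos _), mul_div_cancel₀ _ (hpos _), add_comm]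

/-- With A² = W, this and the next two lemmas show that A maps the accelerated method for the dual
function onto the iterates of the algorithm, which itself only uses W. -/
lemma kronAct_preZ (hAW : ∀ x : Tab V n, kronAct A (kronAct A x) = kronAct W x) (ω : Seeds V Ξ)
    (t : ℕ) : kronAct A (preZ W A g α β r M ω t) =
      -(1 / β t) • (algorithm W g α β r M ω t).gsum := by
  rw [preZ, kronAct_smul, kronAct_sum, algorithm_gsum]
  simp only [kronAct_smul, hAW]

lemma kronAct_preLam (hAW : ∀ x : Tab V n, kronAct A (kronAct A x) = kronAct W x) (ω : Seeds V Ξ)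
    (t : ℕ) : kronAct A (preLam W A g α β r M ω t) = (algorithm W g α β r M ω t).lam := by
  induction t with
  | zero => rw [preLam, kronAct_smul, hAW]; rfl
  | succ t ih =>
    rw [preLam, kronAct_add, kronAct_smul, kronAct_smul, kronAct_sub, kronAct_smul, hAW,
      kronAct_preZ hAW, ih]
    rfl

lemma kronAct_preQuery (hAW : ∀ x : Tab V n, kronAct A (kronAct A x) = kronAct W x)
    (ω : Seeds V Ξ) (t : ℕ) :
    kronAct A (preQuery W A g α β r M ω t) = queryPoint W g α β r M ω t := by
  cases t with
  | zero => exact kronAct_zero A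
  | succ t =>
    rw [preQuery, kronAct_add, kronAct_smul, kronAct_smul, kronAct_preZ hAW, kronAct_preLam hAW]
    rfl

variable [DecidableEq V] [MeasurableSpace Ξ] {P : V → Measure Ξ} {xb : V → Vec n → Vec n} {B : ℝ}

lemma measurable_kronAct (A : Matrix V V ℝ) : Measurable (kronAct A : Tab V n → Tab V n) :=
  (kronCLM A).continuous.measurable

lemma algorithm_zero (ω : Seeds V Ξ) : algorithm W g α β r M ω 0 =
    { gsum := α 0 • kronAct W (msgAt W g α β r M ω 0)
      lam := -(α 0 / β 0) • kronAct W (msgAt W g α β r M ω 0)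
      x := gradAt W g α β r M ω 0 } := rfl

lemma algorithm_succ (ω : Seeds V Ξ) (t : ℕ) : algorithm W g α β r M ω (t + 1) =
    { gsum := (algorithm W g α β r M ω t).gsum
        + α (t + 1) • kronAct W (msgAt W g α β r M ω (t + 1))
      lam := (α (t + 1) / partialSum α (t + 1)) • (-(1 / β t) • (algorithm W g α β r M ω t).gsum
        - (α (t + 1) / β t) • kronAct W (msgAt W g α β r M ω (t + 1)))
        + (1 - α (t + 1) / partialSum α (t + 1)) • (algorithm W g α β r M ω t).lam
      x := (α (t + 1) / partialSum α (t + 1)) • gradAt W g α β r M ω (t + 1)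
        + (partialSum α t / partialSum α (t + 1)) • (algorithm W g α β r M ω t).x } := rfl

/-- Predictability: the query point of iteration t is fixed before the seeds of that iteration are
drawn. State and query point need a joint induction. -/
lemma dependsBefore_state (t : ℕ) :
    DependsBefore (t + 1) (fun ω : Seeds V Ξ => algorithm W g α β r M ω t) ∧
      DependsBefore t (fun ω : Seeds V Ξ => queryPoint W g α β r M ω t) := by
  have hstep : ∀ t, DependsBefore t (fun ω : Seeds V Ξ => queryPoint W g α β r M ω t) →
      ∀ ω ω' : Seeds V Ξ, (∀ q, q.1 < t + 1 → ω q = ω' q) →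
        msgAt W g α β r M ω t = msgAt W g α β r M ω' t ∧
        gradAt W g α β r M ω t = gradAt W g α β r M ω' t :=
    fun t hq ω ω' h => ⟨hq.nodeMsg ω ω' h, hq.nodeGrad ω ω' h⟩
  induction t with
  | zero =>
    have h0 : DependsBefore 0 (fun ω : Seeds V Ξ => queryPoint W g α β r M ω 0) := fun _ _ _ => rfl
    refine ⟨fun ω ω' h => ?_, h0⟩
    obtain ⟨h1, h2⟩ := hstep 0 h0 ω ω' h
    dsimp only
    rw [algorithm_zero, algorithm_zero, h1, h2]
  | succ t ih =>
    have hq : DependsBefore (t + 1) (fun ω : Seeds V Ξ => queryPoint W g α β r M ω (t + 1)) := by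
      intro ω ω' h
      have := ih.1 ω ω' h
      dsimp only at this
      dsimp only
      rw [queryPoint, queryPoint, this]
    refine ⟨fun ω ω' h => ?_, hq⟩
    obtain ⟨h1, h2⟩ := hstep (t + 1) hq ω ω' h
    have h3 := ih.1 ω ω' (fun q hq => h q (by omega))
    dsimp only at h3
    dsimp only
    rw [algorithm_succ, algorithm_succ, h1, h2, h3]

lemma dependsBefore_msgAt (t : ℕ) :
    DependsBefore (t + 1) (fun ω : Seeds V Ξ => msgAt W g α β r M ω t) :=
  (dependsBefore_state t).2.nodeMsg

lemma dependsBefore_shiftSeq_preZ (t : ℕ) :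
    DependsBefore t (fun ω : Seeds V Ξ => shiftSeq (preZ W A g α β r M ω) t) := by
  cases t with
  | zero =>
    simp only [shiftSeq]
    exact fun _ _ _ => rfl
  | succ t =>
    intro ω ω' h
    simp only [shiftSeq, preZ]
    have hk : ∀ k ∈ Finset.range (t + 1), α k • kronAct A (msgAt W g α β r M ω k) =
        α k • kronAct A (msgAt W g α β r M ω' k) := fun k hk => by
      have : msgAt W g α β r M ω k = msgAt W g α β r M ω' k := (dependsBefore_msgAt k).mono
        (Nat.succ_le_of_lt (Finset.mem_range.1 hk)) ω ω' h
      rw [this]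
    rw [Finset.sum_congr rfl hk]

lemma IsBoundedOracle.measurable_state (hg : IsBoundedOracle P g xb B) (t : ℕ) :
    Measurable (fun ω : Seeds V Ξ => queryPoint W g α β r M ω t) ∧
      Measurable (fun ω : Seeds V Ξ => (algorithm W g α β r M ω t).gsum) ∧
      Measurable (fun ω : Seeds V Ξ => (algorithm W g α β r M ω t).lam) := by
  have hstep : ∀ t, Measurable (fun ω : Seeds V Ξ => queryPoint W g α β r M ω t) →
      Measurable (fun ω : Seeds V Ξ => kronAct W (msgAt W g α β r M ω t)) :=
    fun t hq => (measurable_kronAct W).comp (hg.measurable_nodeMsg r M t hq)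
  induction t with
  | zero =>
    have h0 : Measurable (fun ω : Seeds V Ξ => queryPoint W g α β r M ω 0) := measurable_const
    have h2 := hstep 0 h0
    refine ⟨h0, ?_, ?_⟩
    · simp only [algorithm_zero]
      exact h2.const_smul (α 0)
    · simp only [algorithm_zero]
      exact h2.const_smul (-(α 0 / β 0))
  | succ t ih =>
    obtain ⟨-, hs, hl⟩ := ih
    have hz : Measurable fun ω : Seeds V Ξ => -(1 / β t) • (algorithm W g α β r M ω t).gsum :=
      hs.const_smul (-(1 / β t))
    have hl' := hl.const_smul (1 - α (t + 1) / partialSum α (t + 1))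
    have hq : Measurable (fun ω : Seeds V Ξ => queryPoint W g α β r M ω (t + 1)) :=
      (hz.const_smul (α (t + 1) / partialSum α (t + 1))).add hl'
    have h2 := hstep (t + 1) hq
    refine ⟨hq, ?_, ?_⟩
    · simp only [algorithm_succ]
      exact hs.add (h2.const_smul (α (t + 1)))
    · simp only [algorithm_succ]
      exact ((hz.sub (h2.const_smul (α (t + 1) / β t))).const_smul
        (α (t + 1) / partialSum α (t + 1))).add hl'

lemma IsBoundedOracle.measurable_msgAt (hg : IsBoundedOracle P g xb B) (t : ℕ) :
    Measurable (fun ω : Seeds V Ξ => msgAt W g α β r M ω t) :=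
  hg.measurable_nodeMsg r M t (hg.measurable_state t).1

lemma IsBoundedOracle.measurable_shiftSeq_preZ (hg : IsBoundedOracle P g xb B) (t : ℕ) :
    Measurable (fun ω : Seeds V Ξ => shiftSeq (preZ W A g α β r M ω) t) := by
  cases t with
  | zero => exact measurable_const
  | succ t =>
    have h : ∀ k, Measurable fun ω : Seeds V Ξ => α k • kronAct A (msgAt W g α β r M ω k) :=
      fun k => ((measurable_kronAct A).comp (hg.measurable_msgAt k)).const_smul (α k)
    have h2 : Measurable fun ω : Seeds V Ξ =>
        ∑ k ∈ Finset.range (t + 1), α k • kronAct A (msgAt W g α β r M ω k) :=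
      Finset.measurable_fun_sum _ fun k _ => h k
    exact h2.const_smul (-(1 / β t))

end Trajectory

/-! ### The good event -/

section GoodEvent

set_option linter.unusedSectionVars false

/-- Reduces vector concentration to finitely many scalar tests along plus and minus the basis
vectors, at the price of a dimension factor. -/
lemma norm_sq_le_of_inner_le {E ι : Type*} [NormedAddCommGroup E] [InnerProductSpace ℝ E]
    [Fintype ι] (b : OrthonormalBasis ι ℝ E) {v : E} {x : ℝ}
    (h : ∀ i, ∀ s : Bool, (if s then (1 : ℝ) else -1) * ⟪b i, v⟫ ≤ x) :
    ‖v‖ ^ 2 ≤ Fintype.card ι * x ^ 2 := by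
  rw [← b.sum_sq_norm_inner_right v]
  have : ∀ i ∈ Finset.univ, ‖⟪b i, v⟫‖ ^ 2 ≤ x ^ 2 := by
    intro i _
    have h1 := h i true
    have h2 := h i false
    simp only [if_true, Bool.false_eq_true, if_false] at h1 h2
    rw [Real.norm_eq_abs, sq_abs]
    exact sq_le_sq' (by linarith) (by linarith)
  refine (Finset.sum_le_sum this).trans (le_of_eq ?_)
  rw [Finset.sum_const, Finset.card_univ, nsmul_eq_mul]

/-- The Chernoff step: divide the bounded exponent by the scale s, which stays free to balance Lam /
s against s times the variance. -/
lemma inner_sum_le_of_exponent_lt {E : Type*} [NormedAddCommGroup E] [InnerProductSpace ℝ E]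
    {b : E} (hb : ‖b‖ = 1) {N : ℕ} {w v : ℕ → ℝ} {y : ℕ → E} {Lam s : ℝ} (hs : 0 < s) (sg : Bool)
    (h : ∑ k ∈ Finset.range N, (⟪(s * w k * (if sg then (1 : ℝ) else -1)) • b, y k⟫
      - v k * ‖(s * w k * (if sg then (1 : ℝ) else -1)) • b‖ ^ 2) ≤ Lam) :
    (if sg then (1 : ℝ) else -1) * ⟪b, ∑ k ∈ Finset.range N, w k • y k⟫ ≤
      Lam / s + s * ∑ k ∈ Finset.range N, v k * w k ^ 2 := by
  set e : ℝ := if sg then (1 : ℝ) else -1 with he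
  have he2 : e ^ 2 = 1 := by rw [he]; split_ifs <;> norm_num
  have h1 : ∑ k ∈ Finset.range N, (⟪(s * w k * e) • b, y k⟫ - v k * ‖(s * w k * e) • b‖ ^ 2) =
      s * (e * ⟪b, ∑ k ∈ Finset.range N, w k • y k⟫) -
        s * (s * ∑ k ∈ Finset.range N, v k * w k ^ 2) := by
    rw [inner_sum, Finset.mul_sum, Finset.mul_sum, Finset.mul_sum, Finset.mul_sum,
      ← Finset.sum_sub_distrib]
    refine Finset.sum_congr rfl fun k _ => ?_
    rw [norm_smul, hb, mul_one, Real.norm_eq_abs, sq_abs, real_inner_smul_left,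
      real_inner_smul_right, mul_pow, he2]
    ring
  rw [h1] at h
  have h2 : s * (Lam / s) = Lam := by field_simp
  refine le_of_mul_le_mul_left ?_ hs
  linarith

variable {V : Type u} [Fintype V] [DecidableEq V] {Ξ : Type v} [MeasurableSpace Ξ] {n : ℕ}
  {P : V → Measure Ξ} [∀ i, IsProbabilityMeasure (P i)] {g : V → Vec n → Ξ → Vec n}
  {xb : V → Vec n → Vec n} {B : ℝ} {r M : ℕ → ℕ} {c : ℝ}

lemma DependsBefore.const {β : Type*} (t : ℕ) (x : β) :
    DependsBefore t (fun _ : Seeds V Ξ => x) := fun _ _ _ => rfl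

/-- A finite union bound over exponential supermartingales. -/
lemma IsBoundedOracle.exists_bad_set (hg : IsBoundedOracle P g xb B) (hB : 0 ≤ B)
    (hr : ∀ t, r t ≠ 0) (hM : ∀ t, M t ≠ 0) (hc : (2 * n + 1) * B ≤ c)
    (hc2 : 2 * B ≤ c) {μ : ℕ → Seeds V Ξ → Tab V n} (hμ : ∀ t, Measurable (μ t))
    (hμd : ∀ t, DependsBefore t (μ t)) {ι : Type*} [Fintype ι]
    (N : ι → ℕ) (h h' : ι → ℕ → Seeds V Ξ → Tab V n)
    (hh : ∀ i t, Measurable (h i t)) (hh' : ∀ i t, Measurable (h' i t))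
    (hhd : ∀ i t, DependsBefore t (h i t)) (hh'd : ∀ i t, DependsBefore t (h' i t)) (Lam : ℝ) :
    ∃ S : Set (Seeds V Ξ), MeasurableSet S ∧
      seedMeasure P S ≤ ENNReal.ofReal (Fintype.card ι * Real.exp (-Lam)) ∧
      ∀ ω ∉ S, ∀ i, ∑ k ∈ Finset.range (N i),
        noiseExp g xb r M c k (μ k) (h i k) (h' i k) ω ≤ Lam := by
  have key := fun i => hg.measure_noise_ge_le hB hr hM hc hc2 hμ (hh i) (hh' i) hμd (hhd i)
    (hh'd i) (N i) Lam
  refine ⟨⋃ i, {ω | Lam ≤ ∑ k ∈ Finset.range (N i),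
      noiseExp g xb r M c k (μ k) (h i k) (h' i k) ω}, MeasurableSet.iUnion fun i => (key i).1,
      ?_, fun ω hω i => ?_⟩
  · refine (measure_iUnion_fintype_le _ _).trans ?_
    refine (Finset.sum_le_sum fun i _ => (key i).2).trans (le_of_eq ?_)
    rw [Finset.sum_const, Finset.card_univ, nsmul_eq_mul, ENNReal.ofReal_mul (Nat.cast_nonneg _),
      ENNReal.ofReal_natCast]
  · exact (not_le.1 fun h => hω (Set.mem_iUnion.2 ⟨i, h⟩)).le

/-- Equal test vectors for both components test the total noise of a message; a zero second one, as
in the next lemma, isolates the batch noise. -/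
lemma noiseExp_self (t : ℕ) (μ h : Seeds V Ξ → Tab V n) (ω : Seeds V Ξ) :
    noiseExp g xb r M c t μ h h ω =
      ⟪h ω, nodeMsg g r M ω t (μ ω) - tabArgmax xb (μ ω)⟫
        - c ^ 2 / 2 * (1 / r t + 1 / M t) * ‖h ω‖ ^ 2 := by
  have e1 : nodeMsg g r M ω t (μ ω) - tabArgmax xb (μ ω) =
      (nodeGrad g r ω t (μ ω) - tabArgmax xb (μ ω)) +
        (nodeMsg g r M ω t (μ ω) - nodeGrad g r ω t (μ ω)) := by abel
  rw [noiseExp, e1, inner_add_right]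
  ring

lemma noiseExp_zero_right (t : ℕ) (μ h : Seeds V Ξ → Tab V n) (ω : Seeds V Ξ) :
    noiseExp g xb r M c t μ h (fun _ => 0) ω =
      ⟪h ω, nodeGrad g r ω t (μ ω) - tabArgmax xb (μ ω)⟫
        - c ^ 2 / 2 * (1 / r t) * ‖h ω‖ ^ 2 := by
  simp only [noiseExp, inner_zero_left, norm_zero]
  ring

variable {W A : Matrix V V ℝ} {α β : ℕ → ℝ}

set_option maxHeartbeats 1000000 in
/-- With high probability the noise of the messages is small. -/
theorem IsBoundedOracle.exists_good_event (hg : IsBoundedOracle P g xb B) (hB : 0 ≤ B)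
    (hr : ∀ t, r t ≠ 0) (hM : ∀ t, M t ≠ 0) (hc : (2 * n + 1) * B ≤ c) (hc2 : 2 * B ≤ c)
    (hA : A.IsSymm) (hAW : ∀ x : Tab V n, kronAct A (kronAct A x) = kronAct W x)
    {a₂ : ℝ} (ha₂ : 0 ≤ a₂) (hAn : ∀ x : Tab V n, ‖kronAct A x‖ ^ 2 ≤ a₂ * ‖x‖ ^ 2)
    (hα : ∀ t, 0 < α t) (hα1 : ∀ t, α t ≤ t + 1) {kv p Lam cc : ℝ} (hkv : 0 ≤ kv) (hp : 0 < p)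
    (hLam : 1 ≤ Lam) (hcc : 0 < cc)
    (hv : ∀ k, c ^ 2 / 2 * (1 / r k + 1 / M k) ≤ kv * (p ^ 2 / (k + 1))) (us : Tab V n) (T : ℕ) :
    ∃ S : Set (Seeds V Ξ), MeasurableSet S ∧
      seedMeasure P S ≤ ENNReal.ofReal
        (((T : ℝ) + 1) * (6 * Module.finrank ℝ (Tab V n) + 1) * Real.exp (-Lam)) ∧
      ∀ ω ∉ S,
        (∀ k ≤ T, ‖kronAct A (msgAt W g α β r M ω k)
          - dualGrad xb A (preQuery W A g α β r M ω k)‖ ^ 2 ≤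
          a₂ * (Module.finrank ℝ (Tab V n) * (kv + 1) ^ 2) * Lam * p ^ 2 / (k + 1)) ∧
        (∀ t ≤ T, ∑ k ∈ Finset.range (t + 1), α k * ⟪kronAct A (msgAt W g α β r M ω k)
          - dualGrad xb A (preQuery W A g α β r M ω k),
            us - shiftSeq (preZ W A g α β r M ω) k⟫ ≤
          cc / ((t + 1) * p) * (a₂ * kv * p ^ 2 * ∑ k ∈ Finset.range (t + 1),
            ((k : ℝ) + 1) * ‖us - shiftSeq (preZ W A g α β r M ω) k‖ ^ 2)
              + Lam * ((t + 1) * p) / cc) ∧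
        ‖∑ k ∈ Finset.range (T + 1), α k • (kronAct A (msgAt W g α β r M ω k)
          - dualGrad xb A (preQuery W A g α β r M ω k))‖ ≤
          Real.sqrt (a₂ * (Module.finrank ℝ (Tab V n) * (kv + 1) ^ 2)) * Lam * ((T + 1) * p) ∧
        ‖∑ k ∈ Finset.range (T + 1), α k • (gradAt W g α β r M ω k
          - tabArgmax xb (queryPoint W g α β r M ω k))‖ ≤
          Real.sqrt (Module.finrank ℝ (Tab V n) * (kv + 1) ^ 2) * Lam * ((T + 1) * p) := by
  set d := Module.finrank ℝ (Tab V n) with hd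
  let b := stdOrthonormalBasis ℝ (Tab V n)
  have hb1 : ∀ i, ‖b i‖ = 1 := fun i => b.orthonormal.1 i
  set μ : ℕ → Seeds V Ξ → Tab V n := fun k ω => queryPoint W g α β r M ω k with hμdef
  have hμ : ∀ t, Measurable (μ t) := fun t => (hg.measurable_state t).1
  have hμd : ∀ t, DependsBefore t (μ t) := fun t => (dependsBefore_state t).2
  set v : ℕ → ℝ := fun k => c ^ 2 / 2 * (1 / r k + 1 / M k) with hvdef
  have hv0 : ∀ k, 0 ≤ v k := fun k => by positivity
  have hLam0 : 0 < Lam := one_pos.trans_le hLam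
  have hT : 0 < ((T : ℝ) + 1) * p := by positivity
  let sgn : Bool → ℝ := fun s => if s then (1 : ℝ) else -1
  -- coefficients of the four families
  let s₁ : ℕ → ℝ := fun k => Real.sqrt Lam * Real.sqrt (k + 1) / p
  have hs₁ : ∀ k, 0 < s₁ k := fun k => by positivity
  let s₃ : ℝ := 1 / ((T + 1) * p)
  have hs₃ : 0 < s₃ := by positivity
  let s₂ : ℕ → ℝ := fun t => cc / ((t + 1) * p)
  have hs₂ : ∀ t, 0 < s₂ t := fun t => by positivity
  let w₁ : ℕ → ℕ → ℝ := fun k j => if j = k then 1 else 0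
  let h₁ : Fin (T + 1) × Fin d × Bool → ℕ → Seeds V Ξ → Tab V n :=
    fun q j _ => (s₁ q.1 * w₁ q.1 j * sgn q.2.2) • b q.2.1
  let h₂ : Fin (T + 1) → ℕ → Seeds V Ξ → Tab V n :=
    fun t k ω => (s₂ t * α k) • kronAct A (us - shiftSeq (preZ W A g α β r M ω) k)
  let h₃ : Fin d × Bool → ℕ → Seeds V Ξ → Tab V n :=
    fun q k _ => (s₃ * α k * sgn q.2) • b q.1
  have hm₂ : ∀ t k, Measurable (h₂ t k) := fun t k =>
    ((measurable_kronAct A).comp (measurable_const.sub (hg.measurable_shiftSeq_preZ k))).const_smul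
      (s₂ t * α k)
  have hd₂ : ∀ t k, DependsBefore k (h₂ t k) := by
    intro t k ω ω' hω
    have : shiftSeq (preZ W A g α β r M ω) k = shiftSeq (preZ W A g α β r M ω') k :=
      dependsBefore_shiftSeq_preZ k ω ω' hω
    simp only [h₂, this]
  obtain ⟨S₁, hS₁m, hS₁, hω₁⟩ := hg.exists_bad_set hB hr hM hc hc2 hμ hμd
    (fun _ : Fin (T + 1) × Fin d × Bool => T + 1) h₁ h₁ (fun _ _ => measurable_const)
    (fun _ _ => measurable_const) (fun _ _ => DependsBefore.const _ _)
    (fun _ _ => DependsBefore.const _ _) Lam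
  obtain ⟨S₂, hS₂m, hS₂, hω₂⟩ := hg.exists_bad_set hB hr hM hc hc2 hμ hμd
    (fun t : Fin (T + 1) => (t : ℕ) + 1) h₂ h₂ hm₂ hm₂ hd₂ hd₂ Lam
  obtain ⟨S₃, hS₃m, hS₃, hω₃⟩ := hg.exists_bad_set hB hr hM hc hc2 hμ hμd
    (fun _ : Fin d × Bool => T + 1) h₃ h₃ (fun _ _ => measurable_const)
    (fun _ _ => measurable_const) (fun _ _ => DependsBefore.const _ _)
    (fun _ _ => DependsBefore.const _ _) Lam
  -- The primal output averages the batches before quantization, so their noise needs a bound of its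
  -- own.
  obtain ⟨S₄, hS₄m, hS₄, hω₄⟩ := hg.exists_bad_set hB hr hM hc hc2 hμ hμd
    (fun _ : Fin d × Bool => T + 1) h₃ (fun _ _ _ => 0) (fun _ _ => measurable_const)
    (fun _ _ => measurable_const) (fun _ _ => DependsBefore.const _ _)
    (fun _ _ => DependsBefore.const _ _) Lam
  refine ⟨S₁ ∪ S₂ ∪ S₃ ∪ S₄, ((hS₁m.union hS₂m).union hS₃m).union hS₄m, ?_, fun ω hω => ?_⟩
  · have h1 : seedMeasure P (S₁ ∪ S₂ ∪ S₃ ∪ S₄) ≤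
        seedMeasure P S₁ + seedMeasure P S₂ + seedMeasure P S₃ + seedMeasure P S₄ :=
      (measure_union_le _ _).trans (add_le_add_left ((measure_union_le _ _).trans
        (add_le_add_left (measure_union_le _ _) _)) _)
    refine h1.trans ((add_le_add (add_le_add (add_le_add hS₁ hS₂) hS₃) hS₄).trans ?_)
    rw [← ENNReal.ofReal_add (by positivity) (by positivity),
      ← ENNReal.ofReal_add (by positivity) (by positivity),
      ← ENNReal.ofReal_add (by positivity) (by positivity)]
    refine ENNReal.ofReal_le_ofReal ?_
    -- The families have 2d(T + 1), T + 1, 2d and 2d members, together at most (T + 1)(6d + 1).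
    simp only [Fintype.card_prod, Fintype.card_fin, Fintype.card_bool]
    push_cast
    have : (0 : ℝ) ≤ T * d * Real.exp (-Lam) := by positivity
    nlinarith
  simp only [Set.mem_union, not_or] at hω
  obtain ⟨⟨⟨hn₁, hn₂⟩, hn₃⟩, hn₄⟩ := hω
  set y : ℕ → Tab V n := fun k => msgAt W g α β r M ω k
    - tabArgmax xb (queryPoint W g α β r M ω k) with hy
  set x : ℕ → Tab V n := fun k => gradAt W g α β r M ω k
    - tabArgmax xb (queryPoint W g α β r M ω k) with hx
  have he : ∀ k, kronAct A (msgAt W g α β r M ω k) - dualGrad xb A (preQuery W A g α β r M ω k) =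
      kronAct A (y k) := fun k => by
    rw [dualGrad, kronAct_preQuery hAW, ← kronAct_sub]
  simp only [he]
  have hvsum : ∀ k, v k * α k ^ 2 ≤ kv * p ^ 2 * (k + 1) := by
    intro k
    have h1 : α k ^ 2 ≤ ((k : ℝ) + 1) ^ 2 := pow_le_pow_left₀ (hα k).le (hα1 k) 2
    calc v k * α k ^ 2 ≤ (kv * (p ^ 2 / (k + 1))) * ((k : ℝ) + 1) ^ 2 :=
          mul_le_mul (hv k) h1 (by positivity) (by positivity)
      _ = kv * p ^ 2 * (k + 1) := by field_simp
  have hvtot : ∑ k ∈ Finset.range (T + 1), v k * α k ^ 2 ≤ kv * ((T + 1) * p) ^ 2 := by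
    have : ∀ k ∈ Finset.range (T + 1), v k * α k ^ 2 ≤ kv * p ^ 2 * (T + 1) := by
      intro k hk
      have hkT : (k : ℝ) ≤ T := by exact_mod_cast Nat.lt_succ_iff.1 (Finset.mem_range.1 hk)
      exact (hvsum k).trans (by gcongr)
    refine (Finset.sum_le_sum this).trans (le_of_eq ?_)
    rw [Finset.sum_const, Finset.card_range, nsmul_eq_mul]
    push_cast; ring
  have hlin : ∀ z : ℕ → Tab V n, (∀ i s, sgn s * ⟪b i, ∑ k ∈ Finset.range (T + 1), α k • z k⟫ ≤
      Lam / s₃ + s₃ * ∑ k ∈ Finset.range (T + 1), v k * α k ^ 2) →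
      ‖∑ k ∈ Finset.range (T + 1), α k • z k‖ ^ 2 ≤
        d * ((kv + 1) * Lam * ((T + 1) * p)) ^ 2 := by
    intro z hz
    have h1 : Lam / s₃ + s₃ * ∑ k ∈ Finset.range (T + 1), v k * α k ^ 2 ≤
        (kv + 1) * Lam * ((T + 1) * p) := by
      have h2 : s₃ * ∑ k ∈ Finset.range (T + 1), v k * α k ^ 2 ≤
          s₃ * (kv * ((T + 1) * p) ^ 2) := mul_le_mul_of_nonneg_left hvtot hs₃.le
      have h3 : s₃ * (kv * ((T + 1) * p) ^ 2) = kv * ((T + 1) * p) := by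
        simp only [s₃]; field_simp
      have h4 : Lam / s₃ = Lam * ((T + 1) * p) := by simp only [s₃]; field_simp
      have h5 : kv * ((T + 1) * p) * 1 ≤ kv * ((T + 1) * p) * Lam :=
        mul_le_mul_of_nonneg_left hLam (by positivity)
      rw [h4]
      linarith
    have h2 := norm_sq_le_of_inner_le b (fun i s => (hz i s).trans h1)
    rwa [Fintype.card_fin] at h2
  have hsq : ∀ {z X Y : ℝ}, 0 ≤ X → 0 ≤ Y → z ^ 2 ≤ X * Y ^ 2 → z ≤ Real.sqrt X * Y := by
    intro z X Y hX hY h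
    refine le_of_sq_le_sq ?_ (by positivity)
    rw [mul_pow, Real.sq_sqrt hX]; exact h
  have hev₃ : ‖∑ k ∈ Finset.range (T + 1), α k • y k‖ ^ 2 ≤
        d * ((kv + 1) * Lam * ((T + 1) * p)) ^ 2 := by
    refine hlin y fun i s => inner_sum_le_of_exponent_lt (hb1 i) hs₃ s ?_
    refine le_trans (le_of_eq ?_) (hω₃ ω hn₃ (i, s))
    refine Finset.sum_congr rfl fun k _ => ?_
    rw [noiseExp_self]
    rfl
  have hev₄ : ‖∑ k ∈ Finset.range (T + 1), α k • x k‖ ^ 2 ≤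
        d * ((kv + 1) * Lam * ((T + 1) * p)) ^ 2 := by
    refine hlin x fun i s => inner_sum_le_of_exponent_lt (hb1 i) hs₃ s ?_
    refine le_trans (Finset.sum_le_sum fun k _ => ?_) (hω₄ ω hn₄ (i, s))
    rw [noiseExp_zero_right]
    refine sub_le_sub le_rfl ?_
    refine mul_le_mul_of_nonneg_right (mul_le_mul_of_nonneg_left ?_ (by positivity)) (by positivity)
    have : (0 : ℝ) ≤ 1 / M k := by positivity
    linarith
  refine ⟨fun k hk => ?_, fun t ht => ?_, ?_, ?_⟩
  · have hk1 : 0 < (k : ℝ) + 1 := by positivity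
    have h0 : ∀ i s, sgn s * ⟪b i, y k⟫ ≤ (kv + 1) * (Real.sqrt Lam * p / Real.sqrt (k + 1)) := by
      intro i s
      have h1 := inner_sum_le_of_exponent_lt (hb1 i) (w := w₁ k) (v := v) (y := y) (N := T + 1)
        (hs₁ k) s (by
          refine le_trans (le_of_eq ?_) (hω₁ ω hn₁ (⟨k, by omega⟩, i, s))
          refine Finset.sum_congr rfl fun j _ => ?_
          rw [noiseExp_self]
          rfl)
      have hmem : k ∈ Finset.range (T + 1) := Finset.mem_range.2 (by omega)
      have h2 : ∑ j ∈ Finset.range (T + 1), w₁ k j • y j = y k := by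
        rw [Finset.sum_eq_single k]
        · simp [w₁]
        · intro j _ hj; simp [w₁, hj]
        · exact fun h => absurd hmem h
      have h3 : ∑ j ∈ Finset.range (T + 1), v j * w₁ k j ^ 2 = v k := by
        rw [Finset.sum_eq_single k]
        · simp [w₁]
        · intro j _ hj; simp [w₁, hj]
        · exact fun h => absurd hmem h
      rw [h2, h3] at h1
      refine h1.trans ?_
      have h4 : Lam / s₁ k = Real.sqrt Lam * p / Real.sqrt (k + 1) := by
        simp only [s₁]
        have : Real.sqrt Lam ≠ 0 := by positivity
        have h5 : Real.sqrt ((k : ℝ) + 1) ≠ 0 := by positivity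
        rw [div_div_eq_mul_div, div_eq_div_iff (by positivity) h5]
        have := Real.mul_self_sqrt hLam0.le
        linear_combination (-(p * Real.sqrt ((k : ℝ) + 1))) * this
      have h5 : s₁ k * v k ≤ s₁ k * (kv * (p ^ 2 / (k + 1))) :=
        mul_le_mul_of_nonneg_left (hv k) (hs₁ k).le
      have h6 : s₁ k * (kv * (p ^ 2 / (k + 1))) = kv * (Real.sqrt Lam * p / Real.sqrt (k + 1)) := by
        simp only [s₁]
        have h5 : Real.sqrt ((k : ℝ) + 1) ≠ 0 := by positivity
        have h7 := Real.mul_self_sqrt hk1.le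
        field_simp
        linear_combination kv * h7
      rw [h4]
      linarith
    have h1 := norm_sq_le_of_inner_le b h0
    rw [Fintype.card_fin] at h1
    have h2 : ((kv + 1) * (Real.sqrt Lam * p / Real.sqrt (k + 1))) ^ 2 =
        (kv + 1) ^ 2 * (Lam * p ^ 2 / (k + 1)) := by
      rw [mul_pow, div_pow, mul_pow, Real.sq_sqrt hLam0.le, Real.sq_sqrt hk1.le]
    rw [h2] at h1
    refine (hAn _).trans ((mul_le_mul_of_nonneg_left h1 ha₂).trans (le_of_eq ?_))
    ring
  · have h1 := hω₂ ω hn₂ ⟨t, by omega⟩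
    have ht0 : 0 < ((t : ℝ) + 1) * p := by positivity
    set u : ℕ → Tab V n := fun k => us - shiftSeq (preZ W A g α β r M ω) k with hu
    have h2 : ∑ k ∈ Finset.range (t + 1), (s₂ t * (α k * ⟪kronAct A (y k), u k⟫)
        - s₂ t ^ 2 * (a₂ * kv * p ^ 2 * ((k + 1) * ‖u k‖ ^ 2))) ≤ Lam := by
      refine le_trans (Finset.sum_le_sum fun k _ => ?_) h1
      rw [noiseExp_self]
      have e1 : ⟪h₂ ⟨t, by omega⟩ k ω, nodeMsg g r M ω k (μ k ω) - tabArgmax xb (μ k ω)⟫ =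
          s₂ t * (α k * ⟪kronAct A (y k), u k⟫) := by
        have : h₂ ⟨t, by omega⟩ k ω = (s₂ t * α k) • kronAct A (u k) := rfl
        rw [this, real_inner_smul_left, inner_kronAct_left hA, real_inner_comm, mul_assoc]
        rfl
      have e2 : ‖h₂ ⟨t, by omega⟩ k ω‖ ^ 2 ≤ s₂ t ^ 2 * α k ^ 2 * (a₂ * ‖u k‖ ^ 2) := by
        have : h₂ ⟨t, by omega⟩ k ω = (s₂ t * α k) • kronAct A (u k) := rfl
        rw [this, norm_smul, mul_pow, Real.norm_eq_abs, sq_abs, mul_pow]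
        exact mul_le_mul_of_nonneg_left (hAn _) (by positivity)
      have e3 : v k * ‖h₂ ⟨t, by omega⟩ k ω‖ ^ 2 ≤
          s₂ t ^ 2 * (a₂ * kv * p ^ 2 * ((k + 1) * ‖u k‖ ^ 2)) := by
        calc v k * ‖h₂ ⟨t, by omega⟩ k ω‖ ^ 2
            ≤ v k * (s₂ t ^ 2 * α k ^ 2 * (a₂ * ‖u k‖ ^ 2)) :=
              mul_le_mul_of_nonneg_left e2 (hv0 k)
          _ = (v k * α k ^ 2) * (s₂ t ^ 2 * (a₂ * ‖u k‖ ^ 2)) := by ring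
          _ ≤ (kv * p ^ 2 * (k + 1)) * (s₂ t ^ 2 * (a₂ * ‖u k‖ ^ 2)) :=
              mul_le_mul_of_nonneg_right (hvsum k) (by positivity)
          _ = _ := by ring
      rw [e1]
      exact sub_le_sub le_rfl e3
    rw [Finset.sum_sub_distrib, ← Finset.mul_sum, ← Finset.mul_sum, ← Finset.mul_sum] at h2
    have h3 : Lam * ((t + 1) * p) / cc = Lam / s₂ t := by simp only [s₂]; field_simp
    rw [h3]
    refine le_of_mul_le_mul_left ?_ (hs₂ t)
    have h4 : s₂ t * (Lam / s₂ t) = Lam := by have := (hs₂ t).ne'; field_simp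
    have h5 : cc / ((t + 1) * p) = s₂ t := rfl
    rw [mul_add, h4, h5]
    linarith
  · have h1 : ∑ k ∈ Finset.range (T + 1), α k • kronAct A (y k) =
        kronAct A (∑ k ∈ Finset.range (T + 1), α k • y k) := by
      rw [kronAct_sum]
      simp only [kronAct_smul]
    rw [h1, mul_assoc]
    refine hsq (by positivity) (by positivity) ((hAn _).trans
      ((mul_le_mul_of_nonneg_left hev₃ ha₂).trans (le_of_eq ?_)))
    ring
  · rw [mul_assoc]
    refine hsq (by positivity) (by positivity) (hev₄.trans (le_of_eq ?_))
    ring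

end GoodEvent

/-! ### The parameters of the method -/

section Parameters

lemma alphaSeq_pos (t : ℕ) : 0 < alphaSeq t := by unfold alphaSeq; positivity

lemma alphaSeq_le (t : ℕ) : alphaSeq t ≤ t + 1 := by
  have h : (1 : ℝ) ≤ Real.sqrt 2 := Real.one_le_sqrt.2 (by norm_num)
  exact div_le_self (by positivity) (by linarith)

lemma partialSum_alphaSeq (t : ℕ) :
    partialSum alphaSeq t = (t + 1) * (t + 2) / (4 * Real.sqrt 2) := by
  have h2 : Real.sqrt 2 ≠ 0 := by positivity
  induction t with
  | zero =>
    simp only [partialSum, alphaSeq, zero_add, Finset.sum_range_one, Nat.cast_zero]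
    field_simp; norm_num
  | succ t ih =>
    rw [partialSum_succ, ih, alphaSeq]
    push_cast
    field_simp
    ring

lemma alphaSeq_sq_le (t : ℕ) : alphaSeq t ^ 2 ≤ partialSum alphaSeq t := by
  have h2 : Real.sqrt 2 ^ 2 = 2 := Real.sq_sqrt (by norm_num)
  have h3 : Real.sqrt 2 ≤ 2 := by
    rw [Real.sqrt_le_left (by norm_num)]; norm_num
  rw [partialSum_alphaSeq, alphaSeq, div_pow, mul_pow, h2, div_le_div_iff₀ (by norm_num)
    (by positivity)]
  have ht : (0 : ℝ) ≤ t := Nat.cast_nonneg t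
  calc ((t : ℝ) + 1) ^ 2 * (4 * Real.sqrt 2) ≤ ((t : ℝ) + 1) ^ 2 * (4 * 2) := by gcongr
    _ ≤ ((t : ℝ) + 1) * (t + 2) * (2 ^ 2 * 2) := by nlinarith

lemma sq_le_partialSum_alphaSeq (t : ℕ) : ((t : ℝ) + 1) ^ 2 / 8 ≤ partialSum alphaSeq t := by
  have h3 : Real.sqrt 2 ≤ 2 := by
    rw [Real.sqrt_le_left (by norm_num)]; norm_num
  rw [partialSum_alphaSeq, div_le_div_iff₀ (by norm_num) (by positivity)]
  have ht : (0 : ℝ) ≤ t := Nat.cast_nonneg t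
  calc ((t : ℝ) + 1) ^ 2 * (4 * Real.sqrt 2) ≤ ((t : ℝ) + 1) ^ 2 * (4 * 2) := by gcongr
    _ ≤ ((t : ℝ) + 1) * (t + 2) * 8 := by nlinarith

lemma natCeil_le_add_one {x : ℝ} (hx : 0 ≤ x) : (⌈x⌉₊ : ℝ) ≤ x + 1 :=
  (Nat.ceil_lt_add_one hx).le

/-- A positive sequence that grows almost linearly grows slower than `(t + 2)³`. -/
lemma cube_div_monotone {a : ℕ → ℝ} {Q : ℝ} (hQ : 0 < Q) (h1 : ∀ t : ℕ, Q * (t + 1) ≤ a t)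
    (h2 : ∀ t : ℕ, a t ≤ Q * (t + 1) + Q) : Monotone fun t : ℕ => ((t : ℝ) + 2) ^ 3 / a t := by
  refine monotone_nat_of_le_succ fun t => ?_
  have ha : ∀ t, 0 < a t := fun t => lt_of_lt_of_le (by positivity) (h1 t)
  rw [div_le_div_iff₀ (ha _) (ha _)]
  have ht : (0 : ℝ) ≤ t := Nat.cast_nonneg t
  have h3 := h2 (t + 1)
  push_cast at h3 ⊢
  calc ((t : ℝ) + 2) ^ 3 * a (t + 1) ≤ ((t : ℝ) + 2) ^ 3 * (Q * (t + 1 + 1) + Q) := by gcongr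
    _ ≤ ((t : ℝ) + 1 + 2) ^ 3 * (Q * (t + 1)) := by
      have : 0 ≤ Q * (t ^ 3 + 6 * t ^ 2 + 10 * t + 3 : ℝ) := by positivity
      nlinarith
    _ ≤ _ := by gcongr; exact h1 t

/-- The ratio of the sample numbers and the batch sizes. -/
noncomputable def sampleRate (n : ℕ) (B var : ℝ) : ℝ := 2 * (1 - 1 / (n : ℝ)) * B ^ 2 / (Real.exp 1 * var)

lemma sampleRate_pos {n : ℕ} (hn : 2 ≤ n) {B var : ℝ} (hB : 0 < B) (hvar : 0 < var) :
    0 < sampleRate n B var := by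
  have hn' : (2 : ℝ) ≤ n := by exact_mod_cast hn
  have : 1 / (n : ℝ) < 1 := by rw [div_lt_one (by linarith)]; linarith
  have : 0 < 1 - 1 / (n : ℝ) := by linarith
  unfold sampleRate
  positivity

variable {n : ℕ} {B var L R q : ℝ} {r : ℕ → ℕ}

lemma mul_le_batch (hr : ∀ t, r t = ⌈max 1 (q * (t + 1))⌉₊) (t : ℕ) : q * (t + 1) ≤ r t := by
  rw [hr]
  exact (le_max_right _ _).trans (Nat.le_ceil _)

lemma batch_le (hq : 1 ≤ q) (hr : ∀ t, r t = ⌈max 1 (q * (t + 1))⌉₊) (t : ℕ) :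
    (r t : ℝ) ≤ q * (t + 1) + 1 := by
  have h : 1 ≤ q * ((t : ℝ) + 1) := by
    have : (0 : ℝ) ≤ t := Nat.cast_nonneg t
    nlinarith
  rw [hr, max_eq_right h]
  exact natCeil_le_add_one (by linarith)

lemma mul_le_sampleSeq (t : ℕ) : sampleRate n B var * r t ≤ sampleSeq n B var r t :=
  Nat.le_ceil _

lemma sampleSeq_le (h : 0 ≤ sampleRate n B var) (t : ℕ) :
    (sampleSeq n B var r t : ℝ) ≤ sampleRate n B var * r t + 1 :=
  natCeil_le_add_one (by positivity)

lemma quantSigma_mul_rpow (hn : 2 ≤ n) (hvar : 0 < var) (t : ℕ) (a b : ℕ) :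
    quantSigma n B var a b * ((t : ℝ) + 2) ^ (3 / 2 : ℝ) =
      Real.sqrt (50 * (sampleRate n B var * var * (((t : ℝ) + 2) ^ 3 / b)
        + var * (((t : ℝ) + 2) ^ 3 / a))) := by
  have h1 : ((t : ℝ) + 2) ^ (3 / 2 : ℝ) = Real.sqrt (((t : ℝ) + 2) ^ 3) := by
    rw [Real.sqrt_eq_rpow, ← Real.rpow_natCast, ← Real.rpow_mul (by positivity)]
    norm_num
  have hn' : (2 : ℝ) ≤ n := by exact_mod_cast hn
  have h2 : 0 ≤ 1 - 1 / (n : ℝ) := by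
    rw [sub_nonneg, div_le_one (by linarith)]; linarith
  rw [h1, quantSigma, ← Real.sqrt_mul (by positivity)]
  congr 1
  have h3 : sampleRate n B var * var = 2 * (1 - 1 / (n : ℝ)) * B ^ 2 / Real.exp 1 := by
    rw [sampleRate]; field_simp
  rw [h3, ← div_div]
  ring

/-- The parameters `β_t` grow, and they are of the order `L + (t + 1) / √q`. -/
theorem betaSeq_bounds (hn : 2 ≤ n) (hB : 0 < B) (hvar : 0 < var) (hR : 0 < R) (hq : 1 ≤ q)
    (hq' : 1 + sampleRate n B var ≤ sampleRate n B var * q)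
    (hr : ∀ t, r t = ⌈max 1 (q * (t + 1))⌉₊) :
    Monotone (betaSeq n B var L R r (sampleSeq n B var r)) ∧
    (∀ t : ℕ, L + 5 * Real.sqrt var / ((2 : ℝ) ^ (1 / 4 : ℝ) * Real.sqrt 3 * R)
        * ((t + 1) * (1 / Real.sqrt q)) ≤ betaSeq n B var L R r (sampleSeq n B var r) t) ∧
    (∀ t : ℕ, betaSeq n B var L R r (sampleSeq n B var r) t ≤
      L + Real.sqrt (800 * var) / ((2 : ℝ) ^ (1 / 4 : ℝ) * Real.sqrt 3 * R)
        * ((t + 1) * (1 / Real.sqrt q))) := by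
  have hc := sampleRate_pos hn hB hvar
  set c₀ := sampleRate n B var
  set D := (2 : ℝ) ^ (1 / 4 : ℝ) * Real.sqrt 3 * R with hD
  have hD0 : 0 < D := by positivity
  have hq0 : 0 < q := one_pos.trans_le hq
  set M := sampleSeq n B var r with hM
  have hr1 : ∀ t, q * (t + 1) ≤ r t := mul_le_batch hr
  have hr2 : ∀ t, (r t : ℝ) ≤ q * (t + 1) + 1 := batch_le hq hr
  have hM1 : ∀ t, c₀ * r t ≤ M t := mul_le_sampleSeq
  have hM2 : ∀ t, (M t : ℝ) ≤ c₀ * r t + 1 := sampleSeq_le hc.le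
  have hr0 : ∀ t, (0 : ℝ) < r t := fun t => lt_of_lt_of_le (by positivity) (hr1 t)
  have hM0 : ∀ t, (0 : ℝ) < M t := fun t => lt_of_lt_of_le (mul_pos hc (hr0 t)) (hM1 t)
  have hmr : Monotone fun t : ℕ => ((t : ℝ) + 2) ^ 3 / (r t : ℝ) :=
    cube_div_monotone hq0 hr1 fun t => (hr2 t).trans (by linarith)
  -- The two roundings exceed c₀q(t + 1) by at most c₀ + 1, which is at most c₀q by `hq'`.
  have hmM : Monotone fun t : ℕ => ((t : ℝ) + 2) ^ 3 / (M t : ℝ) := by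
    refine cube_div_monotone (mul_pos hc hq0) (fun t => ?_) fun t => ?_
    · exact le_trans (by rw [mul_assoc]; exact mul_le_mul_of_nonneg_left (hr1 t) hc.le) (hM1 t)
    · have := mul_le_mul_of_nonneg_left (hr2 t) hc.le
      have := hM2 t
      linarith
  have hβ : ∀ t, betaSeq n B var L R r M t = L + Real.sqrt (50 * (c₀ * var *
      (((t : ℝ) + 2) ^ 3 / M t) + var * (((t : ℝ) + 2) ^ 3 / r t))) / D := fun t => by
    rw [betaSeq, quantSigma_mul_rpow hn hvar]
  have hcv : 0 < c₀ * var := mul_pos hc hvar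
  refine ⟨fun s t hst => ?_, fun t => ?_, fun t => ?_⟩
  · rw [hβ, hβ]
    have h1 := mul_le_mul_of_nonneg_left (hmM hst) hcv.le
    have h2 := mul_le_mul_of_nonneg_left (hmr hst) hvar.le
    dsimp only at h1 h2
    gcongr
  · rw [hβ, div_mul_eq_mul_div]
    have hkey : 5 * Real.sqrt var * ((t + 1) * (1 / Real.sqrt q)) ≤ Real.sqrt (50 * (c₀ * var *
      (((t : ℝ) + 2) ^ 3 / M t) + var * (((t : ℝ) + 2) ^ 3 / r t))) := by
      refine Real.le_sqrt_of_sq_le ?_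
      rw [mul_pow, mul_pow, mul_pow, div_pow, Real.sq_sqrt hvar.le, Real.sq_sqrt hq0.le]
      have h1 : ((t : ℝ) + 1) ^ 2 / (2 * q) ≤ ((t : ℝ) + 2) ^ 3 / r t := by
        rw [div_le_div_iff₀ (by positivity) (hr0 t)]
        have h3 : (r t : ℝ) ≤ 2 * q * (t + 1) := by
          have := hr2 t
          have : (1 : ℝ) ≤ q * (t + 1) := by
            have : (0 : ℝ) ≤ t := Nat.cast_nonneg t
            nlinarith
          linarith
        calc ((t : ℝ) + 1) ^ 2 * r t ≤ ((t : ℝ) + 1) ^ 2 * (2 * q * (t + 1)) := by gcongr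
          _ = ((t : ℝ) + 1) ^ 3 * (2 * q) := by ring
          _ ≤ ((t : ℝ) + 2) ^ 3 * (2 * q) := by gcongr; norm_num
      have h2 : 0 ≤ c₀ * var * (((t : ℝ) + 2) ^ 3 / M t) := by positivity
      have h3 := mul_le_mul_of_nonneg_left h1 hvar.le
      have h4 : 5 ^ 2 * var * (((t : ℝ) + 1) ^ 2 * (1 ^ 2 / q)) =
          50 * (var * (((t : ℝ) + 1) ^ 2 / (2 * q))) := by field_simp; ring
      rw [h4]
      linarith
    gcongr
  · rw [hβ, div_mul_eq_mul_div]
    -- The quantization part is at most the batch part and (t + 2)³ ≤ 8(t + 1)³, whence 800 = 50 · 2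
    -- · 8.
    have hkey : Real.sqrt (50 * (c₀ * var * (((t : ℝ) + 2) ^ 3 / M t)
        + var * (((t : ℝ) + 2) ^ 3 / r t))) ≤
        Real.sqrt (800 * var) * ((t + 1) * (1 / Real.sqrt q)) := by
      refine Real.sqrt_le_left (by positivity) |>.2 ?_
      rw [mul_pow, mul_pow, div_pow, Real.sq_sqrt (by positivity), Real.sq_sqrt hq0.le]
      have h1 : ((t : ℝ) + 2) ^ 3 / r t ≤ 8 * ((t : ℝ) + 1) ^ 2 / q := by
        rw [div_le_div_iff₀ (hr0 t) hq0]
        have ht : (0 : ℝ) ≤ t := Nat.cast_nonneg t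
        calc ((t : ℝ) + 2) ^ 3 * q ≤ (2 * ((t : ℝ) + 1)) ^ 3 * q := by gcongr; linarith
          _ = 8 * ((t : ℝ) + 1) ^ 2 * (q * (t + 1)) := by ring
          _ ≤ _ := by gcongr; exact hr1 t
      have h2 : c₀ * (((t : ℝ) + 2) ^ 3 / M t) ≤ ((t : ℝ) + 2) ^ 3 / r t := by
        rw [← mul_div_assoc, div_le_div_iff₀ (hM0 t) (hr0 t)]
        calc c₀ * ((t : ℝ) + 2) ^ 3 * r t = ((t : ℝ) + 2) ^ 3 * (c₀ * r t) := by ring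
          _ ≤ _ := by gcongr; exact hM1 t
      have h3 := mul_le_mul_of_nonneg_left h1 hvar.le
      have h4 := mul_le_mul_of_nonneg_left h2 hvar.le
      have h5 : 800 * var * (((t : ℝ) + 1) ^ 2 * (1 ^ 2 / q)) =
          100 * (var * (8 * ((t : ℝ) + 1) ^ 2 / q)) := by field_simp; ring
      rw [h5]
      linarith
    gcongr

/-- The variance proxy of the messages is of the order `1 / (q (t + 1))`. -/
lemma inv_batch_add_inv_sample_le (hc : 0 < sampleRate n B var) (hq : 0 < q)
    (hr : ∀ t, r t = ⌈max 1 (q * (t + 1))⌉₊) (k : ℕ) :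
    1 / (r k : ℝ) + 1 / (sampleSeq n B var r k : ℝ) ≤
      (1 + 1 / sampleRate n B var) * ((1 / Real.sqrt q) ^ 2 / (k + 1)) := by
  have h1 := mul_le_batch hr k
  have h2 := mul_le_sampleSeq (n := n) (B := B) (var := var) (r := r) k
  have h0 : 0 < q * ((k : ℝ) + 1) := by positivity
  have h3 : 1 / (r k : ℝ) ≤ 1 / (q * (k + 1)) := one_div_le_one_div_of_le h0 h1
  have h4 : 1 / (sampleSeq n B var r k : ℝ) ≤ 1 / (sampleRate n B var * (q * (k + 1))) :=
    one_div_le_one_div_of_le (by positivity)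
      ((mul_le_mul_of_nonneg_left h1 hc.le).trans h2)
  rw [div_pow, Real.sq_sqrt hq.le]
  refine (add_le_add h3 h4).trans (le_of_eq ?_)
  field_simp

variable {V : Type u} [Fintype V] [DecidableEq V] (G : SimpleGraph V) [DecidableRel G.Adj]

/-- The factor `q` for which the batch sizes are `max {1, q (t + 1)}`, rounded up. -/
noncomputable def batchRate (γ σi Bs J ε δ : ℝ) : ℝ :=
  34 * γ * σi ^ 2 / (2 * Real.sqrt 2) / ε * chiLap G
    * max (18 * constC2 δ)
        ((constC3 J δ
          + constC4 δ * (Real.sqrt ((Fintype.card V : ℝ) ^ 3 * lambdaTwo G) / (γ * Bs))) ^ 2)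

lemma batchSeq_eq (γ σi Bs J ε δ : ℝ) (t : ℕ) :
    batchSeq G γ σi Bs J ε δ t = ⌈max 1 (batchRate G γ σi Bs J ε δ * (t + 1))⌉₊ := by
  rw [batchSeq, batchRate, alphaSeq]
  congr 2
  ring

end Parameters

/-! ### The error of the method -/

section ErrorBound

set_option linter.unusedSectionVars false

variable {V : Type u} [Fintype V] {Ξ : Type v} {n : ℕ}

/-- Every iterate is a convex combination of oracle points. Being in S is essential, since a
relative interior point has a neighbourhood in the domain only within S. -/
lemma algorithm_x_mem {W : Matrix V V ℝ} {g : V → Vec n → Ξ → Vec n} {α β : ℕ → ℝ} {r M : ℕ → ℕ}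
    (hα : ∀ t, 0 < α t) (hr : ∀ t, r t ≠ 0) {S : AffineSubspace ℝ (Vec n)}
    (hg : ∀ i μ ξ, g i μ ξ ∈ S) (ω : Seeds V Ξ) (t : ℕ) (i : V) :
    (algorithm W g α β r M ω t).x i ∈ S := by
  have hS : Convex ℝ (S : Set (Vec n)) := S.convex
  have h1 : ∀ k, gradAt W g α β r M ω k i ∈ (S : Set (Vec n)) := fun k => by
    have : gradAt W g α β r M ω k i = ∑ s ∈ Finset.range (r k), (1 / (r k : ℝ)) •
        g i (queryPoint W g α β r M ω k i) (ω (k, i, s)).1 := by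
      rw [← Finset.smul_sum]; rfl
    rw [this]
    have hk : (r k : ℝ) ≠ 0 := Nat.cast_ne_zero.2 (hr k)
    refine hS.sum_mem (fun _ _ => by positivity) ?_ fun s _ => hg i _ _
    rw [Finset.sum_const, Finset.card_range, nsmul_eq_mul]
    field_simp
  have hpos : 0 < partialSum α t := Finset.sum_pos (fun k _ => hα k) ⟨0, by simp⟩
  have h2 : (algorithm W g α β r M ω t).x i =
      ∑ k ∈ Finset.range (t + 1), (α k / partialSum α t) • gradAt W g α β r M ω k i := by
    have h3 : (algorithm W g α β r M ω t).x = (partialSum α t)⁻¹ •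
        ∑ k ∈ Finset.range (t + 1), α k • gradAt W g α β r M ω k := by
      rw [← partialSum_smul_algorithm_x hα, smul_smul, inv_mul_cancel₀ hpos.ne', one_smul]
    rw [h3, Finset.smul_sum]
    simp only [PiLp.smul_apply, smul_smul, WithLp.ofLp_sum, Finset.sum_apply]
    refine Finset.sum_congr rfl fun k _ => ?_
    simp only [div_eq_inv_mul]
  rw [h2]
  refine hS.sum_mem (fun k _ => (div_pos (hα k) hpos).le) ?_ fun k _ => h1 k
  rw [← Finset.sum_div]
  exact div_self hpos.ne'

variable [DecidableEq V] {G : SimpleGraph V} [DecidableRel G.Adj] [MeasurableSpace Ξ]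
  {P : V → Measure Ξ} [∀ i, IsProbabilityMeasure (P i)] {γ σi B Bs : ℝ}
  {S : AffineSubspace ℝ (Vec n)} {X : V → Set (Vec n)} {f : V → Vec n → ℝ}
  {Y : V → Ξ → Set (Vec n)} {F : V → Ξ → Vec n → ℝ} {xs gs : Tab V n}

lemma IsDualOracle.isBoundedOracle (hγ : 0 < γ)
    (horacle : ∀ i, IsDualOracle (P i) S (X i) (f i) (Y i) (F i) σi B) {xb : V → Vec n → Vec n}
    (hxb : ∀ i, IsConjArgmax (X i) (f i) γ (xb i)) :
    IsBoundedOracle P (fun i => oracleGrad (Y i) (F i)) xb B :=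
  ⟨fun i => (horacle i).measurable_oracleGrad, fun i => (horacle i).bounded,
    fun i => (horacle i).integral_oracleGrad hγ (hxb i),
    fun i => (horacle i).measurable_argmax hγ (hxb i),
    fun i => (horacle i).norm_argmax_le hγ (hxb i)⟩

set_option maxHeartbeats 1000000 in
/-- The error of the method outside of an event of small probability. -/
theorem exists_error_bound (hG : G.Connected) (hV : 2 ≤ Fintype.card V) (hn : 2 ≤ n) (hγ : 0 < γ)
    (hσi : 0 < σi) (hB : 0 < B) (hBs : 0 < Bs)
    (hcl : ∀ i, IsClosed {p : Vec n × ℝ | p.1 ∈ X i ∧ f i p.1 ≤ p.2})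
    (hS : ∀ i, affineSpan ℝ (X i) = S)
    (hf : StrongConvexOn {x : Tab V n | ∀ i, x i ∈ X i} (γ / Fintype.card V) (objective f))
    (horacle : ∀ i, IsDualOracle (P i) S (X i) (f i) (Y i) (F i) σi B)
    (hxs0 : kronAct (sqrtLap G) xs = 0)
    (hmin : IsMinOn (objective f)
      {x : Tab V n | (∀ i, x i ∈ X i) ∧ kronAct (sqrtLap G) x = 0} xs)
    (hint : ∀ i, xs i ∈ intrinsicInterior ℝ (X i))
    (hgs : ∀ i, gs i ∈ S.direction ∧ HasGradientWithinAt (f i) (gs i) (X i) (xs i))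
    (hgsB : ∀ i, ‖gs i‖ ≤ Bs) :
    ∃ K η₀ : ℝ, 0 < K ∧ 0 < η₀ ∧ ∀ (q Lam η : ℝ) (r : ℕ → ℕ) (T : ℕ), 1 ≤ q →
      1 + sampleRate n B (dualVar G σi) ≤ sampleRate n B (dualVar G σi) * q → 1 ≤ Lam →
      (∀ t, r t = ⌈max 1 (q * (t + 1))⌉₊) →
      1 / ((T : ℝ) + 1) ^ 2 + Lam * (1 / Real.sqrt q) / (T + 1) = η → η ≤ η₀ →
      ∃ E : Set (Seeds V Ξ), MeasurableSet E ∧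
        seedMeasure P E ≤ ENNReal.ofReal
          (((T : ℝ) + 1) * (6 * Module.finrank ℝ (Tab V n) + 1) * Real.exp (-Lam)) ∧
        ∀ ω ∉ E, ∀ x : Tab V n, x = (algorithm (G.lapMatrix ℝ) (fun i => oracleGrad (Y i) (F i))
            alphaSeq (betaSeq n B (dualVar G σi) (dualL G γ) (dualR G Bs) r
              (sampleSeq n B (dualVar G σi) r)) r (sampleSeq n B (dualVar G σi) r) ω T).x →
          (∀ i, x i ∈ X i) ∧ objective f x - objective f xs ≤ K * η ∧
            ‖kronAct (sqrtLap G) x‖ ≤ K * η := by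
  have hmR : (2 : ℝ) ≤ Fintype.card V := by exact_mod_cast hV
  have hne : Nonempty V := hG.nonempty
  have ha₂ := lapNorm_pos hG hV
  have hl₂ := lambdaTwo_pos hG hV
  have hxsX : ∀ i, xs i ∈ X i := fun i => intrinsicInterior_subset (hint i)
  have hconv : ∀ i, StrongConvexOn (X i) γ (f i) := fun i => StrongConvexOn.component hxsX hf i
  have hsub : ∀ i, ∀ x ∈ X i, f i (xs i) + ⟪gs i, x - xs i⟫ + γ / 2 * ‖x - xs i‖ ^ 2 ≤ f i x :=
    fun i x hx => (hconv i).subgradient (hgs i).2 (hxsX i) hx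
  have hex : ∀ i, ∃ xb : Vec n → Vec n, IsConjArgmax (X i) (f i) γ xb := fun i => by
    choose xb h1 h2 h3 using exists_conj_argmax (hcl i) (hconv i) hγ (hxsX i) (hsub i)
    exact ⟨xb, fun μ => ⟨h1 μ, h2 μ, h3 μ⟩⟩
  choose xb hxb using hex
  have hIB := IsDualOracle.isBoundedOracle hγ horacle hxb
  obtain ⟨ls, hls⟩ := exists_kronAct_sqrtLap_eq hG gs
    (sum_gradient_eq_zero hG hS hxs0 hmin hint hgs)
  set g : V → Vec n → Ξ → Vec n := fun i => oracleGrad (Y i) (F i) with hgdef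
  set A := sqrtLap G with hAdef
  have hA : A.IsSymm := sqrtLap_isSymm G
  set a₂ := lapNorm G with ha₂def
  have hAn : ∀ x : Tab V n, ‖kronAct A x‖ ^ 2 ≤ a₂ * ‖x‖ ^ 2 := norm_sq_kronAct_sqrtLap_le G
  set L := dualL G γ with hLdef
  have hLval : L * γ = Fintype.card V * a₂ := by rw [hLdef, dualL, ha₂def]; field_simp
  have hL0 : 0 ≤ L := by rw [hLdef, dualL]; positivity
  -- The unnormalised dual sum is already ‖W‖₂/γ-smooth; the constant L of the method is larger by
  -- the factor m.
  have hLn : ∀ x : Tab V n, ‖kronAct A x‖ ^ 2 ≤ L * γ * ‖x‖ ^ 2 := fun x => by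
    refine (hAn x).trans (mul_le_mul_of_nonneg_right ?_ (by positivity))
    rw [hLval]
    exact le_mul_of_one_le_left ha₂.le (by linarith)
  set var := dualVar G σi with hvardef
  have hvar : 0 < var := by rw [hvardef, dualVar]; positivity
  set R := dualR G Bs with hRdef
  have hR : 0 < R := by rw [hRdef, dualR]; positivity
  have hc₀ := sampleRate_pos hn hB hvar
  set c₀ := sampleRate n B var
  set d := Module.finrank ℝ (Tab V n)
  set c : ℝ := (2 * n + 1) * B + 2 * B with hcdef
  have hc1 : (2 * n + 1) * B ≤ c := by linarith
  have hc2 : 2 * B ≤ c := by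
    have : 0 ≤ (2 * n + 1) * B := by positivity
    linarith
  set kv : ℝ := c ^ 2 / 2 * (1 + 1 / c₀) with hkvdef
  have hkv : 0 ≤ kv := by positivity
  set b₁ : ℝ := 5 * Real.sqrt var / ((2 : ℝ) ^ (1 / 4 : ℝ) * Real.sqrt 3 * R) with hb₁def
  have hb₁ : 0 < b₁ := by positivity
  set b₂ : ℝ := Real.sqrt (800 * var) / ((2 : ℝ) ^ (1 / 4 : ℝ) * Real.sqrt 3 * R) with hb₂def
  have hb₂ : 0 ≤ b₂ := by positivity
  set Kb : ℝ := a₂ * kv with hKbdef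
  have hKb : 0 ≤ Kb := by positivity
  set cc : ℝ := b₁ / (4 * (Kb + 1)) with hccdef
  have hcc : 0 < cc := by positivity
  have hccK : 4 * (cc * Kb) ≤ b₁ := by
    have : 4 * (cc * Kb) = b₁ * (Kb / (Kb + 1)) := by rw [hccdef]; field_simp
    rw [this]
    exact mul_le_of_le_one_right hb₁.le ((div_le_one (by positivity)).2 (by linarith))
  set Ka : ℝ := a₂ * (d * (kv + 1) ^ 2) with hKadef
  have hKa : 0 ≤ Ka := by positivity
  have hlsmin : ∀ l, dualFun X f A ls ≤ dualFun X f A l := fun l =>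
    (dualFun_le_neg_sum hA hxb hγ.le hxs0 hls hsub).trans
      (neg_sum_le_dualFun hA hxb hγ hxsX hxs0 l)
  set ρ := ‖ls‖ + 1 with hρdef
  have hρ : 0 ≤ ρ := by positivity
  obtain ⟨K₁, hK₁, hacc⟩ := exists_accelerated_error (dualFun_lower hA hxb hγ)
    (dualFun_upper hA hxb hγ hLn) hL0 hlsmin hb₁ hb₂ hKa hKb (Real.sqrt_nonneg Ka) hcc hccK hρ
  set K₂ : ℝ := 8 * (L * ρ ^ 2 / 2 + K₁) with hK₂def
  have hK₂ : 0 ≤ K₂ := by positivity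
  set K₃ : ℝ := 8 * Real.sqrt (d * (kv + 1) ^ 2) with hK₃def
  have hK₃ : 0 ≤ K₃ := by positivity
  have hlip := Filter.eventually_all.2 fun i =>
    (hconv i).eventually_lipschitz_above hγ.le (hS i) (hint i) (hgs i).2 (hgsB i)
  obtain ⟨r₀, hr₀lip, hr₀⟩ := (hlip.and self_mem_nhdsWithin).exists
  have hr₀ : 0 < r₀ := hr₀
  refine ⟨K₂ + (3 * Bs + 2) * K₃ + Real.sqrt a₂ * K₃ + 1,
    -- Below this threshold the averaged maximizers are within r₀ of the solution and the output is
    -- within r₀ of them, as the local Lipschitz bound requires.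
    min (γ * r₀ ^ 2 / (2 * (K₂ + 1))) (r₀ / (K₃ + 1)), by positivity, by positivity, ?_⟩
  intro q Lam η r T hq hqc hLam hr hη hηle
  have hq0 : 0 < q := one_pos.trans_le hq
  set M := sampleSeq n B var r with hMdef
  have hr0 : ∀ t, r t ≠ 0 := fun t => by
    have : (0 : ℝ) < r t := lt_of_lt_of_le (by positivity) (mul_le_batch hr t)
    exact_mod_cast this.ne'
  have hM0 : ∀ t, M t ≠ 0 := fun t => by
    have h1 : (0 : ℝ) < r t := lt_of_lt_of_le (by positivity) (mul_le_batch hr t)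
    have : (0 : ℝ) < M t := lt_of_lt_of_le (mul_pos hc₀ h1) (mul_le_sampleSeq t)
    exact_mod_cast this.ne'
  obtain ⟨hmono, hlo, hhi⟩ := betaSeq_bounds (L := L) hn hB hvar hR hq hqc hr
  set β := betaSeq n B var L R r M with hβdef
  set p := 1 / Real.sqrt q with hpdef
  have hp : 0 < p := by positivity
  have hv : ∀ k, c ^ 2 / 2 * (1 / r k + 1 / M k) ≤ kv * (p ^ 2 / (k + 1)) := fun k => by
    rw [hkvdef, mul_assoc]
    exact mul_le_mul_of_nonneg_left (inv_batch_add_inv_sample_le hc₀ hq0 hr k) (by positivity)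
  obtain ⟨E, hEm, hE, hgood⟩ := hIB.exists_good_event (β := β) hB.le hr0 hM0 hc1 hc2 hA
    (kronAct_sqrtLap_sqrtLap G) ha₂.le hAn alphaSeq_pos alphaSeq_le hkv hp hLam hcc hv ls T
  refine ⟨E, hEm, hE, fun ω hω xT hxT => ?_⟩
  obtain ⟨ga, gb, gc, gd⟩ := hgood ω hω
  have hA0 : 0 < partialSum alphaSeq T :=
    Finset.sum_pos (fun k _ => alphaSeq_pos k) ⟨0, by simp⟩
  have hAT := sq_le_partialSum_alphaSeq T
  have hT1 : (0 : ℝ) < (T : ℝ) + 1 := by positivity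
  have hη0 : 0 ≤ η := by rw [← hη]; positivity
  have hTη : ((T : ℝ) + 1) ^ 2 * η = 1 + Lam * ((T + 1) * p) := by
    rw [← hη]; field_simp
  have hbound : ∀ u : Tab V n, ‖u‖ ≤ ‖ls‖ + 1 →
      partialSum alphaSeq T * dualFun X f A (preLam (G.lapMatrix ℝ) A g alphaSeq β r M ω T) ≤
      ∑ k ∈ Finset.range (T + 1), alphaSeq k *
        (dualFun X f A (preQuery (G.lapMatrix ℝ) A g alphaSeq β r M ω k)
          + ⟪dualGrad xb A (preQuery (G.lapMatrix ℝ) A g alphaSeq β r M ω k),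
            u - preQuery (G.lapMatrix ℝ) A g alphaSeq β r M ω k⟫)
        + partialSum alphaSeq T * (K₂ * η) := by
    intro u hu
    have h1 := hacc alphaSeq β _ _ _ _ p Lam T alphaSeq_pos alphaSeq_le alphaSeq_sq_le hmono hp hLam
      hlo hhi (isAccelerated_pre ω) ga gb gc u hu
    have h2 : L * ρ ^ 2 / 2 + K₁ * Lam * ((T + 1) * p) ≤ partialSum alphaSeq T * (K₂ * η) := by
      have h3 : ((T : ℝ) + 1) ^ 2 / 8 * (K₂ * η) ≤ partialSum alphaSeq T * (K₂ * η) :=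
        mul_le_mul_of_nonneg_right hAT (by positivity)
      have h4 : ((T : ℝ) + 1) ^ 2 / 8 * (K₂ * η) =
          (L * ρ ^ 2 / 2 + K₁) * (((T : ℝ) + 1) ^ 2 * η) := by rw [hK₂def]; ring
      have h5 : 0 ≤ L * ρ ^ 2 / 2 * (Lam * ((T + 1) * p)) := by positivity
      rw [h4, hTη] at h3
      linarith
    linarith
  -- The noiseless counterpart of the output. Duality controls it, and the batch noise controls its
  -- distance to the output.
  set xbar : Tab V n := (partialSum alphaSeq T)⁻¹ • ∑ k ∈ Finset.range (T + 1), alphaSeq k •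
    tabArgmax xb (kronAct A (preQuery (G.lapMatrix ℝ) A g alphaSeq β r M ω k)) with hxbar
  obtain ⟨hbX, hbF, hbA, hbn⟩ := primal_of_dual (x := xbar) hA hxb hγ hconv hxsX hxs0 hls hsub
    alphaSeq_pos hbound (by rw [hxbar, smul_smul, mul_inv_cancel₀ hA0.ne', one_smul])
  have hshift : ‖xT - xbar‖ ≤ K₃ * η := by
    have h1 : partialSum alphaSeq T • (xT - xbar) = ∑ k ∈ Finset.range (T + 1), alphaSeq k •
        (gradAt (G.lapMatrix ℝ) g alphaSeq β r M ω k
          - tabArgmax xb (queryPoint (G.lapMatrix ℝ) g alphaSeq β r M ω k)) := by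
      rw [smul_sub, hxT, partialSum_smul_algorithm_x alphaSeq_pos, hxbar, smul_smul,
        mul_inv_cancel₀ hA0.ne', one_smul, ← Finset.sum_sub_distrib]
      refine Finset.sum_congr rfl fun k _ => ?_
      rw [kronAct_preQuery (kronAct_sqrtLap_sqrtLap G), smul_sub]
    have h2 : partialSum alphaSeq T * ‖xT - xbar‖ ≤
        Real.sqrt (d * (kv + 1) ^ 2) * Lam * ((T + 1) * p) := by
      rw [← h1, norm_smul, Real.norm_of_nonneg hA0.le] at gd
      exact gd
    have h3 : ((T : ℝ) + 1) ^ 2 / 8 * ‖xT - xbar‖ ≤ ((T : ℝ) + 1) ^ 2 / 8 * (K₃ * η) := by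
      have h4 : ((T : ℝ) + 1) ^ 2 / 8 * (K₃ * η) =
          Real.sqrt (d * (kv + 1) ^ 2) * (((T : ℝ) + 1) ^ 2 * η) := by rw [hK₃def]; ring
      rw [h4, hTη]
      have h5 := mul_le_mul_of_nonneg_right hAT (norm_nonneg (xT - xbar))
      have h6 := Real.sqrt_nonneg (d * (kv + 1) ^ 2)
      linarith
    exact le_of_mul_le_mul_left h3 (by positivity)
  have hη1 : K₂ * η ≤ γ / 2 * r₀ ^ 2 := by
    have h1 := hηle.trans (min_le_left _ _)
    rw [le_div_iff₀ (by positivity)] at h1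
    linarith
  have hη2 : K₃ * η ≤ r₀ := by
    have h1 := hηle.trans (min_le_right _ _)
    rw [le_div_iff₀ (by positivity)] at h1
    linarith
  have hxn : ‖xbar - xs‖ ≤ r₀ := by
    refine le_of_sq_le_sq ?_ hr₀.le
    exact le_of_mul_le_mul_left (hbn.trans hη1) (by positivity)
  have hcomp : ∀ (y : Tab V n) i, ‖y i‖ ≤ ‖y‖ := fun y i => PiLp.norm_apply_le y i
  have hpt : ∀ i, xT i ∈ X i ∧ f i (xT i) ≤ f i (xbar i) + (3 * Bs + 2) * ‖xT i - xbar i‖ :=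
    fun i => hr₀lip i (xbar i) (hbX i) ((hcomp (xbar - xs) i).trans hxn) (xT i)
      (hxT ▸ algorithm_x_mem alphaSeq_pos hr0
        (fun i μ ξ => (horacle i).dom_subset ξ ((horacle i).gradient_mem_and_lower μ ξ).1) ω T i)
      ((hcomp (xT - xbar) i).trans (hshift.trans hη2))
  have hBs' : 0 ≤ 3 * Bs + 2 := by linarith
  refine ⟨fun i => (hpt i).1, ?_, ?_⟩
  · have h1 : ∑ i, f i (xT i) ≤ ∑ i, f i (xbar i) + Fintype.card V * ((3 * Bs + 2) * (K₃ * η)) := by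
      have h2 : ∑ i, f i (xT i) ≤ ∑ i, (f i (xbar i) + (3 * Bs + 2) * (K₃ * η)) :=
        Finset.sum_le_sum fun i _ => (hpt i).2.trans (add_le_add le_rfl
          (mul_le_mul_of_nonneg_left ((hcomp (xT - xbar) i).trans hshift) hBs'))
      rwa [Finset.sum_add_distrib, Finset.sum_const, Finset.card_univ, nsmul_eq_mul] at h2
    rw [objective, objective, ← mul_sub, one_div, inv_mul_le_iff₀ (by linarith)]
    have h3 : K₂ * η ≤ Fintype.card V * (K₂ * η) :=
      le_mul_of_one_le_left (by positivity) (by linarith)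
    have h4 : 0 ≤ (Fintype.card V : ℝ) * (Real.sqrt a₂ * K₃ * η + η) := by positivity
    linarith
  · have h1 : kronAct A xT = kronAct A xbar + kronAct A (xT - xbar) := by
      rw [← kronAct_add, add_sub_cancel]
    have h2 : ‖kronAct A (xT - xbar)‖ ≤ Real.sqrt a₂ * ‖xT - xbar‖ := by
      refine le_of_sq_le_sq ?_ (by positivity)
      rw [mul_pow, Real.sq_sqrt ha₂.le]
      exact hAn _
    have h3 : Real.sqrt a₂ * ‖xT - xbar‖ ≤ Real.sqrt a₂ * (K₃ * η) := by gcongr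
    have h4 : 0 ≤ (3 * Bs + 2) * K₃ * η := by positivity
    rw [h1]
    have := norm_add_le (kronAct A xbar) (kronAct A (xT - xbar))
    linarith

end ErrorBound

/-! ### The size of the batches and the number of iterations -/

section Rates

lemma one_lt_log_five_div {δ : ℝ} (hδ : 0 < δ) (hδ1 : δ < 1) : 1 < Real.log (5 / δ) := by
  rw [Real.lt_log_iff_exp_lt (by positivity)]
  have h1 : (5 : ℝ) ≤ 5 / δ := by rw [le_div_iff₀ hδ]; linarith
  linarith [Real.exp_one_lt_d9]

/-- C₃ has the exact order of Jℓ. The lower bound gives batches large enough for accuracy, the upper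
one limits the number of bits. -/
lemma constC3_bounds {J δ : ℝ} (hJ : 1 ≤ J) (hδ : 0 < δ) (hδ1 : δ < 1) :
    J * Real.sqrt (3 * Real.log (5 / δ)) ≤ constC3 J δ ∧
      constC3 J δ ≤ 21 * (J * Real.sqrt (3 * Real.log (5 / δ))) := by
  have hl := one_lt_log_five_div hδ hδ1
  have hℓ : 1 ≤ Real.sqrt (3 * Real.log (5 / δ)) := Real.one_le_sqrt.2 (by linarith)
  rw [constC3, constC1]
  set ℓ := Real.sqrt (3 * Real.log (5 / δ))
  have h2 : (1 : ℝ) ≤ Real.sqrt 2 := Real.one_le_sqrt.2 (by norm_num)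
  have h3 : Real.sqrt 2 ≤ 3 / 2 := by
    rw [Real.sqrt_le_left (by norm_num)]; norm_num
  have hJℓ : J ≤ J * ℓ := le_mul_of_one_le_right (by linarith) hℓ
  have hℓJ : ℓ ≤ J * ℓ := le_mul_of_one_le_left (by linarith) hJ
  constructor
  · have h4 : (2 * J) * (1 + 2 * ℓ) ≤ (2 * J + Real.sqrt 2 - 1) * (Real.sqrt 2 + (Real.sqrt 2 + 1) * ℓ) := by
      refine mul_le_mul (by linarith) ?_ (by positivity) (by linarith)
      have : 2 * ℓ ≤ (Real.sqrt 2 + 1) * ℓ := by gcongr; linarith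
      linarith
    have h5 : 0 ≤ 2 * Real.sqrt 2 * J * (1 + ℓ) := by positivity
    nlinarith
  · have h4 : (2 * J + Real.sqrt 2 - 1) * (Real.sqrt 2 + (Real.sqrt 2 + 1) * ℓ) ≤
        (3 * J) * (2 + 3 * ℓ) := by
      refine mul_le_mul (by linarith) ?_ (by positivity) (by linarith)
      have : (Real.sqrt 2 + 1) * ℓ ≤ 3 * ℓ := by gcongr; linarith
      linarith
    have h5 : 2 * Real.sqrt 2 * J * (1 + ℓ) ≤ 3 * J * (1 + ℓ) := by gcongr; linarith
    nlinarith

variable {V : Type u} [Fintype V] [DecidableEq V] {G : SimpleGraph V} [DecidableRel G.Adj]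
  {γ σi Bs : ℝ}

/-- The factor in the batch sizes is of the order `J² log (5 / δ) / ε`. -/
lemma exists_batchRate_bounds (hG : G.Connected) (hV : 2 ≤ Fintype.card V) (hγ : 0 < γ)
    (hσi : 0 < σi) (hBs : 0 < Bs) :
    ∃ κ₁ κ₂ : ℝ, 0 < κ₁ ∧ 0 < κ₂ ∧ ∀ J ε δ : ℝ, 1 ≤ J → 0 < ε → 0 < δ → δ < 1 →
      κ₁ * (J ^ 2 * Real.log (5 / δ) / ε) ≤ batchRate G γ σi Bs J ε δ ∧
      batchRate G γ σi Bs J ε δ ≤ κ₂ * (J ^ 2 * Real.log (5 / δ) / ε) := by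
  have ha₂ := lapNorm_pos hG hV
  have hl₂ := lambdaTwo_pos hG hV
  have hχ : 0 < chiLap G := div_pos ha₂ hl₂
  set κ := 34 * γ * σi ^ 2 / (2 * Real.sqrt 2) * chiLap G with hκ
  have hκ0 : 0 < κ := by positivity
  set w := Real.sqrt ((Fintype.card V : ℝ) ^ 3 * lambdaTwo G) / (γ * Bs) with hw
  have hw0 : 0 ≤ w := by positivity
  refine ⟨κ * 3, κ * (36 + 3 * (21 + 4 * w) ^ 2), by positivity, by positivity,
    fun J ε δ hJ hε hδ hδ1 => ?_⟩
  have hl := one_lt_log_five_div hδ hδ1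
  have hℓ : 1 ≤ Real.sqrt (3 * Real.log (5 / δ)) := Real.one_le_sqrt.2 (by linarith)
  obtain ⟨hC1, hC2⟩ := constC3_bounds hJ hδ hδ1
  have hJ2 : 1 ≤ J ^ 2 := one_le_pow₀ hJ
  have hsq : (J * Real.sqrt (3 * Real.log (5 / δ))) ^ 2 = 3 * (J ^ 2 * Real.log (5 / δ)) := by
    rw [mul_pow, Real.sq_sqrt (by linarith)]; ring
  have hC4 : constC4 δ ≤ 4 * (J * Real.sqrt (3 * Real.log (5 / δ))) := by
    have h3 : Real.sqrt 2 ≤ 2 := by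
      rw [Real.sqrt_le_left (by norm_num)]; norm_num
    have hℓJ := le_mul_of_one_le_left (by linarith : 0 ≤ Real.sqrt (3 * Real.log (5 / δ))) hJ
    calc constC4 δ ≤ 2 * (1 + Real.sqrt (3 * Real.log (5 / δ))) := by
          rw [constC4]; gcongr
      _ ≤ _ := by linarith
  have hC40 : 0 ≤ constC4 δ := by rw [constC4]; positivity
  set Q := J * Real.sqrt (3 * Real.log (5 / δ)) with hQ
  have hQ0 : 0 ≤ Q := by positivity
  have hrate : batchRate G γ σi Bs J ε δ = κ / ε * max (18 * constC2 δ)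
      ((constC3 J δ + constC4 δ * w) ^ 2) := by
    rw [batchRate, hκ]; ring
  rw [hrate]
  constructor
  · have h1 : 3 * (J ^ 2 * Real.log (5 / δ)) ≤ max (18 * constC2 δ)
        ((constC3 J δ + constC4 δ * w) ^ 2) := by
      refine le_trans ?_ (le_max_right _ _)
      rw [← hsq]
      exact pow_le_pow_left₀ hQ0 (hC1.trans (le_add_of_nonneg_right (by positivity))) 2
    calc κ * 3 * (J ^ 2 * Real.log (5 / δ) / ε) = κ / ε * (3 * (J ^ 2 * Real.log (5 / δ))) := by ring
      _ ≤ _ := by gcongr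
  · have h1 : max (18 * constC2 δ) ((constC3 J δ + constC4 δ * w) ^ 2) ≤
        (36 + 3 * (21 + 4 * w) ^ 2) * (J ^ 2 * Real.log (5 / δ)) := by
      have h0 : Real.log (5 / δ) ≤ J ^ 2 * Real.log (5 / δ) :=
        le_mul_of_one_le_left (by linarith) hJ2
      refine max_le ?_ ?_
      · rw [constC2]
        have : 0 ≤ 3 * (21 + 4 * w) ^ 2 * (J ^ 2 * Real.log (5 / δ)) := by positivity
        linarith
      · have h2 : constC3 J δ + constC4 δ * w ≤ (21 + 4 * w) * Q := by
          have := mul_le_mul_of_nonneg_right hC4 hw0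
          linarith
        have h3 : (constC3 J δ + constC4 δ * w) ^ 2 ≤ ((21 + 4 * w) * Q) ^ 2 :=
          pow_le_pow_left₀ (by linarith [mul_nonneg hC40 hw0]) h2 2
        rw [mul_pow, hsq] at h3
        have : 0 ≤ J ^ 2 * Real.log (5 / δ) := by positivity
        linarith
    calc κ / ε * max (18 * constC2 δ) ((constC3 J δ + constC4 δ * w) ^ 2)
        ≤ κ / ε * ((36 + 3 * (21 + 4 * w) ^ 2) * (J ^ 2 * Real.log (5 / δ))) := by gcongr
      _ = _ := by ring

/-- The logarithmic factor in the batch sizes after `T` iterations. -/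
noncomputable def logFactor (T : ℕ) : ℝ := 1 + Real.log (T + 1)

lemma one_le_logFactor (T : ℕ) : 1 ≤ logFactor T := by
  have : 0 ≤ Real.log ((T : ℝ) + 1) := Real.log_nonneg (by linarith [(Nat.cast_nonneg T : (0:ℝ) ≤ T)])
  rw [logFactor]; linarith

lemma tendsto_logFactor : Filter.Tendsto logFactor Filter.atTop Filter.atTop :=
  Filter.tendsto_atTop_add_const_left _ _ (Real.tendsto_log_atTop.comp
    (Filter.tendsto_atTop_add_const_right _ _ tendsto_natCast_atTop_atTop))

/-- The accuracy after the number of iterations chosen for small `ε`. -/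
lemma error_le_of_iterations {ε ℓ H K : ℝ} {T : ℕ} (hε : 0 < ε) (hℓ : 1 ≤ ℓ) (hH : 1 ≤ H)
    (hK : 0 ≤ K) (hT : Real.sqrt (ℓ / ε) * H ≤ T + 1) :
    1 / ((T : ℝ) + 1) ^ 2 + K * Real.sqrt (ε * ℓ) / (T + 1) ≤ (1 + K) * ε / H := by
  have hN : 0 < Real.sqrt (ℓ / ε) * H := by positivity
  have h1 : 1 / ((T : ℝ) + 1) ^ 2 ≤ 1 / (Real.sqrt (ℓ / ε) * H) ^ 2 := by gcongr
  have h2 : K * Real.sqrt (ε * ℓ) / (T + 1) ≤ K * Real.sqrt (ε * ℓ) / (Real.sqrt (ℓ / ε) * H) := by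
    gcongr
  have h3 : 1 / (Real.sqrt (ℓ / ε) * H) ^ 2 ≤ ε / H := by
    rw [mul_pow, Real.sq_sqrt (by positivity), div_mul_eq_mul_div, one_div_div]
    refine div_le_div_of_nonneg_left hε.le (by linarith) ?_
    nlinarith
  have h4 : K * Real.sqrt (ε * ℓ) / (Real.sqrt (ℓ / ε) * H) = K * ε / H := by
    have h5 : Real.sqrt (ε * ℓ) = ε * Real.sqrt (ℓ / ε) := by
      have : ε * ℓ = ε ^ 2 * (ℓ / ε) := by field_simp
      rw [this, Real.sqrt_mul (by positivity), Real.sqrt_sq hε.le]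
    rw [h5]
    have : Real.sqrt (ℓ / ε) ≠ 0 := by positivity
    field_simp
  rw [h4] at h2
  calc _ ≤ ε / H + K * ε / H := add_le_add (h1.trans h3) h2
    _ = _ := by ring

/-- The number of iterations chosen for small `ε` in terms of the logarithmic factor in the
complexity bound. -/
lemma iterations_bounds {ε δ : ℝ} (hε : 0 < ε) (hε1 : ε ≤ 1) (hδ : 0 < δ) (hδ1 : δ < 1) {T : ℕ}
    (hT : T = ⌈Real.sqrt (Real.log (5 / δ) / ε) * (1 + Real.log (1 / ε))⌉₊) {Γ : ℝ}
    (hΓ : Γ = 1 + Real.log (1 / ε) + Real.sqrt (Real.log (1 / δ))) :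
    ((T : ℝ) + 1) ^ 2 ≤ 18 * Γ ^ 4 / ε ∧ logFactor T ≤ 7 * Γ ∧ Real.log (5 / δ) ≤ 2 * Γ ^ 2 := by
  have hl := one_lt_log_five_div hδ hδ1
  set ℓ := Real.log (5 / δ) with hℓ
  have he : 0 ≤ Real.log (1 / ε) := Real.log_nonneg (by rw [le_div_iff₀ hε]; linarith)
  have hd : 0 ≤ Real.log (1 / δ) := Real.log_nonneg (by rw [le_div_iff₀ hδ]; linarith)
  have hs := Real.sqrt_nonneg (Real.log (1 / δ))
  have hΓ1 : 1 ≤ Γ := by linarith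
  have hH : 1 + Real.log (1 / ε) ≤ Γ := by linarith
  have hH1 : 1 ≤ 1 + Real.log (1 / ε) := by linarith
  set H := 1 + Real.log (1 / ε) with hHdef
  have hlog5 : Real.log 5 ≤ 2 := by
    rw [Real.log_le_iff_le_exp (by norm_num)]
    have h1 : Real.exp 2 = Real.exp 1 ^ 2 := by rw [← Real.exp_nat_mul]; norm_num
    rw [h1]
    nlinarith [Real.exp_one_gt_d9]
  have hℓ2 : ℓ ≤ 2 * Γ ^ 2 := by
    have h1 : ℓ = Real.log 5 + Real.log (1 / δ) := by
      rw [hℓ, ← Real.log_mul (by norm_num) (by positivity)]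
      congr 1; ring
    have h2 : Real.log (1 / δ) ≤ (Γ - 1) ^ 2 := by
      have : Real.sqrt (Real.log (1 / δ)) ≤ Γ - 1 := by linarith
      calc Real.log (1 / δ) = Real.sqrt (Real.log (1 / δ)) ^ 2 := (Real.sq_sqrt hd).symm
        _ ≤ _ := pow_le_pow_left₀ hs this 2
    nlinarith
  set N := Real.sqrt (ℓ / ε) * H with hN
  have hN1 : 1 ≤ N := by
    refine one_le_mul_of_one_le_of_one_le (Real.one_le_sqrt.2 ?_) hH1
    rw [le_div_iff₀ hε]; linarith
  have hTN : (T : ℝ) + 1 ≤ 3 * N := by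
    have := natCeil_le_add_one (by linarith : 0 ≤ N)
    rw [hT]; linarith
  refine ⟨?_, ?_, hℓ2⟩
  · calc ((T : ℝ) + 1) ^ 2 ≤ (3 * N) ^ 2 := by gcongr
      _ = 9 * (ℓ * H ^ 2) / ε := by
        rw [hN, mul_pow, mul_pow, Real.sq_sqrt (by positivity)]; ring
      _ ≤ 9 * ((2 * Γ ^ 2) * Γ ^ 2) / ε := by gcongr
      _ = _ := by ring
  · have h1 : Real.log ((T : ℝ) + 1) ≤ Real.log (3 * N) := Real.log_le_log (by positivity) hTN
    have h2 : Real.log (3 * N) = Real.log 3 + ((Real.log ℓ + Real.log (1 / ε)) / 2 + Real.log H) := by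
      have hsq : Real.sqrt (ℓ / ε) ≠ 0 := by positivity
      rw [Real.log_mul (by norm_num) (by linarith), hN, Real.log_mul hsq (by linarith),
        Real.log_sqrt (by positivity), ← Real.log_mul (by linarith) (by positivity),
        mul_one_div]
    have h3 : Real.log 3 ≤ 2 := (Real.log_le_log (by norm_num) (by norm_num)).trans hlog5
    have h4 : Real.log H ≤ Γ := (Real.log_le_self (by linarith)).trans hH
    -- Writing ln ℓ = 2 ln √ℓ ≤ 2√ℓ gives a bound linear in Γ, whereas ln ℓ ≤ ℓ would give a
    -- quadratic one.
    have h5 : Real.log ℓ ≤ 2 * (2 * Γ) := by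
      have h6 : Real.sqrt ℓ ≤ 2 * Γ := by
        rw [Real.sqrt_le_left (by linarith)]
        nlinarith
      have h7 := (Real.log_le_self (Real.sqrt_nonneg ℓ)).trans h6
      rw [Real.log_sqrt (by linarith)] at h7
      linarith
    rw [logFactor]
    linarith

variable {n flt : ℕ} {B q : ℝ}

/-- The number of bits in terms of the number of iterations and the batch sizes. -/
lemma bitsSent_le (hn : 2 ≤ n) (hB : 0 < B) {J ε δ : ℝ} (hvar : 0 < dualVar G σi)
    (hq : 1 ≤ batchRate G γ σi Bs J ε δ)
    (hqc : 1 + sampleRate n B (dualVar G σi) ≤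
      sampleRate n B (dualVar G σi) * batchRate G γ σi Bs J ε δ) (T : ℕ) (j : V) :
    bitsSent G flt n γ σi B Bs J ε δ T j ≤ (2 * flt + 4 * sampleRate n B (dualVar G σi)
      * Real.logb 2 n) * G.maxDegree * (batchRate G γ σi Bs J ε δ * (T + 1) ^ 2) := by
  have hc := sampleRate_pos hn hB hvar
  set c₀ := sampleRate n B (dualVar G σi)
  set q := batchRate G γ σi Bs J ε δ
  have hn' : (2 : ℝ) ≤ n := by exact_mod_cast hn
  have hlb : 0 ≤ Real.logb 2 n := Real.logb_nonneg (by norm_num) (by linarith)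
  have hr : ∀ t, batchSeq G γ σi Bs J ε δ t = ⌈max 1 (q * (t + 1))⌉₊ := batchSeq_eq G γ σi Bs J ε δ
  have hterm : ∀ t ∈ Finset.range (T + 1), (G.degree j : ℝ) *
      messageBits flt n (sampleSeq n B (dualVar G σi) (batchSeq G γ σi Bs J ε δ) t) ≤
      G.maxDegree * ((2 * flt + 4 * c₀ * Real.logb 2 n) * (q * (T + 1))) := by
    intro t ht
    have htT : (t : ℝ) ≤ T := by exact_mod_cast Nat.lt_succ_iff.1 (Finset.mem_range.1 ht)
    have ht0 : (0 : ℝ) ≤ t := Nat.cast_nonneg t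
    have h1 := sampleSeq_le (n := n) (B := B) (r := batchSeq G γ σi Bs J ε δ) hc.le t
    have h2 := mul_le_mul_of_nonneg_left (batch_le hq hr t) hc.le
    have h3 : (sampleSeq n B (dualVar G σi) (batchSeq G γ σi Bs J ε δ) t : ℝ) ≤
        2 * (c₀ * (q * (T + 1))) := by
      have h4 : c₀ * (q * (t + 1)) ≤ c₀ * (q * (T + 1)) := by gcongr
      have h5 : c₀ * q ≤ c₀ * q * (T + 1) := le_mul_of_one_le_right (by positivity) (by linarith)
      linarith
    have h6 : 1 ≤ q * ((T : ℝ) + 1) := one_le_mul_of_one_le_of_one_le hq (by linarith)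
    have hdeg : (G.degree j : ℝ) ≤ G.maxDegree := by exact_mod_cast G.degree_le_maxDegree j
    refine mul_le_mul hdeg ?_ (by rw [messageBits]; positivity) (by positivity)
    rw [messageBits]
    have h7 : (2 * flt : ℝ) ≤ 2 * flt * (q * (T + 1)) := le_mul_of_one_le_right (by positivity) h6
    have h8 := mul_le_mul_of_nonneg_right h3 hlb
    linarith
  refine (Finset.sum_le_sum hterm).trans (le_of_eq ?_)
  rw [Finset.sum_const, Finset.card_range, nsmul_eq_mul]
  push_cast
  ring

end Rates

/-! ### The main theorem -/

section Main

variable {V : Type u} [Fintype V] [DecidableEq V] {G : SimpleGraph V} [DecidableRel G.Adj]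
  {Ξ : Type v} [MeasurableSpace Ξ] {P : V → Measure Ξ} [∀ i, IsProbabilityMeasure (P i)] {n : ℕ}
  {γ σi B Bs : ℝ} {S : AffineSubspace ℝ (Vec n)} {X : V → Set (Vec n)} {f : V → Vec n → ℝ}
  {Y : V → Ξ → Set (Vec n)} {F : V → Ξ → Vec n → ℝ} {xs gs : Tab V n}

lemma one_sub_lt_measureReal_of_compl_subset {Ω : Type*} [MeasurableSpace Ω] {μ : Measure Ω}
    [IsProbabilityMeasure μ] {E A : Set Ω} {δ : ℝ} (hδ : 0 < δ) (hE : MeasurableSet E)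
    (hμ : μ E ≤ ENNReal.ofReal (δ / 2)) (hA : Eᶜ ⊆ A) : 1 - δ < μ.real A := by
  have h1 : μ.real E ≤ δ / 2 := ENNReal.toReal_le_of_le_ofReal (by linarith) hμ
  have h2 : μ.real Eᶜ = 1 - μ.real E := by rw [measureReal_compl hE, probReal_univ]
  have h3 : μ.real Eᶜ ≤ μ.real A := measureReal_mono hA
  linarith

/-- The method succeeds with high probability after sufficiently many iterations. -/
theorem exists_success (hG : G.Connected) (hV : 2 ≤ Fintype.card V) (hn : 2 ≤ n) (hγ : 0 < γ)
    (hσi : 0 < σi) (hB : 0 < B) (hBs : 0 < Bs)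
    (hcl : ∀ i, IsClosed {p : Vec n × ℝ | p.1 ∈ X i ∧ f i p.1 ≤ p.2})
    (hS : ∀ i, affineSpan ℝ (X i) = S)
    (hf : StrongConvexOn {x : Tab V n | ∀ i, x i ∈ X i} (γ / Fintype.card V) (objective f))
    (horacle : ∀ i, IsDualOracle (P i) S (X i) (f i) (Y i) (F i) σi B)
    (hxs0 : kronAct (sqrtLap G) xs = 0)
    (hmin : IsMinOn (objective f)
      {x : Tab V n | (∀ i, x i ∈ X i) ∧ kronAct (sqrtLap G) x = 0} xs)
    (hint : ∀ i, xs i ∈ intrinsicInterior ℝ (X i))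
    (hgs : ∀ i, gs i ∈ S.direction ∧ HasGradientWithinAt (f i) (gs i) (X i) (xs i))
    (hgsB : ∀ i, ‖gs i‖ ≤ Bs) :
    ∃ c K : ℝ, 0 < c ∧ 0 ≤ K ∧ ∀ (ε δ : ℝ) (T : ℕ), 0 < ε → 0 < δ → δ < 1 →
      1 ≤ batchRate G γ σi Bs (logFactor T) ε δ →
      1 + sampleRate n B (dualVar G σi) ≤
        sampleRate n B (dualVar G σi) * batchRate G γ σi Bs (logFactor T) ε δ →
      1 / ((T : ℝ) + 1) ^ 2 + K * Real.sqrt (ε * Real.log (5 / δ)) / (T + 1) ≤ c * min ε 1 →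
      1 - δ < (seedMeasure P).real {ω |
        let x := outputX G (fun i => oracleGrad (Y i) (F i)) γ σi B Bs (logFactor T) ε δ T ω
        (∀ i, x i ∈ X i) ∧ objective f x - objective f xs ≤ ε} ∧
      1 - δ < (seedMeasure P).real {ω |
        let x := outputX G (fun i => oracleGrad (Y i) (F i)) γ σi B Bs (logFactor T) ε δ T ω
        ‖kronAct (sqrtLap G) x‖ ≤ ε * Real.sqrt (2 * Fintype.card V) / Bs} := by
  have hprob : IsProbabilityMeasure (seedMeasure P) := by unfold seedMeasure; infer_instance
  obtain ⟨K, η₀, hK, hη₀, hmain⟩ := exists_error_bound hG hV hn hγ hσi hB hBs hcl hS hf horacle hxs0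
    hmin hint hgs hgsB
  obtain ⟨κ₁, κ₂, hκ₁, -, hrate⟩ := exists_batchRate_bounds (G := G) hG hV hγ hσi hBs
  have hm : (0 : ℝ) < Fintype.card V := by exact_mod_cast (by omega : 0 < Fintype.card V)
  set d := Module.finrank ℝ (Tab V n)
  have hdlog : 0 ≤ Real.log (18 * d + 3) := Real.log_nonneg (by
    have : (0 : ℝ) ≤ d := Nat.cast_nonneg d
    linarith)
  -- The three entries serve the local regime η ≤ η₀, the objective gap and the consensus violation.
  set c := min η₀ (min (1 / K) (Real.sqrt (2 * Fintype.card V) / (Bs * K))) with hc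
  have hc0 : 0 < c := by positivity
  refine ⟨c, (2 + Real.log (18 * d + 3)) / Real.sqrt κ₁, hc0, by positivity,
    fun ε δ T hε hδ hδ1 hq hqc herr => ?_⟩
  have hl := one_lt_log_five_div hδ hδ1
  have hJ := one_le_logFactor T
  set J := logFactor T with hJdef
  set q := batchRate G γ σi Bs J ε δ with hqdef
  have hq0 : 0 < q := one_pos.trans_le hq
  set ℓ := Real.log (5 / δ) with hℓ
  have hT1 : (1 : ℝ) ≤ (T : ℝ) + 1 := by linarith [(Nat.cast_nonneg T : (0 : ℝ) ≤ T)]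
  -- Since 18d + 3 = 3(6d + 1), the bad event has probability at most δ/3.
  set Lam := Real.log (((T : ℝ) + 1) * (18 * d + 3) / δ) with hLam
  have hd3 : (3 : ℝ) ≤ 18 * d + 3 := by linarith [(Nat.cast_nonneg d : (0 : ℝ) ≤ d)]
  have hpos : 0 < ((T : ℝ) + 1) * (18 * d + 3) / δ := by positivity
  have hLam1 : 1 ≤ Lam := by
    rw [hLam, Real.le_log_iff_exp_le hpos, le_div_iff₀ hδ]
    have h1 : (3 : ℝ) ≤ ((T : ℝ) + 1) * (18 * d + 3) := by nlinarith
    have h2 := Real.exp_one_lt_d9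
    nlinarith
  have hLamle : Lam ≤ (2 + Real.log (18 * d + 3)) * (J * ℓ) := by
    have h1 : Lam = Real.log ((T : ℝ) + 1) + Real.log (18 * d + 3) + Real.log (1 / δ) := by
      rw [hLam, ← Real.log_mul (by positivity) (by positivity),
        ← Real.log_mul (by positivity) (by positivity), mul_one_div]
    have h2 : Real.log (1 / δ) ≤ ℓ := Real.log_le_log (by positivity) (by gcongr; norm_num)
    have h3 : Real.log ((T : ℝ) + 1) ≤ J := by rw [hJdef, logFactor]; linarith
    have h4 : J ≤ J * ℓ := le_mul_of_one_le_right (by linarith) hl.le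
    have h5 : ℓ ≤ J * ℓ := le_mul_of_one_le_left (by linarith) hJ
    have h6 : Real.log (18 * d + 3) ≤ Real.log (18 * d + 3) * (J * ℓ) :=
      le_mul_of_one_le_right hdlog (by linarith)
    linarith
  -- The factor J² in q pays for the ln T of the union bound: the noise level no longer involves T.
  have hp : J * ℓ * (1 / Real.sqrt q) ≤ Real.sqrt (ε * ℓ) / Real.sqrt κ₁ := by
    have h1 := (hrate J ε δ hJ hε hδ hδ1).1
    rw [mul_one_div, div_le_div_iff₀ (by positivity) (by positivity)]
    have h2 : (J * ℓ) ^ 2 * κ₁ ≤ ε * ℓ * q := by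
      calc (J * ℓ) ^ 2 * κ₁ = ε * ℓ * (κ₁ * (J ^ 2 * ℓ / ε)) := by field_simp
        _ ≤ _ := by gcongr
    refine le_of_sq_le_sq ?_ (by positivity)
    rw [mul_pow _ (Real.sqrt κ₁), mul_pow _ (Real.sqrt q), Real.sq_sqrt hκ₁.le, Real.sq_sqrt (by positivity), Real.sq_sqrt hq0.le]
    exact h2
  set η := 1 / ((T : ℝ) + 1) ^ 2 + Lam * (1 / Real.sqrt q) / (T + 1) with hη
  have hηle : η ≤ c * min ε 1 := by
    refine le_trans ?_ herr
    have h1 : Lam * (1 / Real.sqrt q) ≤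
        (2 + Real.log (18 * d + 3)) / Real.sqrt κ₁ * Real.sqrt (ε * ℓ) := by
      calc Lam * (1 / Real.sqrt q) ≤ (2 + Real.log (18 * d + 3)) * (J * ℓ) * (1 / Real.sqrt q) := by
            gcongr
        _ = (2 + Real.log (18 * d + 3)) * (J * ℓ * (1 / Real.sqrt q)) := by ring
        _ ≤ (2 + Real.log (18 * d + 3)) * (Real.sqrt (ε * ℓ) / Real.sqrt κ₁) := by gcongr
        _ = _ := by ring
    rw [hη]
    gcongr
  have hη₀le : η ≤ η₀ := hηle.trans ((mul_le_of_le_one_right hc0.le (min_le_right _ _)).trans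
    (min_le_left _ _))
  have hηε : η ≤ c * ε := hηle.trans (mul_le_mul_of_nonneg_left (min_le_left _ _) hc0.le)
  have hKη : K * η ≤ ε := by
    have h1 : c * ε ≤ 1 / K * ε :=
      mul_le_mul_of_nonneg_right ((min_le_right _ _).trans (min_le_left _ _)) hε.le
    calc K * η ≤ K * (1 / K * ε) := mul_le_mul_of_nonneg_left (hηε.trans h1) hK.le
      _ = ε := by field_simp
  have hKη' : K * η ≤ ε * Real.sqrt (2 * Fintype.card V) / Bs := by
    have h1 : c * ε ≤ Real.sqrt (2 * Fintype.card V) / (Bs * K) * ε :=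
      mul_le_mul_of_nonneg_right ((min_le_right _ _).trans (min_le_right _ _)) hε.le
    calc K * η ≤ K * (Real.sqrt (2 * Fintype.card V) / (Bs * K) * ε) :=
          mul_le_mul_of_nonneg_left (hηε.trans h1) hK.le
      _ = _ := by field_simp
  obtain ⟨E, hEm, hE, hgood⟩ := hmain q Lam η (batchSeq G γ σi Bs J ε δ) T hq hqc hLam1
    (batchSeq_eq G γ σi Bs J ε δ) rfl hη₀le
  have hE2 : seedMeasure P E ≤ ENNReal.ofReal (δ / 2) := by
    refine hE.trans (ENNReal.ofReal_le_ofReal ?_)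
    rw [hLam, Real.exp_neg, Real.exp_log hpos, inv_div]
    have h1 : ((T : ℝ) + 1) * (6 * d + 1) * (δ / (((T : ℝ) + 1) * (18 * d + 3))) = δ / 3 := by
      have : (6 * d + 1 : ℝ) ≠ 0 := by positivity
      have h2 : (18 * d + 3 : ℝ) = 3 * (6 * d + 1) := by ring
      rw [h2]
      field_simp
    rw [h1]
    linarith
  have hx := fun ω hω => hgood ω hω _ rfl
  refine ⟨one_sub_lt_measureReal_of_compl_subset hδ hEm hE2 fun ω hω => ?_,
    one_sub_lt_measureReal_of_compl_subset hδ hEm hE2 fun ω hω => ?_⟩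
  · exact ⟨(hx ω hω).1, (hx ω hω).2.1.trans hKη⟩
  · exact (hx ω hω).2.2.trans hKη'

end Main
theorem mainTheorem5 :
    -- the constants `C`, `k` of the `Õ` bound and the polylogarithmic factor `J(T)` are absolute
    ∃ (C : ℝ) (k : ℕ) (J : ℕ → ℝ),
      (∀ T : ℕ, 0 ≤ J T ∧ J T ≤ C * (1 + Real.log (T + 1)) ^ k) ∧
      ∀ (V : Type u) [Fintype V] [DecidableEq V] (G : SimpleGraph V) [DecidableRel G.Adj]
        (Ξ : Type v) [MeasurableSpace Ξ]
        (P : V → Measure Ξ) [∀ i, IsProbabilityMeasure (P i)]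
        (n flt : ℕ) (γ σi B Bs : ℝ)
        -- the local functions `f i` with effective domains `X i`, all with affine hull `S`
        (S : AffineSubspace ℝ (Vec n)) (X : V → Set (Vec n)) (f : V → Vec n → ℝ)
        -- the local stochastic functions `F i ξ` with effective domains `Y i ξ`
        (Y : V → Ξ → Set (Vec n)) (F : V → Ξ → Vec n → ℝ)
        -- the solution and the gradients of the local functions there
        (xs gs : Tab V n),
        G.Connected → 2 ≤ Fintype.card V → 2 ≤ n →
        0 < γ → 0 < σi → 0 < B → 0 < Bs →
        (∀ i, IsClosed {p : Vec n × ℝ | p.1 ∈ X i ∧ f i p.1 ≤ p.2}) →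
        (∀ i, affineSpan ℝ (X i) = S) →
        StrongConvexOn {x : Tab V n | ∀ i, x i ∈ X i} (γ / Fintype.card V) (objective f) →
        (∀ i, IsDualOracle (P i) S (X i) (f i) (Y i) (F i) σi B) →
        -- `xs` solves the problem, lies in the (relative) interior of the domain, and the
        -- (tangential) gradients there are bounded by `Bs`
        kronAct (sqrtLap G) xs = 0 →
        IsMinOn (objective f)
          {x : Tab V n | (∀ i, x i ∈ X i) ∧ kronAct (sqrtLap G) x = 0} xs →
        (∀ i, xs i ∈ intrinsicInterior ℝ (X i)) →
        (∀ i, gs i ∈ S.direction ∧ HasGradientWithinAt (f i) (gs i) (X i) (xs i)) →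
        (∀ i, ‖gs i‖ ≤ Bs) →
        ∃ a : ℝ, 0 < a ∧ a < 1 ∧ ∀ ε δ : ℝ, 0 < ε → 0 < δ → δ < 1 → ∃ T : ℕ,
          1 - δ < (seedMeasure P).real {ω |
            let x := outputX G (fun i => oracleGrad (Y i) (F i)) γ σi B Bs (J T) ε δ T ω
            (∀ i, x i ∈ X i) ∧ objective f x - objective f xs ≤ ε} ∧
          1 - δ < (seedMeasure P).real {ω |
            let x := outputX G (fun i => oracleGrad (Y i) (F i)) γ σi B Bs (J T) ε δ T ω
            ‖kronAct (sqrtLap G) x‖ ≤ ε * Real.sqrt (2 * Fintype.card V) / Bs} ∧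
          (ε ≤ a → ∀ j : V,
            bitsSent G flt n γ σi B Bs (J T) ε δ T j ≤
              C * (1 + Real.log (1 / ε) + Real.sqrt (Real.log (1 / δ))) ^ k *
                (B ^ 2 * G.maxDegree * Real.log n *
                  max (1 / σi ^ 2 *
                      Real.sqrt (G.diam * Bs ^ 2 / (γ * ε * Fintype.card V * G.maxDegree)))
                    (max (G.diam * Bs ^ 2 / ε ^ 2)
                      ((Fintype.card V : ℝ) ^ 2 / (γ ^ 2 * ε ^ 2))))) := by

  -- Exponent 9: J² and ln(5/δ) each cost Γ², (T + 1)² costs Γ⁴, and one further Γ absorbs all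
  -- constants, which allows C = 1.
  refine ⟨1, 9, logFactor, fun T => ⟨zero_le_one.trans (one_le_logFactor T), ?_⟩, ?_⟩
  · rw [one_mul]
    exact le_self_pow₀ (one_le_logFactor T) (by norm_num)
  intro V _ _ G _ Ξ _ P _ n flt γ σi B Bs S X f Y F xs gs hG hV hn hγ hσi hB hBs hcl hS hf horacle
    hxs0 hmin hint hgs hgsB
  obtain ⟨c, K, hc, hK, hsucc⟩ := exists_success hG hV hn hγ hσi hB hBs hcl hS hf horacle hxs0 hmin
    hint hgs hgsB
  obtain ⟨κ₁, κ₂, hκ₁, hκ₂, hrate⟩ := exists_batchRate_bounds (G := G) hG hV hγ hσi hBs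
  have hm : (0 : ℝ) < Fintype.card V := by exact_mod_cast (by omega : 0 < Fintype.card V)
  have hn' : (2 : ℝ) ≤ n := by exact_mod_cast hn
  have hlogn : 0 < Real.log n := Real.log_pos (by linarith)
  have hvar : 0 < dualVar G σi := by
    have := lapNorm_pos hG hV
    rw [dualVar]; positivity
  have hc₀ := sampleRate_pos hn hB hvar
  set c₀ := sampleRate n B (dualVar G σi)
  -- A batch rate from which on both requirements of `exists_success` hold.
  set q₀ : ℝ := 1 + 1 / c₀ with hq₀
  have hq₀0 : 0 < q₀ := by positivity
  have hqgood : ∀ q, q₀ ≤ q → 1 ≤ q ∧ 1 + c₀ ≤ c₀ * q := fun q hq => by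
    refine ⟨le_trans (by rw [hq₀]; linarith [one_div_pos.2 hc₀]) hq, ?_⟩
    calc 1 + c₀ = c₀ * q₀ := by rw [hq₀]; field_simp; ring
      _ ≤ _ := by gcongr
  have hlb : 0 ≤ Real.logb 2 n := Real.logb_nonneg (by norm_num) (by linarith)
  set K₇ : ℝ := (2 * flt + 4 * c₀ * Real.logb 2 n) * (κ₂ * 98 * 18) with hK₇
  have hK₇0 : 0 ≤ K₇ := by positivity
  set D : ℝ := B ^ 2 * Real.log n * ((Fintype.card V : ℝ) ^ 2 / γ ^ 2) with hD
  have hD0 : 0 < D := by positivity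
  -- Once ln(1/ε) ≥ H₀, it exceeds both the constant in the error bound and the ratio K₇ / D of the
  -- actual to the permitted constant in the number of bits.
  set H₀ : ℝ := (1 + K) / c + K₇ / D with hH₀
  have hH₀0 : 0 ≤ H₀ := by positivity
  set a := min (Real.exp (-H₀)) (min (κ₁ / q₀) (1 / 2)) with ha
  have ha0 : 0 < a := by positivity
  have ha1 : a ≤ 1 / 2 := (min_le_right _ _).trans (min_le_right _ _)
  refine ⟨a, ha0, by linarith, fun ε δ hε hδ hδ1 => ?_⟩
  have hl := one_lt_log_five_div hδ hδ1
  rcases lt_or_ge a ε with hεa | hεa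
  -- For large ε only accuracy is claimed. As T grows the error tends to 0, and the batch rate
  -- becomes sufficient because J(T) is unbounded.
  · have hnat : Filter.Tendsto (fun T : ℕ => (T : ℝ) + 1) Filter.atTop Filter.atTop :=
      Filter.tendsto_atTop_add_const_right _ _ tendsto_natCast_atTop_atTop
    have h1 : Filter.Tendsto (fun T : ℕ => 1 / ((T : ℝ) + 1) ^ 2
        + K * Real.sqrt (ε * Real.log (5 / δ)) / (T + 1)) Filter.atTop (nhds (0 + 0)) :=
      (tendsto_const_nhds.div_atTop ((Filter.tendsto_pow_atTop two_ne_zero).comp hnat)).add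
        (tendsto_const_nhds.div_atTop hnat)
    rw [add_zero] at h1
    have h2 := h1.eventually_le_const (show 0 < c * min ε 1 by positivity)
    have h3 := tendsto_logFactor.eventually_ge_atTop (q₀ * ε / κ₁)
    obtain ⟨T, hT1, hT2⟩ := (h2.and h3).exists
    have hJ := one_le_logFactor T
    have hq : q₀ ≤ batchRate G γ σi Bs (logFactor T) ε δ := by
      refine le_trans ?_ (hrate _ ε δ hJ hε hδ hδ1).1
      rw [div_le_iff₀ hκ₁] at hT2
      rw [← mul_div_assoc, le_div_iff₀ hε]
      have h4 : logFactor T ≤ logFactor T ^ 2 * Real.log (5 / δ) :=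
        (le_self_pow₀ hJ two_ne_zero).trans (le_mul_of_one_le_right (by positivity) hl.le)
      have h5 := mul_le_mul_of_nonneg_left h4 hκ₁.le
      linarith
    obtain ⟨hs1, hs2⟩ := hsucc ε δ T hε hδ hδ1 (hqgood _ hq).1 (hqgood _ hq).2 hT1
    exact ⟨T, hs1, hs2, fun h => absurd h (not_le.2 hεa)⟩
  · have hε1 : ε ≤ 1 := by linarith
    -- The extra factor 1 + ln(1/ε) divides the error bound and so beats its problem-dependent
    -- constant.
    set T : ℕ := ⌈Real.sqrt (Real.log (5 / δ) / ε) * (1 + Real.log (1 / ε))⌉₊ with hT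
    set Γ := 1 + Real.log (1 / ε) + Real.sqrt (Real.log (1 / δ)) with hΓ
    have hH : H₀ ≤ Real.log (1 / ε) := by
      have h1 : ε ≤ Real.exp (-H₀) := hεa.trans (min_le_left _ _)
      have h2 := (Real.log_le_iff_le_exp hε).2 h1
      rw [one_div, Real.log_inv]
      linarith
    have hH1 : 1 ≤ 1 + Real.log (1 / ε) := by linarith
    have hΓH : 1 + Real.log (1 / ε) ≤ Γ := by
      rw [hΓ]; linarith [Real.sqrt_nonneg (Real.log (1 / δ))]
    have hJ := one_le_logFactor T
    obtain ⟨hb1, hb2, hb3⟩ := iterations_bounds hε hε1 hδ hδ1 hT hΓ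
    have hr := hrate (logFactor T) ε δ hJ hε hδ hδ1
    have hq : q₀ ≤ batchRate G γ σi Bs (logFactor T) ε δ := by
      refine le_trans ?_ hr.1
      have h1 : ε ≤ κ₁ / q₀ := hεa.trans ((min_le_right _ _).trans (min_le_left _ _))
      rw [le_div_iff₀ hq₀0] at h1
      rw [← mul_div_assoc, le_div_iff₀ hε]
      have h4 : 1 ≤ logFactor T ^ 2 * Real.log (5 / δ) :=
        one_le_mul_of_one_le_of_one_le (one_le_pow₀ hJ) hl.le
      have h5 := mul_le_mul_of_nonneg_left h4 hκ₁.le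
      linarith
    obtain ⟨hq1, hqc⟩ := hqgood _ hq
    have herr : 1 / ((T : ℝ) + 1) ^ 2 + K * Real.sqrt (ε * Real.log (5 / δ)) / (T + 1) ≤
        c * min ε 1 := by
      refine (error_le_of_iterations hε hl.le hH1 hK ?_).trans ?_
      · exact (Nat.le_ceil _).trans (by rw [← hT]; linarith)
      · rw [min_eq_left hε1, div_le_iff₀ (by linarith)]
        have h1 : (1 + K) / c ≤ 1 + Real.log (1 / ε) := by
          have : 0 ≤ K₇ / D := by positivity
          linarith
        rw [div_le_iff₀ hc] at h1
        calc (1 + K) * ε ≤ (1 + Real.log (1 / ε)) * c * ε := by gcongr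
          _ = _ := by ring
    obtain ⟨hs1, hs2⟩ := hsucc ε δ T hε hδ hδ1 hq1 hqc herr
    refine ⟨T, hs1, hs2, fun _ j => ?_⟩
    have hΓ0 : 0 < Γ := by linarith
    have hdeg : (0 : ℝ) ≤ G.maxDegree := Nat.cast_nonneg _
    have hqT : batchRate G γ σi Bs (logFactor T) ε δ * ((T : ℝ) + 1) ^ 2 ≤
        κ₂ * 98 * 18 * Γ ^ 8 / ε ^ 2 := by
      have h1 : logFactor T ^ 2 ≤ (7 * Γ) ^ 2 := by gcongr
      calc batchRate G γ σi Bs (logFactor T) ε δ * ((T : ℝ) + 1) ^ 2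
          ≤ κ₂ * (logFactor T ^ 2 * Real.log (5 / δ) / ε) * ((T : ℝ) + 1) ^ 2 := by
            gcongr; exact hr.2
        _ ≤ κ₂ * ((7 * Γ) ^ 2 * (2 * Γ ^ 2) / ε) * (18 * Γ ^ 4 / ε) := by gcongr
        _ = _ := by field_simp; ring
    have hbits := bitsSent_le (flt := flt) hn hB hvar hq1 hqc T j
    refine hbits.trans ?_
    have h2 : (2 * flt + 4 * c₀ * Real.logb 2 n) * G.maxDegree *
        (batchRate G γ σi Bs (logFactor T) ε δ * ((T : ℝ) + 1) ^ 2) ≤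
        K₇ * (G.maxDegree * Γ ^ 8 / ε ^ 2) := by
      calc (2 * flt + 4 * c₀ * Real.logb 2 n) * G.maxDegree *
            (batchRate G γ σi Bs (logFactor T) ε δ * ((T : ℝ) + 1) ^ 2)
          ≤ (2 * flt + 4 * c₀ * Real.logb 2 n) * G.maxDegree *
            (κ₂ * 98 * 18 * Γ ^ 8 / ε ^ 2) := by gcongr
        _ = _ := by rw [hK₇]; ring
    have h3 : K₇ ≤ Γ * D := by
      have h4 : K₇ / D ≤ Γ := by
        have : 0 ≤ (1 + K) / c := by positivity
        linarith
      rwa [div_le_iff₀ hD0] at h4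
    refine h2.trans ?_
    calc K₇ * (G.maxDegree * Γ ^ 8 / ε ^ 2) ≤ Γ * D * (G.maxDegree * Γ ^ 8 / ε ^ 2) := by gcongr
      _ = 1 * Γ ^ 9 * (B ^ 2 * G.maxDegree * Real.log n *
          ((Fintype.card V : ℝ) ^ 2 / (γ ^ 2 * ε ^ 2))) := by rw [hD]; field_simp
      _ ≤ _ := by
        refine mul_le_mul_of_nonneg_left (mul_le_mul_of_nonneg_left ?_ (by positivity))
          (by positivity)
        -- The third term of the maximum suffices.
        exact (le_max_right _ _).trans (le_max_right _ _)
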